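/- **Theorem (CLTs under Bernoulli thinning).** Let $\phi_1>0$, $\phi_2>0$, and let $m\ge\lfloor\phi_2\rfloor+1$ be an integer. Let $X$ be a Gaussian power-law random field on $\mathbb R^2$, i.e. a Gaussian intrinsic random function of order $k=\lfloor\phi_2\rfloor$ with generalized covariance $$K_{\phi_1,\phi_2}(h)=\phi_1\Gamma(-\phi_2)\|h\|^{2\phi_2}\ (\phi_2\notin\mathbb N),\qquad K_{\phi_1,\phi_2}(h)=\frac{2\phi_1(-1)^{\phi_2+1}}{\phi_2!}\|h\|^{2\phi_2}\log\|h\|\ (\phi_2\in\mathbb N):$$ for every finitely supported signed measure $\sum_x w_x\delta_x$ annihilating all polynomials of total degree at most $k$, $\sum_x w_xX(x)$ is Gaussian with mean $0$ and variance $\sum_{x,y}w_xw_yK_{\phi_1,\phi_2}(x-y)$. *Notation.* Let $\Lambda_n=\{0,\dots,n-1\}^2$, $N=n^2$, $c_a=(-1)^{a_1+a_2}\binom m{a_1}\binom m{a_2}$ for $a\in\{0,\dots,m\}^2$. For an array $x$ on $\Lambda_n$ and $j\in\{1,2\}$ put $(D_{[j]}x)_t=\sum_a c_a x_{t+ja}$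 for $t\in\Lambda_{n-jm}$, and let $Q_j(x)$ be the average of $(D_{[j]}x)_t^2$ over $t\in\Lambda_{n-jm}$. Let $a_m(s)=\sum_{a,b}c_ac_bK_{1,s}(b-a)$, $q_j=\phi_1a_m(\phi_2)j^{2\phi_2}$, $q=(q_1,q_2)$, and $$h(y_1,y_2)=\Bigl(\frac{y_1}{a_m(\frac12\log_2(y_2/y_1))},\ \tfrac12\log_2(y_2/y_1)\Bigr).$$ Let $f_0(\lambda)=2^{2\phi_2+2}\pi\,\Gamma(1+\phi_2)\,\phi_1\|\lambda\|^{-(2+2\phi_2)}$ (the spectral density of $X$ with respect to $(2\pi)^{-2}d\lambda$), $F(\lambda)=|1-e^{\mathrm i\lambda_1}|^{2m}|1-e^{\mathrm i\lambda_2}|^{2m}\sum_{k\in\mathbb Z^2}f_0(\lambda+2\pi k)$, $b_1\equiv1$, $b_2(\lambda)=\prod_{i=1}^2(2\cos(\lambda_i/2))^{2m}$, and $$\Sigma_{\ell r}=2\int_{(-\pi,\pi]^2}b_\ell b_rF^2\,\frac{d\lambda}{(2\pi)^2},\qquad J=\nabla h(q),\qquad K=\mathrm{diag}(1/\phi_1,1)\,J,\qquad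 \Omega=K\Sigma K^\top .$$ *Thinning.* For each $n$, the sites of $\Lambda_n$ are retained independently of each other and of $X$, each with probability $p_n\in(0,1]$, where $(1-p_n)\sqrt N\to0$. For an array $x$ let $\widetilde Q_j(x)$ be the average of $(D_{[j]}x)_t^2$ over those $t\in\Lambda_{n-jm}$ for which all sites $t+ja$, $a\in\{0,\dots,m\}^2$, are retained. The increasing-domain (ID) sample is $x_t=X(t)$, $t\in\Lambda_n$; write $\widetilde Q=(\widetilde Q_1,\widetilde Q_2)$ for it and $(\hat\phi_1,\hat\phi_2)=h(\widetilde Q)$. The fixed-domain (FD) sample is $x'_t=X(t/n)$, $t\in\Lambda_n$; write $\widetilde Q'=(\widetilde Q'_1,\widetilde Q'_2)$ for it, $(\hat\tau_1,\hat\tau_2)=h(\widetilde Q')$ and $\tau_1=\phi_1N^{-\phi_2}$. *Conclusion.* The full-grid statistics satisfy $\mathbb E\,Q_j(x)=q_j$ for the ID sample $x$ and all $n>2m$, $j=1,2$; and, as $n\to\infty$, the limits of the full-grid case hold with unchanged covariances: 1. (ID) $\sqrt N(\widetilde Q-q)\Rightarrow\mathcal N(0,\Sigma)$; 2. (ID)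 $\sqrt N(\hat\phi_1-\phi_1,\hat\phi_2-\phi_2)\Rightarrow\mathcal N(0,J\Sigma J^\top)$; 3. (ID) $\sqrt N(\hat\phi_1/\phi_1-1,\hat\phi_2-\phi_2)\Rightarrow\mathcal N(0,\Omega)$; 4. (FD) $\sqrt N(N^{\phi_2}\widetilde Q'-q)\Rightarrow\mathcal N(0,\Sigma)$; 5. (FD) $\sqrt N(\hat\tau_1/\tau_1-1,\hat\tau_2-\phi_2)\Rightarrow\mathcal N(0,\Omega)$; 6. (FD) $\sqrt N\bigl(N^{\hat\tau_2}\hat\tau_1/\phi_1-1-(\log N)(\hat\tau_2-\phi_2),\ \hat\tau_2-\phi_2\bigr)\Rightarrow\mathcal N(0,\Omega)$; 7. (FD) $\sqrt N\bigl(\log(N^{\hat\tau_2}\hat\tau_1/\phi_1)-(\log N)(\hat\tau_2-\phi_2),\ \hat\tau_2-\phi_2\bigr)\Rightarrow\mathcal N(0,\Omega)$. -/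

import Mathlib

open MeasureTheory ProbabilityTheory Filter Topology

noncomputable section

namespace ThinnedGrid

/-- The Euclidean plane `ℝ²`. -/
abbrev Plane : Type := EuclideanSpace ℝ (Fin 2)

/-- Lattice sites with nonnegative integer coordinates. -/
abbrev Site : Type := Fin 2 → ℕ

/-- A lattice site viewed as a point of the plane. -/
def toPlane (t : Site) : Plane := WithLp.toLp 2 (fun i => (t i : ℝ))

/-- The grid `Λ_n = {0, …, n-1}²`. -/
def grid (n : ℕ) : Finset Site := Fintype.piFinset (fun _ => Finset.range n)

/-! ### The power-law intrinsic random function -/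

/-- The power-law generalized covariance `K_{φ₁,φ₂}`: `φ₁ Γ(-φ₂) ‖h‖^{2φ₂}` if `φ₂` is not an
integer, and `2 φ₁ (-1)^{k+1} / k! ‖h‖^{2k} log ‖h‖` if `φ₂ = k` is a positive integer. -/
def powerLawCov (φ₁ φ₂ : ℝ) (h : Plane) : ℝ :=
  if (⌊φ₂⌋₊ : ℝ) = φ₂ then
    2 * φ₁ * (-1) ^ (⌊φ₂⌋₊ + 1) / (Nat.factorial ⌊φ₂⌋₊ : ℝ) * ‖h‖ ^ (2 * φ₂) * Real.log ‖h‖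
  else
    φ₁ * Real.Gamma (-φ₂) * ‖h‖ ^ (2 * φ₂)

/-- The finitely supported signed measure `∑_{x ∈ s} w x δ_x` annihilates all polynomials of total
degree at most `k`. -/
def Annihilates (k : ℕ) (s : Finset Plane) (w : Plane → ℝ) : Prop :=
  ∀ q : MvPolynomial (Fin 2) ℝ, q.totalDegree ≤ k →
    ∑ x ∈ s, w x * MvPolynomial.eval (fun i => x i) q = 0

/-- `X` is a Gaussian power-law random field on the plane: a Gaussian intrinsic random function of
order `⌊φ₂⌋` with generalized covariance `K_{φ₁,φ₂}`. Every linear functional of the field given by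
a finitely supported signed measure that annihilates the polynomials of degree at most `⌊φ₂⌋` is
centered Gaussian, its variance being the quadratic form of `K_{φ₁,φ₂}`. -/
structure IsPowerLawField {Ω : Type*} [MeasurableSpace Ω] (φ₁ φ₂ : ℝ) (X : Plane → Ω → ℝ)
    (P : Measure Ω) : Prop where
  measurable : ∀ x, Measurable (X x)
  law : ∀ (s : Finset Plane) (w : Plane → ℝ), Annihilates ⌊φ₂⌋₊ s w →
    HasLaw (fun ω => ∑ x ∈ s, w x * X x ω)
      (gaussianReal 0 (Real.toNNReal (∑ x ∈ s, ∑ y ∈ s, w x * w y * powerLawCov φ₁ φ₂ (x - y)))) P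

/-! ### Bilinear differences and quadratic variations -/

/-- The stencil `{0, …, m}²`. -/
def stencil (m : ℕ) : Finset Site := grid (m + 1)

/-- The coefficients `c_a = (-1)^{a₁+a₂} (m choose a₁) (m choose a₂)`. -/
def coeff (m : ℕ) (a : Site) : ℝ := ∏ i, ((-1) ^ (a i) * (Nat.choose m (a i) : ℝ))

/-- The `m`-th order bilinear difference with step `j` of an array of values, at site `t`. -/
def bilinDiff (m j : ℕ) (x : Site → ℝ) (t : Site) : ℝ :=
  ∑ a ∈ stencil m, coeff m a * x (t + j • a)

/-- The full-grid quadratic variation `Q_j`: the average of the squared differences over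
`Λ_{n-jm}`. -/
def quadVar (m j n : ℕ) (x : Site → ℝ) : ℝ :=
  (∑ t ∈ grid (n - j * m), (bilinDiff m j x t) ^ 2) / ((grid (n - j * m)).card : ℝ)

/-- The sites `t ∈ Λ_{n-jm}` all of whose stencil points are retained (`b = true`). -/
def keptSites (m j n : ℕ) (b : Site → Bool) : Finset Site :=
  (grid (n - j * m)).filter (fun t => ∀ a ∈ stencil m, b (t + j • a) = true)

/-- The quadratic variation of the thinned sample: differences touching a deleted site are
discarded, and the sum is divided by the number of differences that are left. -/
def thinnedQuadVar (m j n : ℕ) (b : Site → Bool) (x : Site → ℝ) : ℝ :=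
  (∑ t ∈ keptSites m j n b, (bilinDiff m j x t) ^ 2) / ((keptSites m j n b).card : ℝ)

/-- The pair `(Q₁, Q₂)` of the thinned sample. -/
def thinnedPair (m n : ℕ) (b : Site → Bool) (x : Site → ℝ) : Plane :=
  !₂[thinnedQuadVar m 1 n b x, thinnedQuadVar m 2 n b x]

/-- The scale function `a_m(s) = ∑_{a,b} c_a c_b K_{1,s}(b-a)`. -/
def scaleFun (m : ℕ) (s : ℝ) : ℝ :=
  ∑ a ∈ stencil m, ∑ b ∈ stencil m,
    coeff m a * coeff m b * powerLawCov 1 s (toPlane b - toPlane a)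

/-- The means `q_j = φ₁ a_m(φ₂) j^{2φ₂}`, `j = 1, 2`, of the quadratic variations. -/
def meanPair (m : ℕ) (φ₁ φ₂ : ℝ) : Plane :=
  !₂[φ₁ * scaleFun m φ₂, φ₁ * scaleFun m φ₂ * 2 ^ (2 * φ₂)]

/-- The moment map `h(y₁,y₂) = (y₁ / a_m(½ log₂(y₂/y₁)), ½ log₂(y₂/y₁))`; the method-of-moments
estimators are its value at `(Q₁, Q₂)`. -/
def momentMap (m : ℕ) (y : Plane) : Plane :=
  !₂[y 0 / scaleFun m (Real.logb 2 (y 1 / y 0) / 2), Real.logb 2 (y 1 / y 0) / 2]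

/-- The Jacobian matrix of a map of the plane. -/
def jacobian (f : Plane → Plane) (y : Plane) : Matrix (Fin 2) (Fin 2) ℝ :=
  Matrix.of (fun i j => (fderiv ℝ f y (EuclideanSpace.single j 1)) i)

/-! ### Spectra and asymptotic covariances -/

/-- The spectral density of the power-law field with respect to `(2π)⁻² dλ`. -/
def spectralDensity (φ₁ φ₂ : ℝ) (l : Plane) : ℝ :=
  2 ^ (2 * φ₂ + 2) * Real.pi * Real.Gamma (1 + φ₂) * φ₁ * ‖l‖ ^ (-(2 + 2 * φ₂))

/-- The aliased (lattice) spectral density `∑_{k ∈ ℤ²} f₀(λ + 2πk)`. -/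
def aliasedDensity (φ₁ φ₂ : ℝ) (l : Plane) : ℝ :=
  ∑' k : Fin 2 → ℤ,
    spectralDensity φ₁ φ₂ (l + (2 * Real.pi) • WithLp.toLp 2 (fun i => (k i : ℝ)))

/-- The symbol `g_m(λ) = (1-e^{iλ₁})^m (1-e^{iλ₂})^m` of the unit-step difference. -/
def symbol (m : ℕ) (l : Plane) : ℂ := ∏ i, (1 - Complex.exp (Complex.I * (l i : ℂ))) ^ m

/-- The spectral density `F = |g_m|² f₀^{lat}` of the unit-step `m`-th difference. -/
def filteredDensity (m : ℕ) (φ₁ φ₂ : ℝ) (l : Plane) : ℝ :=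
  ‖symbol m l‖ ^ 2 * aliasedDensity φ₁ φ₂ l

/-- The multipliers `b₁ = 1` and `b₂ = B_m = ∏ᵢ (2 cos(λᵢ/2))^{2m}`. -/
def multiplier (m : ℕ) (i : Fin 2) (l : Plane) : ℝ :=
  ![1, ∏ r, (2 * Real.cos (l r / 2)) ^ (2 * m)] i

/-- The torus `(-π, π]²`. -/
def torus : Set Plane := {l | ∀ i, l i ∈ Set.Ioc (-Real.pi) Real.pi}

/-- `Σ_{ℓr} = 2 ∫_{𝕋²} b_ℓ b_r F² (2π)⁻² dλ`. -/
def asympCov (m : ℕ) (φ₁ φ₂ : ℝ) : Matrix (Fin 2) (Fin 2) ℝ :=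
  Matrix.of (fun i j =>
    2 * ∫ l in torus, multiplier m i l * multiplier m j l * (filteredDensity m φ₁ φ₂ l) ^ 2
      * ((2 * Real.pi) ^ 2)⁻¹)

/-- The Jacobian `J` of the moment map at the vector of means. -/
def deltaJac (m : ℕ) (φ₁ φ₂ : ℝ) : Matrix (Fin 2) (Fin 2) ℝ :=
  jacobian (momentMap m) (meanPair m φ₁ φ₂)

/-- `J Σ Jᵀ`. -/
def deltaCov (m : ℕ) (φ₁ φ₂ : ℝ) : Matrix (Fin 2) (Fin 2) ℝ :=
  deltaJac m φ₁ φ₂ * asympCov m φ₁ φ₂ * (deltaJac m φ₁ φ₂).transpose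

/-- `K = diag(1/φ₁, 1) J`. -/
def ratioJac (m : ℕ) (φ₁ φ₂ : ℝ) : Matrix (Fin 2) (Fin 2) ℝ :=
  Matrix.diagonal ![1 / φ₁, 1] * deltaJac m φ₁ φ₂

/-- `Ω = K Σ Kᵀ`. -/
def ratioCov (m : ℕ) (φ₁ φ₂ : ℝ) : Matrix (Fin 2) (Fin 2) ℝ :=
  ratioJac m φ₁ φ₂ * asympCov m φ₁ φ₂ * (ratioJac m φ₁ φ₂).transpose

/-! ### Sampling designs, thinning, convergence in law -/

/-- The increasing-domain sample: the field on the unit lattice. -/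
def idSample {Ω : Type*} (X : Plane → Ω → ℝ) (ω : Ω) (t : Site) : ℝ := X (toPlane t) ω

/-- The fixed-domain sample: the field at the points `t / n`. -/
def fdSample {Ω : Type*} (X : Plane → Ω → ℝ) (n : ℕ) (ω : Ω) (t : Site) : ℝ :=
  X ((n : ℝ)⁻¹ • toPlane t) ω

/-- Bernoulli thinning: at stage `n` the sites of `Λ_n` are retained independently of each other
and of the field, each with probability `p n`; `B n t = true` means that `t` is retained. Nothing
is assumed about the joint law of different stages. -/
structure IsBernoulliThinning {Ω : Type*} [MeasurableSpace Ω] (p : ℕ → ℝ)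
    (B : ℕ → Site → Ω → Bool) (X : Plane → Ω → ℝ) (P : Measure Ω) : Prop where
  measurable : ∀ n, ∀ t ∈ grid n, Measurable (B n t)
  prob : ∀ n, ∀ t ∈ grid n, P.real {ω | B n t ω = true} = p n
  indep_sites : ∀ n, iIndepFun (fun (t : grid n) => B n t) P
  indep_field : ∀ n, IndepFun (fun ω (x : Plane) => X x ω) (fun ω (t : grid n) => B n t ω) P

/-- `Y_n ⇒ N(0, S)`. -/
def TendstoGaussian {Ω : Type*} [MeasurableSpace Ω] (P : Measure Ω) [IsProbabilityMeasure P]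
    (Y : ℕ → Ω → Plane) (S : Matrix (Fin 2) (Fin 2) ℝ) : Prop :=
  TendstoInDistribution Y atTop (id : Plane → Plane) (fun _ => P) (multivariateGaussian 0 S)

/-- The sample size `N = n²`. -/
def sampleSize (n : ℕ) : ℝ := (n : ℝ) ^ 2

/-- The pair `(Q̃₁, Q̃₂)` of the thinned increasing-domain sample. -/
def idPair {Ω : Type*} (m : ℕ) (X : Plane → Ω → ℝ) (B : ℕ → Site → Ω → Bool) (n : ℕ) (ω : Ω) :
    Plane :=
  thinnedPair m n (fun t => B n t ω) (idSample X ω)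

/-- The pair `(Q̃₁, Q̃₂)` of the thinned fixed-domain sample. -/
def fdPair {Ω : Type*} (m : ℕ) (X : Plane → Ω → ℝ) (B : ℕ → Site → Ω → Bool) (n : ℕ) (ω : Ω) :
    Plane :=
  thinnedPair m n (fun t => B n t ω) (fdSample X n ω)

/-- The estimators `(φ̂₁, φ̂₂)` from the thinned increasing-domain sample. -/
def idEst {Ω : Type*} (m : ℕ) (X : Plane → Ω → ℝ) (B : ℕ → Site → Ω → Bool) (n : ℕ) (ω : Ω) :
    Plane :=
  momentMap m (idPair m X B n ω)

/-- The estimators `(τ̂₁, τ̂₂)` from the thinned fixed-domain sample. -/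
def fdEst {Ω : Type*} (m : ℕ) (X : Plane → Ω → ℝ) (B : ℕ → Site → Ω → Bool) (n : ℕ) (ω : Ω) :
    Plane :=
  momentMap m (fdPair m X B n ω)

/-- The fixed-domain scale parameter `τ₁ = φ₁ N^{-φ₂}`. -/
def fdScale (φ₁ φ₂ : ℝ) (n : ℕ) : ℝ := φ₁ * sampleSize n ^ (-φ₂)

end ThinnedGrid

end

open ThinnedGrid

namespace ThinnedGrid

/-! ### Characteristic functions of Gaussian quadratic forms -/

/-! The differences of order `m` annihilate the polynomials on which the law of the field is
unspecified. On the unit lattice they form a centered stationary Gaussian array, and `Q₁`, `Q₂` are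
diagonal quadratic forms in it. Everything rests on one analytic fact: since `m > φ₂`, the zero of
the symbol at the origin absorbs the singularity of the spectral density, so the filtered density
`F` is bounded on the torus (`exists_filteredDensity_le`).

Two consequences give the full-grid limit. First, covariance matrices of distinct differences have
quadratic forms bounded uniformly in `n` (`exists_quadForm_covMatrix_le`). Second, by Parseval the
squared cross-covariances are summable over the lags, with sums `Σ_{ℓr}/2` (`hasSum_covFun_sq`).
After diagonalization a linear combination of the centered variations is `∑ μ_k (ξ_k² - 1)` with
independent standard normal `ξ_k`. The weights of the squares are `O(1/n)`, so `max |μ_k| → 0`,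
while `∑ μ_k²` converges to half the limiting variance. A third-order expansion of the
characteristic function of `ξ² - 1` then gives the normal limit (`charFun_gaussian_quadratic`,
`tendstoGaussian_fullPair`).

The field is given by its generalized covariance, not by a spectral density. The bridge is a Mellin
transform: if weights `W` have enough vanishing moments at the points `y`, then `∫ u^(-s-1) ∑ W
e^(-yu) du = ∑ W K_s(y)`, with one formula for the power kernel and the logarithmic kernel
(`integral_expSum`). The base range `-1 < s ≤ 0` is a Gamma or a Frullani integral, and integration
by parts raises `s` by one. Taking for `y` the squared distances makes each exponential a Fourier
transform of a heat kernel, and integrating over `u` produces the density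
(`spectral_representation`). The same representation shows that the scale function `a_m` is
differentiable, also at integers, and positive, as the delta method requires.

Thinning is negligible. A difference is lost with probability at most `(m+1)²(1 - p_n)`,
independently of its value, so the average weight of the lost differences, multiplied by `√N`, has
an expectation of order `√N(1 - p_n)`, which tends to zero (`lossWeight_mean`). Slutsky's theorem
transfers the full-grid limit (`tendstoGaussian_thinnedPair`).

The fixed-domain sample, multiplied by `n^φ₂`, is the unit-lattice sample of a rescaled field, which
is again a power-law field with the same parameters (`IsPowerLawField.rescale`). For this reason the
limit theorems are stated for a sequence of fields. The estimators follow by the delta method and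
the homogeneity of the moment map. For the plug-in forms put `δ = (log N)(τ̂₂ - φ₂)`: the normalized
scale is `e^δ τ̂₁/τ₁`, and the nonlinear remainder `√N(e^δ - 1 - δ)` is of order `(log N)²/√N`. -/

lemma norm_cexp_sub_taylor_two_le (x : ℝ) :
    ‖Complex.exp (x * Complex.I) - (1 + x * Complex.I - (x : ℂ) ^ 2 / 2)‖ ≤ 4 * |x| ^ 3 := by
  have hn : ‖(x : ℂ) * Complex.I‖ = |x| := by simp
  have hs : ∑ m ∈ Finset.range 3, ((x : ℂ) * Complex.I) ^ m / (m.factorial : ℂ)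
      = 1 + x * Complex.I - (x : ℂ) ^ 2 / 2 := by
    simp [Finset.sum_range_succ, mul_pow, Nat.factorial]
    ring
  -- For `|x| ≤ 1` the remainder of the exponential series carries the factor `e^|x| < 4`; for `|x|
  -- ≥ 1` the crude bound `1 + (1 + |x| + x²/2)` is already below `4|x|³`.
  rcases le_total |x| 1 with h | h
  · have h1 := Complex.norm_exp_sub_sum_le_norm_mul_exp ((x : ℂ) * Complex.I) 3
    rw [hs, hn] at h1
    have h2 : Real.exp |x| ≤ 4 := by
      have := Real.exp_le_exp.2 h
      have := Real.exp_one_lt_d9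
      linarith
    have h3 : 0 ≤ |x| ^ 3 := by positivity
    nlinarith
  · have h1 : ‖Complex.exp (x * Complex.I)‖ = 1 := Complex.norm_exp_ofReal_mul_I x
    have h2 : ‖(1 : ℂ) + x * Complex.I - (x : ℂ) ^ 2 / 2‖ ≤ 1 + |x| + |x| ^ 2 / 2 := by
      refine (norm_sub_le _ _).trans ?_
      refine add_le_add ((norm_add_le _ _).trans ?_) ?_
      · simp
      · simp
    have h3 := norm_sub_le (Complex.exp (x * Complex.I)) (1 + x * Complex.I - (x : ℂ) ^ 2 / 2)
    have h4 : 1 ≤ |x| ^ 3 := one_le_pow₀ h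
    have h5 : |x| ≤ |x| ^ 3 := le_self_pow₀ h (by norm_num)
    have h6 : |x| ^ 2 ≤ |x| ^ 3 := pow_le_pow_right₀ h (by norm_num)
    linarith

/-- The integrand is even, so this is twice a half-line integral, a multiple of `Γ(5/2)`. -/
lemma integral_pow_four_gaussianReal : ∫ x, x ^ 4 ∂(gaussianReal 0 1) = 3 := by
  rw [integral_gaussianReal_eq_integral_smul (by norm_num)]
  have h1 : ∀ x : ℝ, gaussianPDFReal 0 1 x • x ^ 4
      = (fun y : ℝ => (√(2 * Real.pi))⁻¹ * (y ^ (4 : ℝ) * Real.exp (-(1 / 2) * y ^ (2 : ℝ)))) |x| := by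
    intro x
    have e4 : |x| ^ (4 : ℝ) = x ^ 4 := by
      rw [show (4 : ℝ) = ((4 : ℕ) : ℝ) by norm_num, Real.rpow_natCast,
        Even.pow_abs (by decide)]
    simp only [gaussianPDFReal, smul_eq_mul, e4, Real.rpow_two, sq_abs, NNReal.coe_one, mul_one,
      sub_zero]
    rw [show -x ^ 2 / 2 = -(1 / 2) * x ^ 2 by ring]
    ring
  simp_rw [h1]
  rw [integral_comp_abs (f := fun y : ℝ => (√(2 * Real.pi))⁻¹ *
    (y ^ (4 : ℝ) * Real.exp (-(1 / 2) * y ^ (2 : ℝ)))), integral_const_mul,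
    integral_rpow_mul_exp_neg_mul_rpow (by norm_num) (by norm_num) (by norm_num)]
  have h2 : Real.Gamma ((4 + 1) / 2) = 3 * √Real.pi / 4 := by
    have := Real.Gamma_nat_add_half 2
    rw [show (4 + 1 : ℝ) / 2 = (2 : ℕ) + 1 / 2 by norm_num, this]
    norm_num [Nat.doubleFactorial]
  have h3 : (1 / 2 : ℝ) ^ (-(4 + 1 : ℝ) / 2) = 4 * √2 := by
    rw [one_div, Real.inv_rpow (by norm_num), ← Real.rpow_neg (by norm_num),
      show -(-(4 + 1 : ℝ) / 2) = (2 : ℕ) + 1 / 2 by norm_num,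
      Real.rpow_add (by norm_num), Real.rpow_natCast, Real.sqrt_eq_rpow]
    norm_num
  rw [h2, h3, Real.sqrt_mul (by norm_num)]
  have : √2 ≠ 0 := by positivity
  have : √Real.pi ≠ 0 := by positivity
  field_simp

lemma integral_sq_gaussianReal : ∫ x, x ^ 2 ∂(gaussianReal 0 1) = 1 := by
  have h := variance_id_gaussianReal (μ := 0) (v := 1)
  rw [variance_eq_integral (by fun_prop)] at h
  simpa using h

lemma integrable_pow_gaussianReal (n : ℕ) : Integrable (fun x : ℝ => x ^ n) (gaussianReal 0 1) := by
  have h := (memLp_id_gaussianReal (μ := 0) (v := 1) (n : NNReal)).integrable_norm_pow'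
  have h2 : Integrable (fun x : ℝ => ‖x‖ ^ n) (gaussianReal 0 1) := by simpa using h
  refine (integrable_norm_iff (by fun_prop)).1 ?_
  simpa [norm_pow] using h2

/-- Third order expansion of the characteristic function of a centered chi-square variable. -/
lemma exists_charFun_chiSq_bound : ∃ C : ℝ, 0 ≤ C ∧ ∀ θ : ℝ,
    ‖∫ x, Complex.exp ((θ * (x ^ 2 - 1) : ℝ) * Complex.I) ∂(gaussianReal 0 1)
      - Complex.exp (-(θ : ℂ) ^ 2)‖ ≤ C * (|θ| ^ 3 + θ ^ 4) := by
  have hint : Integrable (fun x : ℝ => |x ^ 2 - 1| ^ 3) (gaussianReal 0 1) := by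
    have : Integrable (fun x : ℝ => x ^ 6 - 3 * x ^ 4 + 3 * x ^ 2 - 1) (gaussianReal 0 1) :=
      (((integrable_pow_gaussianReal 6).sub ((integrable_pow_gaussianReal 4).const_mul 3)).add
        ((integrable_pow_gaussianReal 2).const_mul 3)).sub (integrable_const 1)
    refine this.abs.congr (ae_of_all _ fun x => ?_)
    simp only
    rw [← abs_pow]
    congr 1
    ring
  set M := ∫ x, |x ^ 2 - 1| ^ 3 ∂(gaussianReal 0 1) with hM
  have hM0 : 0 ≤ M := integral_nonneg fun x => by positivity
  -- `4M` comes from the second-order Taylor remainder, `M` being the third absolute moment of `x² -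
  -- 1`. The extra `1` pays for replacing `1 - θ²` by `e^(-θ²)`.
  refine ⟨4 * M + 1, by positivity, fun θ => ?_⟩
  have i2 := integrable_pow_gaussianReal 2
  have i4 := integrable_pow_gaussianReal 4
  have iq : Integrable (fun x : ℝ => (x ^ 2 - 1) ^ 2) (gaussianReal 0 1) := by
    refine ((i4.sub (i2.const_mul 2)).add (integrable_const 1)).congr (ae_of_all _ fun x => ?_)
    simp only [Pi.add_apply, Pi.sub_apply]
    ring
  have m1 : ∫ x, (x ^ 2 - 1) ∂(gaussianReal 0 1) = 0 := by
    rw [integral_sub i2 (integrable_const 1), integral_sq_gaussianReal]; simp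
  have m2 : ∫ x, (x ^ 2 - 1) ^ 2 ∂(gaussianReal 0 1) = 2 := by
    have : ∀ x : ℝ, (x ^ 2 - 1) ^ 2 = (x ^ 4 - 2 * x ^ 2) + 1 := fun x => by ring
    simp_rw [this]
    have i42 : Integrable (fun x : ℝ => x ^ 4 - 2 * x ^ 2) (gaussianReal 0 1) :=
      i4.sub (i2.const_mul 2)
    rw [integral_add i42 (integrable_const 1),
      integral_sub i4 (i2.const_mul 2), integral_const_mul, integral_sq_gaussianReal,
      integral_pow_four_gaussianReal]
    simp
    norm_num
  have iexp : Integrable (fun x : ℝ => Complex.exp ((θ * (x ^ 2 - 1) : ℝ) * Complex.I))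
      (gaussianReal 0 1) :=
    Integrable.of_bound (by fun_prop) 1 (ae_of_all _ fun x => by
      rw [Complex.norm_exp_ofReal_mul_I])
  have j1 : Integrable (fun x : ℝ => (1 : ℂ) + ((θ * (x ^ 2 - 1) : ℝ) : ℂ) * Complex.I)
      (gaussianReal 0 1) :=
    (integrable_const 1).add ((((i2.sub (integrable_const 1)).const_mul θ).ofReal).mul_const _)
  have j2 : Integrable (fun x : ℝ => ((θ * (x ^ 2 - 1) : ℝ) : ℂ) ^ 2 / 2) (gaussianReal 0 1) := by
    have := ((iq.const_mul (θ ^ 2)).div_const 2).ofReal (𝕜 := ℂ)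
    refine this.congr (ae_of_all _ fun x => ?_)
    push_cast
    ring_nf
    simp
  have itay : ∫ x : ℝ, ((1 : ℂ) + ((θ * (x ^ 2 - 1) : ℝ) : ℂ) * Complex.I
      - ((θ * (x ^ 2 - 1) : ℝ) : ℂ) ^ 2 / 2) ∂(gaussianReal 0 1) = 1 - (θ : ℂ) ^ 2 := by
    rw [integral_sub j1 j2, integral_add (integrable_const 1)
      ((((i2.sub (integrable_const 1)).const_mul θ).ofReal).mul_const _), integral_mul_const,
      integral_div]
    have e1 : ∫ x : ℝ, (((θ * (x ^ 2 - 1) : ℝ)) : ℂ) ∂(gaussianReal 0 1) = 0 := by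
      rw [integral_complex_ofReal, integral_const_mul, m1]; simp
    have e2 : ∫ x : ℝ, (((θ * (x ^ 2 - 1) : ℝ)) : ℂ) ^ 2 ∂(gaussianReal 0 1) = 2 * (θ : ℂ) ^ 2 := by
      have : ∀ x : ℝ, (((θ * (x ^ 2 - 1) : ℝ)) : ℂ) ^ 2 = ((θ ^ 2 * (x ^ 2 - 1) ^ 2 : ℝ) : ℂ) := by
        intro x; push_cast; ring
      simp_rw [this]
      rw [integral_complex_ofReal, integral_const_mul, m2]; push_cast; ring
    rw [e1, e2]
    simp
  have b1 : ‖∫ x, Complex.exp ((θ * (x ^ 2 - 1) : ℝ) * Complex.I) ∂(gaussianReal 0 1)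
      - (1 - (θ : ℂ) ^ 2)‖ ≤ 4 * M * |θ| ^ 3 := by
    have j12 : Integrable (fun x : ℝ => (1 : ℂ) + ((θ * (x ^ 2 - 1) : ℝ) : ℂ) * Complex.I
        - ((θ * (x ^ 2 - 1) : ℝ) : ℂ) ^ 2 / 2) (gaussianReal 0 1) := j1.sub j2
    rw [← itay, ← integral_sub iexp j12]
    have : 4 * M * |θ| ^ 3 = ∫ x, 4 * |θ| ^ 3 * |x ^ 2 - 1| ^ 3 ∂(gaussianReal 0 1) := by
      rw [integral_const_mul]; ring
    rw [this]
    refine norm_integral_le_of_norm_le (hint.const_mul _) (ae_of_all _ fun x => ?_)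
    refine (norm_cexp_sub_taylor_two_le _).trans (le_of_eq ?_)
    rw [abs_mul]; ring
  have b2 : ‖(1 - (θ : ℂ) ^ 2) - Complex.exp (-(θ : ℂ) ^ 2)‖ ≤ θ ^ 4 := by
    have : (1 - (θ : ℂ) ^ 2) - Complex.exp (-(θ : ℂ) ^ 2)
        = ((1 - θ ^ 2 - Real.exp (-θ ^ 2) : ℝ) : ℂ) := by push_cast; ring
    rw [this, Complex.norm_real, Real.norm_eq_abs]
    rcases le_total (θ ^ 2) 1 with h | h
    · have := Real.abs_exp_sub_one_sub_id_le (x := -θ ^ 2) (by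
        rw [abs_neg, abs_of_nonneg (sq_nonneg θ)]; exact h)
      rw [abs_sub_comm]
      calc _ = |Real.exp (-θ ^ 2) - 1 - -θ ^ 2| := by congr 1; ring
        _ ≤ _ := this
        _ = _ := by ring
    · have e1 : Real.exp (-θ ^ 2) ≤ 1 := Real.exp_le_one_iff.2 (by nlinarith)
      have e2 := Real.exp_pos (-θ ^ 2)
      rw [abs_le]
      constructor <;> nlinarith
  have e : ∀ a b c : ℂ, ‖a - c‖ ≤ ‖a - b‖ + ‖b - c‖ := fun a b c => norm_sub_le_norm_sub_add_norm_sub a b c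
  refine (e _ (1 - (θ : ℂ) ^ 2) _).trans ((add_le_add b1 b2).trans ?_)
  have : 0 ≤ |θ| ^ 3 := by positivity
  have : 0 ≤ θ ^ 4 := by positivity
  nlinarith

/-- Telescoping: the factors are exchanged one at a time, and the remaining ones have modulus at
most one. -/
lemma norm_prod_sub_prod_le {ι : Type*} (s : Finset ι) (a b : ι → ℂ)
    (ha : ∀ i ∈ s, ‖a i‖ ≤ 1) (hb : ∀ i ∈ s, ‖b i‖ ≤ 1) :
    ‖∏ i ∈ s, a i - ∏ i ∈ s, b i‖ ≤ ∑ i ∈ s, ‖a i - b i‖ := by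
  classical
  induction s using Finset.induction_on with
  | empty => simp
  | insert i s hi ih =>
    rw [Finset.prod_insert hi, Finset.prod_insert hi, Finset.sum_insert hi]
    have ih' := ih (fun j hj => ha j (Finset.mem_insert_of_mem hj))
      (fun j hj => hb j (Finset.mem_insert_of_mem hj))
    have hB : ‖∏ j ∈ s, b j‖ ≤ 1 := by
      rw [norm_prod]
      exact Finset.prod_le_one (fun j _ => norm_nonneg _)
        (fun j hj => hb j (Finset.mem_insert_of_mem hj))
    have hA := ha i (Finset.mem_insert_self _ _)
    calc ‖a i * ∏ j ∈ s, a j - b i * ∏ j ∈ s, b j‖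
        = ‖(a i - b i) * ∏ j ∈ s, b j + a i * (∏ j ∈ s, a j - ∏ j ∈ s, b j)‖ := by congr 1; ring
      _ ≤ ‖a i - b i‖ * ‖∏ j ∈ s, b j‖ + ‖a i‖ * ‖∏ j ∈ s, a j - ∏ j ∈ s, b j‖ := by
          refine (norm_add_le _ _).trans ?_
          rw [norm_mul, norm_mul]
      _ ≤ ‖a i - b i‖ * 1 + 1 * ∑ j ∈ s, ‖a j - b j‖ := by gcongr
      _ = _ := by ring

open Matrix in
/-- Quadratic forms in a standard Gaussian vector, in terms of a symmetric matrix whose quadratic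
form is bounded by `ρ`. -/
lemma charFun_stdGaussian_quadratic {ι : Type*} [Fintype ι] [DecidableEq ι] {C : ℝ} (hC0 : 0 ≤ C)
    (hC : ∀ θ : ℝ, ‖∫ x, Complex.exp ((θ * (x ^ 2 - 1) : ℝ) * Complex.I) ∂(gaussianReal 0 1)
      - Complex.exp (-(θ : ℂ) ^ 2)‖ ≤ C * (|θ| ^ 3 + θ ^ 4))
    (M : Matrix ι ι ℝ) (hM : M.IsHermitian) (ρ : ℝ)
    (hρ : ∀ x : EuclideanSpace ℝ ι, ‖x‖ = 1 → |x ⬝ᵥ M *ᵥ x| ≤ ρ) :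
    ‖∫ x : EuclideanSpace ℝ ι, Complex.exp ((x ⬝ᵥ M *ᵥ x - M.trace : ℝ) * Complex.I)
        ∂(stdGaussian (EuclideanSpace ℝ ι))
      - Complex.exp (-((M * M).trace : ℂ))‖ ≤ C * (ρ + ρ ^ 2) * (M * M).trace := by
  set b := hM.eigenvectorBasis
  set μ := hM.eigenvalues with hμ
  have hμρ : ∀ k, |μ k| ≤ ρ := by
    intro k
    have := hρ (b k) (b.orthonormal.1 k)
    rw [hμ, hM.eigenvalues_eq]
    simpa using this
  have htr : M.trace = ∑ k, μ k := by
    rw [hM.trace_eq_sum_eigenvalues]; rfl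
  have htr2 : (M * M).trace = ∑ k, μ k ^ 2 := by
    conv_lhs => rw [hM.spectral_theorem, ← map_mul]
    rw [Unitary.conjStarAlgAut_apply, Matrix.trace_mul_cycle, Unitary.coe_star_mul_self, one_mul,
      Matrix.diagonal_mul_diagonal, Matrix.trace_diagonal]
    simp [hμ, pow_two]
  have hquad : ∀ x : ι → ℝ, ((∑ k, x k • b k : EuclideanSpace ℝ ι) ⬝ᵥ
      M *ᵥ (∑ k, x k • b k : EuclideanSpace ℝ ι)) = ∑ k, μ k * x k ^ 2 := by
    intro x
    rw [← Matrix.inner_toEuclideanCLM, map_sum]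
    have : ∀ k, Matrix.toEuclideanCLM (𝕜 := ℝ) M (x k • b k) = (μ k * x k) • b k := by
      intro k
      rw [map_smul, mul_comm, mul_smul]
      congr 1
      apply WithLp.ofLp_injective
      rw [Matrix.ofLp_toEuclideanCLM]
      exact hM.mulVec_eigenvectorBasis k
    simp_rw [this]
    rw [b.orthonormal.inner_sum]
    simp only [conj_trivial]
    exact Finset.sum_congr rfl fun k _ => by ring
  -- By rotation invariance the coordinates in the eigenbasis are independent standard normal, so
  -- the characteristic function is a product over the eigenvalues.
  rw [stdGaussian_eq_map_pi_orthonormalBasis b,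
    integral_map (Measurable.aemeasurable (by fun_prop))
      (Continuous.aestronglyMeasurable (by fun_prop))]
  have h1 : ∀ x : ι → ℝ, Complex.exp (((((∑ k, x k • b k : EuclideanSpace ℝ ι) ⬝ᵥ
      M *ᵥ (∑ k, x k • b k : EuclideanSpace ℝ ι)) - M.trace : ℝ) : ℂ) * Complex.I)
      = ∏ k, Complex.exp ((μ k * (x k ^ 2 - 1) : ℝ) * Complex.I) := by
    intro x
    rw [hquad, htr, ← Complex.exp_sum, ← Finset.sum_mul, ← Complex.ofReal_sum,
      ← Finset.sum_sub_distrib]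
    congr 4
    ext k
    ring
  simp_rw [h1]
  rw [integral_fintype_prod_eq_prod
    (f := fun k (x : ℝ) => Complex.exp ((μ k * (x ^ 2 - 1) : ℝ) * Complex.I))]
  have h2 : Complex.exp (-((M * M).trace : ℂ)) = ∏ k, Complex.exp (-(μ k : ℂ) ^ 2) := by
    rw [htr2, ← Complex.exp_sum, Finset.sum_neg_distrib]
    push_cast
    rfl
  rw [h2]
  refine (norm_prod_sub_prod_le _ _ _ ?_ ?_).trans ?_
  · intro k _
    refine (norm_integral_le_integral_norm _).trans ?_
    simp_rw [Complex.norm_exp_ofReal_mul_I]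
    simp
  · intro k _
    rw [show -(μ k : ℂ) ^ 2 = ((-μ k ^ 2 : ℝ) : ℂ) by push_cast; ring, ← Complex.ofReal_exp,
      Complex.norm_real, Real.norm_eq_abs, abs_of_pos (Real.exp_pos _)]
    exact Real.exp_le_one_iff.2 (by nlinarith [sq_nonneg (μ k)])
  · rw [htr2, Finset.mul_sum]
    refine Finset.sum_le_sum fun k _ => (hC _).trans ?_
    rw [mul_assoc]
    refine mul_le_mul_of_nonneg_left ?_ hC0
    have h3 := hμρ k
    have h4 : 0 ≤ |μ k| := abs_nonneg _
    have h5 : |μ k| ^ 2 = μ k ^ 2 := sq_abs _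
    calc |μ k| ^ 3 + μ k ^ 4 = (|μ k| + |μ k| ^ 2) * μ k ^ 2 := by rw [← h5]; rw [show μ k ^ 4 = (μ k ^ 2) ^ 2 by ring, ← h5]; ring
      _ ≤ (ρ + ρ ^ 2) * μ k ^ 2 := by gcongr

open Matrix in
/-- A random vector all of whose linear combinations are centered Gaussian, with variances given by
a matrix, follows the multivariate Gaussian law. -/
lemma map_eq_multivariateGaussian {Ω ι : Type*} [MeasurableSpace Ω] {P : Measure Ω}
    [IsProbabilityMeasure P] [Fintype ι] [DecidableEq ι] (V : ι → Ω → ℝ)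
    (hV : ∀ i, Measurable (V i)) (R : Matrix ι ι ℝ) (hR : R.PosSemidef)
    (hlaw : ∀ v : ι → ℝ, HasLaw (fun ω => ∑ i, v i * V i ω)
      (gaussianReal 0 (Real.toNNReal (v ⬝ᵥ R *ᵥ v))) P) :
    P.map (fun ω => WithLp.toLp 2 (fun i => V i ω)) = multivariateGaussian 0 R := by
  have hm : Measurable (fun ω => WithLp.toLp 2 (fun i => V i ω)) := by fun_prop
  have : IsProbabilityMeasure (P.map (fun ω => WithLp.toLp 2 (fun i => V i ω))) :=
    Measure.isProbabilityMeasure_map hm.aemeasurable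
  refine Measure.ext_of_charFun (funext fun t => ?_)
  rw [charFun_multivariateGaussian hR, charFun_apply, integral_map hm.aemeasurable (by fun_prop)]
  have h := (hlaw t).integral_comp (f := fun x : ℝ => Complex.exp ((1 : ℝ) * x * Complex.I))
    (by fun_prop)
  rw [← charFun_apply_real, charFun_gaussianReal] at h
  have h0 : 0 ≤ (t : ι → ℝ) ⬝ᵥ R *ᵥ t := by simpa using hR.dotProduct_mulVec_nonneg (t : ι → ℝ)
  simp only [Real.coe_toNNReal _ h0] at h
  convert h using 1
  · refine integral_congr_ae (ae_of_all _ fun ω => ?_)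
    simp [PiLp.inner_apply, Function.comp]
  · simp

open Matrix in
/-- The characteristic function of a centered diagonal quadratic form in a Gaussian vector is close
to that of a normal variable when the form is spread out. -/
lemma charFun_gaussian_quadratic {C : ℝ} (hC0 : 0 ≤ C)
    (hC : ∀ θ : ℝ, ‖∫ x, Complex.exp ((θ * (x ^ 2 - 1) : ℝ) * Complex.I) ∂(gaussianReal 0 1)
      - Complex.exp (-(θ : ℂ) ^ 2)‖ ≤ C * (|θ| ^ 3 + θ ^ 4))
    {Ω ι : Type*} [MeasurableSpace Ω] {P : Measure Ω}
    [IsProbabilityMeasure P] [Fintype ι] [DecidableEq ι] (V : ι → Ω → ℝ)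
    (hV : ∀ i, Measurable (V i)) (R : Matrix ι ι ℝ) (hR : R.PosSemidef)
    (hlaw : ∀ v : ι → ℝ, HasLaw (fun ω => ∑ i, v i * V i ω)
      (gaussianReal 0 (Real.toNNReal (v ⬝ᵥ R *ᵥ v))) P)
    (A : ι → ℝ) (α κ : ℝ) (hα : ∀ i, |A i| ≤ α) (hα0 : 0 ≤ α)
    (hκ : ∀ v : ι → ℝ, v ⬝ᵥ R *ᵥ v ≤ κ * ∑ i, v i ^ 2) :
    ‖∫ ω, Complex.exp ((∑ i, A i * (V i ω ^ 2 - R i i) : ℝ) * Complex.I) ∂P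
      - Complex.exp (-((∑ i, ∑ j, A i * A j * R i j ^ 2 : ℝ) : ℂ))‖
      ≤ C * (α * κ + (α * κ) ^ 2) * ∑ i, ∑ j, A i * A j * R i j ^ 2 := by
  -- With `S` the square root of `R`, the vector is distributed as `S ξ` for a standard normal `ξ`,
  -- and the diagonal form becomes the form of `S diag(A) S`. Cyclicity of the trace then removes
  -- `S` from both traces that are needed.
  open scoped MatrixOrder in
  set S := CFC.sqrt R with hS
  have hSS : S * S = R := by
    open scoped MatrixOrder in exact CFC.sqrt_mul_sqrt_self _ hR.nonneg
  have hSh : S.IsHermitian := by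
    open scoped MatrixOrder in exact (CFC.sqrt_nonneg R).isSelfAdjoint
  have hSt : Sᵀ = S := by rwa [Matrix.IsHermitian, conjTranspose_eq_transpose_of_trivial] at hSh
  have hRt : ∀ i j, R i j = R j i := fun i j => by
    have := hR.isHermitian.apply j i
    simpa using this
  set M := S * diagonal A * S with hMdef
  have hM : M.IsHermitian := by
    have := isHermitian_mul_mul_conjTranspose S (isHermitian_diagonal A)
    rwa [hSh.eq] at this
  have hnorm : ∀ x : ι → ℝ, ∑ i, (S *ᵥ x) i ^ 2 = x ⬝ᵥ R *ᵥ x := by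
    intro x
    rw [← hSS, ← mulVec_mulVec, dotProduct_mulVec, ← mulVec_transpose, hSt]
    simp [dotProduct, pow_two]
  have hquad : ∀ x : ι → ℝ, x ⬝ᵥ M *ᵥ x = ∑ i, A i * (S *ᵥ x) i ^ 2 := by
    intro x
    rw [hMdef, ← mulVec_mulVec, ← mulVec_mulVec, dotProduct_mulVec, ← mulVec_transpose, hSt]
    simp only [dotProduct, mulVec_diagonal]
    exact Finset.sum_congr rfl fun i _ => by ring
  have htr : M.trace = ∑ i, A i * R i i := by
    rw [hMdef, Matrix.trace_mul_cycle, hSS]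
    simp [Matrix.trace, Matrix.mul_diagonal, mul_comm]
  have htr2 : (M * M).trace = ∑ i, ∑ j, A i * A j * R i j ^ 2 := by
    have : M * M = S * (diagonal A * R * diagonal A) * S := by
      rw [hMdef, ← hSS]; simp only [Matrix.mul_assoc]
    rw [this, Matrix.trace_mul_cycle, hSS]
    have e : ∀ i j, (diagonal A * R * diagonal A) i j = A i * R i j * A j := fun i j => by
      rw [Matrix.mul_diagonal, Matrix.diagonal_mul]
    refine Finset.sum_congr rfl fun i _ => ?_
    rw [Matrix.diag_apply, Matrix.mul_apply]
    refine Finset.sum_congr rfl fun j _ => ?_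
    rw [e, hRt j i]; ring
  have hρ : ∀ x : EuclideanSpace ℝ ι, ‖x‖ = 1 → |x ⬝ᵥ M *ᵥ x| ≤ α * κ := by
    intro x hx
    rw [hquad]
    have hx2 : ∑ i, x i ^ 2 = 1 := by
      rw [← EuclideanSpace.real_norm_sq_eq, hx]; norm_num
    calc |∑ i, A i * (S *ᵥ x) i ^ 2| ≤ ∑ i, |A i * (S *ᵥ x) i ^ 2| :=
          Finset.abs_sum_le_sum_abs _ _
      _ ≤ ∑ i, α * (S *ᵥ x) i ^ 2 := by
          refine Finset.sum_le_sum fun i _ => ?_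
          rw [abs_mul, abs_of_nonneg (sq_nonneg ((S *ᵥ x) i))]
          exact mul_le_mul_of_nonneg_right (hα i) (sq_nonneg _)
      _ = α * (x ⬝ᵥ R *ᵥ x) := by rw [← Finset.mul_sum, hnorm]
      _ ≤ α * κ := by
          refine mul_le_mul_of_nonneg_left ?_ hα0
          simpa [hx2] using hκ x
  have main := charFun_stdGaussian_quadratic hC0 hC M hM (α * κ) hρ
  rw [htr2] at main
  convert main using 3
  have hm : Measurable (fun ω => WithLp.toLp 2 (fun i => V i ω)) := by fun_prop
  have e1 : ∫ ω, Complex.exp ((∑ i, A i * (V i ω ^ 2 - R i i) : ℝ) * Complex.I) ∂P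
      = ∫ x, Complex.exp ((∑ i, A i * (x i ^ 2 - R i i) : ℝ) * Complex.I)
        ∂(multivariateGaussian (0 : EuclideanSpace ℝ ι) R) := by
    rw [← map_eq_multivariateGaussian V hV R hR hlaw, integral_map hm.aemeasurable
      (Continuous.aestronglyMeasurable (by fun_prop))]
  rw [e1, multivariateGaussian, integral_map (by fun_prop)
    (Continuous.aestronglyMeasurable (by fun_prop))]
  refine integral_congr_ae (ae_of_all _ fun x => ?_)
  simp only [zero_add, Matrix.ofLp_toEuclideanCLM, ← hS]
  rw [hquad, htr, ← Finset.sum_sub_distrib]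
  congr 4
  ext i
  ring

/-! ### Mellin transforms of exponential sums -/

/-- The exponential sum `∑ᵢ Wᵢ e^{-yᵢ u}`. -/
noncomputable def expSum {ι : Type*} [Fintype ι] (W y : ι → ℝ) (u : ℝ) : ℝ :=
  ∑ i, W i * Real.exp (-(y i * u))

/-- The power-law kernel as a function of the squared distance. -/
noncomputable def powerKernel (s y : ℝ) : ℝ :=
  if (⌊s⌋₊ : ℝ) = s then (-1) ^ (⌊s⌋₊ + 1) / (Nat.factorial ⌊s⌋₊ : ℝ) * y ^ s * Real.log y
  else Real.Gamma (-s) * y ^ s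

section ExpSum

variable {ι : Type*} [Fintype ι] {W y : ι → ℝ}

@[fun_prop]
lemma continuous_expSum : Continuous (expSum W y) := by
  unfold expSum; fun_prop

lemma hasDerivAt_expSum (u : ℝ) : HasDerivAt (expSum W y) (-expSum (fun i => W i * y i) y u) u := by
  unfold expSum
  rw [← Finset.sum_neg_distrib]
  refine HasDerivAt.fun_sum fun i _ => ?_
  have h : HasDerivAt (fun u : ℝ => -(y i * u)) (-(y i)) u := by
    simpa using ((hasDerivAt_id' u).const_mul (y i)).fun_neg
  exact (h.exp.const_mul (W i)).congr_deriv (by ring)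

lemma abs_expSum_le (hy : ∀ i, 0 ≤ y i) {u : ℝ} (hu : 0 ≤ u) : |expSum W y u| ≤ ∑ i, |W i| := by
  refine (Finset.abs_sum_le_sum_abs _ _).trans (Finset.sum_le_sum fun i _ => ?_)
  rw [abs_mul, abs_of_pos (Real.exp_pos _)]
  have : Real.exp (-(y i * u)) ≤ 1 := Real.exp_le_one_iff.2 (by nlinarith [mul_nonneg (hy i) hu])
  nlinarith [abs_nonneg (W i)]

/-- The vanishing moments make the Taylor polynomials of degree below `k` cancel in the sum, so they
can be subtracted from each exponential for free. -/
lemma expSum_isBigO_zero {k : ℕ} (hW : ∀ r < k, ∑ i, W i * y i ^ r = 0) :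
    expSum W y =O[𝓝 0] (fun u => u ^ k) := by
  have h1 : expSum W y = fun u => ∑ i, W i * (Real.exp (-(y i * u)) -
      ∑ r ∈ Finset.range k, (-(y i * u)) ^ r / (r.factorial : ℝ)) := by
    ext u
    simp only [mul_sub, Finset.sum_sub_distrib, expSum]
    rw [eq_comm, sub_eq_self]
    simp_rw [Finset.mul_sum]
    rw [Finset.sum_comm]
    refine Finset.sum_eq_zero fun r hr => ?_
    have := hW r (Finset.mem_range.1 hr)
    calc ∑ i, W i * ((-(y i * u)) ^ r / (r.factorial : ℝ))
        = ((-u) ^ r / (r.factorial : ℝ)) * ∑ i, W i * y i ^ r := by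
          rw [Finset.mul_sum]
          refine Finset.sum_congr rfl fun i _ => ?_
          rw [show -(y i * u) = (-u) * y i by ring, mul_pow]; ring
      _ = 0 := by rw [this, mul_zero]
  rw [h1]
  refine Asymptotics.IsBigO.fun_sum fun i _ => Asymptotics.IsBigO.const_mul_left ?_ _
  have h2 : Tendsto (fun u : ℝ => -(y i * u)) (𝓝 0) (𝓝 0) := by
    have : Continuous (fun u : ℝ => -(y i * u)) := by fun_prop
    simpa using this.tendsto 0
  refine ((Real.exp_sub_sum_range_isBigO_pow k).comp_tendsto h2).trans ?_
  refine Asymptotics.IsBigO.of_bound (|y i| ^ k) (Eventually.of_forall fun u => ?_)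
  simp [mul_pow]

lemma expSum_isBigO_zero_rpow {k : ℕ} (hW : ∀ r < k, ∑ i, W i * y i ^ r = 0) :
    expSum W y =O[𝓝[>] 0] (fun u => u ^ (-(-(k : ℝ)))) := by
  simpa using (expSum_isBigO_zero hW).mono nhdsWithin_le_nhds

lemma expSum_isBigO_atTop (hy : ∀ i, 0 ≤ y i) :
    expSum W y =O[atTop] (fun u => u ^ (-(0 : ℝ))) := by
  refine Asymptotics.IsBigO.of_bound (∑ i, |W i|) ?_
  filter_upwards [eventually_ge_atTop 0] with u hu
  simpa using abs_expSum_le hy hu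

lemma expSum_isBigO_atTop_one (hy : ∀ i, 0 ≤ y i) (h0 : ∀ i, y i = 0 → W i = 0) :
    expSum W y =O[atTop] (fun u => u ^ (-(1 : ℝ))) := by
  unfold expSum
  refine Asymptotics.IsBigO.fun_sum fun i _ => ?_
  rcases eq_or_ne (y i) 0 with h | h
  · simp [h0 i h, Asymptotics.isBigO_zero]
  · have hp : 0 < y i := lt_of_le_of_ne (hy i) h.symm
    refine Asymptotics.IsBigO.const_mul_left ?_ _
    simpa using (isLittleO_exp_neg_mul_rpow_atTop hp (-1)).isBigO

/-- Near zero the order of vanishing `k` beats `u^(-s-1)` because `s < k`. At infinity boundedness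
suffices when `s > 0`; for `-1 < s ≤ 0` the constant terms must be absent, and the sum then decays.
-/
lemma integrableOn_expSum (hy : ∀ i, 0 ≤ y i) {k : ℕ} (hW : ∀ r < k, ∑ i, W i * y i ^ r = 0)
    {s : ℝ} (hsk : s < k) (hs : 0 < s ∨ (-1 < s ∧ ∀ i, y i = 0 → W i = 0)) :
    IntegrableOn (fun u : ℝ => u ^ (-s - 1) * expSum W y u) (Set.Ioi 0) := by
  have hloc : LocallyIntegrableOn (expSum W y) (Set.Ioi 0) :=
    continuous_expSum.locallyIntegrable.locallyIntegrableOn _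
  rcases hs with hs | ⟨hs, h0⟩
  · exact mellin_convergent_of_isBigO_scalar hloc (expSum_isBigO_atTop hy) (by linarith)
      (expSum_isBigO_zero_rpow hW) (by linarith)
  · exact mellin_convergent_of_isBigO_scalar hloc (expSum_isBigO_atTop_one hy h0) (by linarith)
      (expSum_isBigO_zero_rpow hW) (by linarith)

/-- A Frullani integral; it is the source of the logarithm in the kernel at integer exponents. -/
lemma integral_inv_mul_exp_sub_exp {c : ℝ} (hc : 0 < c) :
    IntegrableOn (fun u : ℝ => u⁻¹ * (Real.exp (-(c * u)) - Real.exp (-u))) (Set.Ioi 0) ∧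
    ∫ u in Set.Ioi (0 : ℝ), u⁻¹ * (Real.exp (-(c * u)) - Real.exp (-u)) = -Real.log c := by
  have hint : IntegrableOn (fun u : ℝ => u⁻¹ * (Real.exp (-(c * u)) - Real.exp (-u)))
      (Set.Ioi 0) := by
    have := integrableOn_expSum (ι := Fin 2) (W := ![1, -1]) (y := ![c, 1]) (k := 1) (s := 0)
      (by intro i; fin_cases i <;> simp [hc.le]) (by simp)
      (by norm_num) (Or.inr ⟨by norm_num, by intro i; fin_cases i <;> simp [hc.ne']⟩)
    refine this.congr_fun (fun u _ => ?_) measurableSet_Ioi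
    simp [expSum, Real.rpow_neg_one, sub_eq_add_neg]
  refine ⟨hint, ?_⟩
  have := Frullani.integral_Ioi_eq (f := fun u : ℝ => Real.exp (-u)) (a := c) (b := 1) (L := 1)
    (R := 0) (Continuous.locallyIntegrable (by fun_prop) |>.locallyIntegrableOn _) hc one_pos
    (by
      have : Continuous (fun u : ℝ => Real.exp (-u)) := by fun_prop
      simpa using (this.tendsto 0).mono_left nhdsWithin_le_nhds)
    Real.tendsto_exp_neg_atTop_nhds_zero (by simpa using hint)
  simpa using this

lemma powerKernel_zero_left (y : ℝ) : powerKernel 0 y = -Real.log y := by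
  simp [powerKernel]

lemma powerKernel_of_neg {s : ℝ} (hs : s < 0) (y : ℝ) :
    powerKernel s y = Real.Gamma (-s) * y ^ s := by
  rw [powerKernel, if_neg]
  rw [Nat.floor_of_nonpos hs.le]
  simpa using hs.ne'

/-- The same recursion holds in both branches, through `Γ(1-s) = -s Γ(-s)` or through the factorial.
It is the mirror image of integration by parts in the Mellin integral. -/
lemma powerKernel_recurrence {s y : ℝ} (hs : 0 < s) (hy : 0 ≤ y) :
    powerKernel s y = -(1 / s) * (y * powerKernel (s - 1) y) := by
  have hyp : y * y ^ (s - 1) = y ^ s := by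
    rcases hy.eq_or_lt with h | h
    · rw [← h, zero_mul, Real.zero_rpow hs.ne']
    · rw [Real.rpow_sub_one h.ne']; field_simp
  have hmul : ∀ a b : ℝ, y * (a * y ^ (s - 1) * b) = a * y ^ s * b := by
    intro a b; rw [← hyp]; ring
  by_cases h : (⌊s⌋₊ : ℝ) = s
  · have hn : ⌊s⌋₊ ≠ 0 := by
      intro h0; rw [h0] at h; simp at h; linarith
    obtain ⟨n, hn⟩ := Nat.exists_eq_succ_of_ne_zero hn
    have hf : ⌊s - 1⌋₊ = n := by rw [Nat.floor_sub_one, hn]; rfl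
    have hsn : s = n + 1 := by rw [← h, hn]; push_cast; ring
    rw [powerKernel, if_pos h, powerKernel, if_pos (by rw [hf, hsn]; ring), hmul, hf, hn,
      Nat.succ_eq_add_one, Nat.factorial_succ, hsn]
    push_cast
    have : (n.factorial : ℝ) ≠ 0 := by positivity
    have : (n : ℝ) + 1 ≠ 0 := by positivity
    field_simp
    ring
  · have h' : ¬ (⌊s - 1⌋₊ : ℝ) = s - 1 := by
      intro h'
      apply h
      rw [Nat.floor_sub_one] at h'
      have h1 : 1 ≤ s := by
        have := Nat.cast_nonneg (α := ℝ) (⌊s⌋₊ - 1)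
        linarith
      have h2 : 1 ≤ ⌊s⌋₊ := Nat.one_le_floor_iff _ |>.2 h1
      rw [Nat.cast_sub h2] at h'
      push_cast at h'
      linarith
    rw [powerKernel, if_neg h, powerKernel, if_neg h']
    have hG : Real.Gamma (-(s - 1)) = (-s) * Real.Gamma (-s) := by
      rw [show -(s - 1) = -s + 1 by ring, Real.Gamma_add_one (by linarith)]
    rw [hG, ← hyp]
    field_simp

/-- For `s < 0` every term is a Gamma integral. At `s = 0` the terms diverge one by one, but the
weights sum to zero, so `e^(-u)` can be subtracted from each exponential and Frullani's formula
applies. -/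
lemma integral_expSum_of_nonpos (hy : ∀ i, 0 ≤ y i) {k : ℕ}
    (hW : ∀ r < k, ∑ i, W i * y i ^ r = 0) {s : ℝ} (hsk : s < k) (hs : -1 < s) (hs0 : s ≤ 0)
    (h0 : ∀ i, y i = 0 → W i = 0) :
    ∫ u in Set.Ioi (0 : ℝ), u ^ (-s - 1) * expSum W y u = ∑ i, W i * powerKernel s (y i) := by
  rcases hs0.lt_or_eq with hs0 | rfl
  · have h1 : ∀ i, IntegrableOn (fun u : ℝ => u ^ (-s - 1) * (W i * Real.exp (-(y i * u))))
        (Set.Ioi 0) := by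
      intro i
      have := integrableOn_expSum (ι := Unit) (W := fun _ => W i) (y := fun _ => y i) (k := 0)
        (s := s) (fun _ => hy i) (by simp) (by simpa using hs0) (Or.inr ⟨hs, fun _ => h0 i⟩)
      simpa [expSum] using this
    simp_rw [expSum, Finset.mul_sum]
    rw [integral_finsetSum _ fun i _ => h1 i]
    refine Finset.sum_congr rfl fun i _ => ?_
    rcases eq_or_ne (y i) 0 with h | h
    · simp [h0 i h]
    · have hp : 0 < y i := lt_of_le_of_ne (hy i) h.symm
      have := Real.integral_rpow_mul_exp_neg_mul_Ioi (a := -s) (r := y i) (by linarith) hp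
      rw [powerKernel_of_neg hs0]
      calc _ = W i * ∫ u in Set.Ioi (0 : ℝ), u ^ (-s - 1) * Real.exp (-(y i * u)) := by
            rw [← integral_const_mul]
            refine integral_congr_ae (ae_of_all _ fun u => ?_)
            ring
        _ = _ := by
            rw [this, one_div, Real.inv_rpow hp.le, Real.rpow_neg hp.le, inv_inv]; ring
  · have hk : 0 < k := by exact_mod_cast hsk
    have hsum : ∑ i, W i = 0 := by simpa using hW 0 hk
    have h1 : ∀ i, IntegrableOn
        (fun u : ℝ => W i * (u⁻¹ * (Real.exp (-(y i * u)) - Real.exp (-u)))) (Set.Ioi 0) := by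
      intro i
      rcases eq_or_ne (y i) 0 with h | h
      · simp [h0 i h]
      · exact (integral_inv_mul_exp_sub_exp (lt_of_le_of_ne (hy i) h.symm)).1.const_mul _
    have h2 : ∀ u : ℝ, u ^ (-(0 : ℝ) - 1) * expSum W y u
        = ∑ i, W i * (u⁻¹ * (Real.exp (-(y i * u)) - Real.exp (-u))) := by
      intro u
      have : ∑ i, W i * (u⁻¹ * (Real.exp (-(y i * u)) - Real.exp (-u)))
          = u⁻¹ * expSum W y u - u⁻¹ * Real.exp (-u) * ∑ i, W i := by
        rw [expSum, Finset.mul_sum, Finset.mul_sum, ← Finset.sum_sub_distrib]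
        exact Finset.sum_congr rfl fun i _ => by ring
      rw [this, hsum]
      simp [Real.rpow_neg_one]
    simp_rw [h2]
    rw [integral_finsetSum _ fun i _ => h1 i]
    refine Finset.sum_congr rfl fun i _ => ?_
    rcases eq_or_ne (y i) 0 with h | h
    · simp [h0 i h]
    · rw [integral_const_mul, (integral_inv_mul_exp_sub_exp (lt_of_le_of_ne (hy i) h.symm)).2,
        powerKernel_zero_left]

/-- Integration by parts against `-u^(-s)/s`. The boundary term vanishes at zero because the sum is
`O(u^(k+1))` with `s < k + 1`, and at infinity because it is bounded and `s > 0`. Differentiation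
multiplies each weight by `y`, which uses up one moment condition and removes the weights at `y =
0`. -/
lemma integral_expSum_parts (hy : ∀ i, 0 ≤ y i) {k : ℕ}
    (hW : ∀ r < k + 1, ∑ i, W i * y i ^ r = 0) {s : ℝ} (hsk : s < k + 1) (hs : 0 < s) :
    ∫ u in Set.Ioi (0 : ℝ), u ^ (-s - 1) * expSum W y u
      = -(1 / s) * ∫ u in Set.Ioi (0 : ℝ), u ^ (-(s - 1) - 1) * expSum (fun i => W i * y i) y u := by
  have hW' : ∀ r < k, ∑ i, (W i * y i) * y i ^ r = 0 := by
    intro r hr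
    rw [← hW (r + 1) (by omega)]
    exact Finset.sum_congr rfl fun i _ => by ring
  have i1 := integrableOn_expSum hy (k := k + 1) hW (s := s) (by exact_mod_cast hsk) (Or.inl hs)
  have i2 := integrableOn_expSum hy (W := fun i => W i * y i) (k := k) hW' (s := s - 1)
    (by linarith) (Or.inr ⟨by linarith, fun i hi => by simp [hi]⟩)
  have e : -(s - 1) - 1 = -s := by ring
  rw [e] at i2 ⊢
  have hv : ∀ x ∈ Set.Ioi (0 : ℝ), HasDerivAt (fun u : ℝ => -(1 / s) * u ^ (-s)) (x ^ (-s - 1)) x := by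
    intro x hx
    have := (Real.hasDerivAt_rpow_const (p := -s) (Or.inl (ne_of_gt hx))).const_mul (-(1 / s))
    refine this.congr_deriv ?_
    rw [← mul_assoc, show -(1 / s) * -s = 1 by field_simp, one_mul]
  have key := integral_Ioi_mul_deriv_eq_deriv_mul (a := 0) (a' := 0) (b' := 0)
    (u := expSum W y) (u' := fun u => -expSum (fun i => W i * y i) y u)
    (v := fun u : ℝ => -(1 / s) * u ^ (-s)) (v' := fun x => x ^ (-s - 1))
    (fun x _ => hasDerivAt_expSum x) hv
    (i1.congr_fun (fun u _ => by simp [mul_comm]) measurableSet_Ioi)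
    ((i2.const_mul (1 / s)).congr (ae_of_all _ fun u => by simp; ring))
    ?_ ?_
  · calc _ = ∫ u in Set.Ioi (0 : ℝ), expSum W y u * u ^ (-s - 1) := by simp_rw [mul_comm]
      _ = _ := by
        rw [key, ← integral_const_mul, sub_zero, zero_sub, ← integral_neg]
        refine integral_congr_ae (ae_of_all _ fun u => ?_)
        simp only
        ring
  · have hO : (expSum W y * fun u : ℝ => -(1 / s) * u ^ (-s)) =O[𝓝[>] 0]
        (fun u : ℝ => u ^ ((k : ℝ) + 1 - s)) := by
      have h1 := expSum_isBigO_zero_rpow (k := k + 1) hW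
      have h2 : (fun u : ℝ => -(1 / s) * u ^ (-s)) =O[𝓝[>] 0] (fun u : ℝ => u ^ (-s)) :=
        (Asymptotics.isBigO_refl _ _).const_mul_left _
      refine (h1.mul h2).congr' EventuallyEq.rfl ?_
      filter_upwards [self_mem_nhdsWithin] with u hu
      rw [← Real.rpow_add hu]
      push_cast
      congr 1; ring
    refine hO.trans_tendsto ?_
    have : Tendsto (fun u : ℝ => u ^ ((k : ℝ) + 1 - s)) (𝓝 0) (𝓝 (0 ^ ((k : ℝ) + 1 - s))) :=
      (Real.continuousAt_rpow_const _ _ (Or.inr (by linarith))).tendsto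
    rw [Real.zero_rpow (by linarith)] at this
    exact this.mono_left nhdsWithin_le_nhds
  · have hO : (expSum W y * fun u : ℝ => -(1 / s) * u ^ (-s)) =O[atTop]
        (fun u : ℝ => u ^ (-s)) := by
      have h1 := expSum_isBigO_atTop (W := W) hy
      have h2 : (fun u : ℝ => -(1 / s) * u ^ (-s)) =O[atTop] (fun u : ℝ => u ^ (-s)) :=
        (Asymptotics.isBigO_refl _ _).const_mul_left _
      refine (h1.mul h2).congr_right fun u => ?_
      simp
    exact hO.trans_tendsto (tendsto_rpow_neg_atTop hs)

/-- Each integration by parts lowers `s` and the number of moment conditions by one, until `s` lies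
in `(-1, 0]`. The result unifies the power and logarithmic kernels. -/
theorem integral_expSum (hy : ∀ i, 0 ≤ y i) {k : ℕ} (hW : ∀ r < k, ∑ i, W i * y i ^ r = 0)
    {s : ℝ} (hsk : s < k) (hs : 0 < s ∨ (-1 < s ∧ ∀ i, y i = 0 → W i = 0)) :
    ∫ u in Set.Ioi (0 : ℝ), u ^ (-s - 1) * expSum W y u = ∑ i, W i * powerKernel s (y i) := by
  induction k generalizing W s with
  | zero =>
    rcases hs with hs | ⟨h1, h0⟩
    · exact absurd hsk (by simpa using hs.le)
    · exact integral_expSum_of_nonpos hy hW hsk h1 (by simpa using hsk.le) h0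
  | succ k ih =>
    rcases le_or_gt s 0 with h | h
    · rcases hs with hs | ⟨h1, h0⟩
      · exact absurd hs h.not_gt
      · exact integral_expSum_of_nonpos hy hW hsk h1 h h0
    · have hsk' : s < k + 1 := by exact_mod_cast hsk
      rw [integral_expSum_parts hy hW hsk' h, ih (W := fun i => W i * y i) (s := s - 1)]
      · rw [Finset.mul_sum]
        refine Finset.sum_congr rfl fun i _ => ?_
        rw [powerKernel_recurrence h (hy i)]; ring
      · intro r hr
        rw [← hW (r + 1) (by omega)]
        exact Finset.sum_congr rfl fun i _ => by ring
      · linarith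
      · exact Or.inr ⟨by linarith, fun i hi => by simp [hi]⟩

/-- The Mellin transform of an exponential sum depends differentiably on its argument. -/
theorem differentiableAt_sum_powerKernel (hy : ∀ i, 0 ≤ y i) {k : ℕ}
    (hW : ∀ r < k, ∑ i, W i * y i ^ r = 0) {s : ℝ} (hs : 0 < s) (hsk : s < k) :
    DifferentiableAt ℝ (fun s => ∑ i, W i * powerKernel s (y i)) s := by
  have hloc : LocallyIntegrableOn (fun u => (expSum W y u : ℂ)) (Set.Ioi 0) :=
    Continuous.locallyIntegrable (by fun_prop) |>.locallyIntegrableOn _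
  have h1 : DifferentiableAt ℂ (mellin fun u => (expSum W y u : ℂ)) ((-s : ℝ) : ℂ) :=
    mellin_differentiableAt_of_isBigO_rpow (a := 0) (b := -(k : ℝ)) hloc
      (Asymptotics.IsBigO.of_norm_left (by
        simpa only [Complex.norm_real] using (expSum_isBigO_atTop (W := W) hy).norm_left))
      (by simpa using hs)
      (Asymptotics.IsBigO.of_norm_left (by
        simpa only [Complex.norm_real] using (expSum_isBigO_zero_rpow hW).norm_left)) (by simpa using hsk)
  have h2 : DifferentiableAt ℝ
      (fun s : ℝ => (mellin (fun u => (expSum W y u : ℂ)) ((-s : ℝ) : ℂ)).re) s := by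
    have h3 : DifferentiableAt ℝ (fun s : ℝ => ((-s : ℝ) : ℂ)) s := by
      have : DifferentiableAt ℝ (fun s : ℝ => (Complex.ofRealCLM (-s) : ℂ)) s := by fun_prop
      simpa using this
    have h4 := (h1.restrictScalars ℝ).comp s h3
    exact Complex.reCLM.differentiableAt.comp s h4
  refine h2.congr_of_eventuallyEq ?_
  -- The integral representation holds on the whole interval `(0, k)`, hence also around the
  -- integers where the closed formula changes. Differentiability comes from holomorphy of the
  -- Mellin transform in the strip.
  filter_upwards [Ioo_mem_nhds hs hsk] with r hr
  rw [← integral_expSum hy hW hr.2 (Or.inl hr.1)]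
  have : ∀ u ∈ Set.Ioi (0 : ℝ), (u : ℂ) ^ (((-r : ℝ) : ℂ) - 1) • (expSum W y u : ℂ)
      = ((u ^ (-r - 1) * expSum W y u : ℝ) : ℂ) := by
    intro u hu
    rw [Complex.ofReal_mul, Complex.ofReal_cpow (le_of_lt hu)]
    simp
  rw [mellin, setIntegral_congr_fun measurableSet_Ioi this, integral_complex_ofReal,
    Complex.ofReal_re]

end ExpSum

/-- The factor `2` of the logarithmic case is absorbed by `log ‖h‖² = 2 log ‖h‖`. -/
lemma powerLawCov_eq_powerKernel (φ₁ φ₂ : ℝ) (h : Plane) :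
    powerLawCov φ₁ φ₂ h = φ₁ * powerKernel φ₂ (‖h‖ ^ 2) := by
  have h1 : (‖h‖ ^ 2) ^ φ₂ = ‖h‖ ^ (2 * φ₂) := by
    rw [Real.rpow_mul (norm_nonneg _), Real.rpow_two]
  rw [powerLawCov, powerKernel, h1, Real.log_pow]
  split_ifs
  · push_cast; ring
  · ring

/-! ### Spectral representation of the generalized covariance -/

section Spectral

variable {ι : Type*} [Fintype ι]

/-- The weighted family of points annihilates the monomials of total degree at most `k`. -/
def AnnihilatesMonomials (k : ℕ) (w : ι → ℝ) (x : ι → Plane) : Prop :=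
  ∀ p q : ℕ, p + q ≤ k → ∑ i, w i * (x i 0 ^ p * x i 1 ^ q) = 0

/-- The Fourier transform of the signed measure `∑ᵢ wᵢ δ_{xᵢ}`. -/
noncomputable def trigSum (w : ι → ℝ) (x : ι → Plane) (l : Plane) : ℂ :=
  ∑ i, (w i : ℂ) * Complex.exp (inner ℝ (x i) l * Complex.I)

@[fun_prop]
lemma continuous_trigSum (w : ι → ℝ) (x : ι → Plane) : Continuous (trigSum w x) := by
  unfold trigSum; fun_prop

lemma norm_sq_trigSum (w : ι → ℝ) (x : ι → Plane) (l : Plane) :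
    ‖trigSum w x l‖ ^ 2 = ∑ i, ∑ j, w i * w j * Real.cos (inner ℝ (x i - x j) l) := by
  have h1 : ((‖trigSum w x l‖ ^ 2 : ℝ) : ℂ) = trigSum w x l * (starRingEnd ℂ) (trigSum w x l) := by
    rw [Complex.mul_conj, Complex.normSq_eq_norm_sq]
  have h2 : ‖trigSum w x l‖ ^ 2 = (trigSum w x l * (starRingEnd ℂ) (trigSum w x l)).re := by
    rw [← h1, Complex.ofReal_re]
  rw [h2, trigSum, map_sum, Finset.sum_mul_sum, Complex.re_sum]
  refine Finset.sum_congr rfl fun i _ => ?_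
  rw [Complex.re_sum]
  refine Finset.sum_congr rfl fun j _ => ?_
  have h3 : (w i : ℂ) * Complex.exp (inner ℝ (x i) l * Complex.I) *
      (starRingEnd ℂ) ((w j : ℂ) * Complex.exp (inner ℝ (x j) l * Complex.I))
      = ((w i * w j : ℝ) : ℂ) * Complex.exp ((inner ℝ (x i - x j) l : ℝ) * Complex.I) := by
    rw [map_mul, Complex.conj_ofReal, ← Complex.exp_conj, map_mul, Complex.conj_ofReal,
      Complex.conj_I, inner_sub_left]
    push_cast
    rw [show ((inner ℝ (x i) l : ℂ) - (inner ℝ (x j) l : ℂ)) * Complex.I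
      = (inner ℝ (x i) l : ℂ) * Complex.I + (inner ℝ (x j) l : ℂ) * -Complex.I by ring,
      Complex.exp_add]
    ring
  rw [h3, Complex.re_ofReal_mul, Complex.exp_ofReal_mul_I_re]

lemma plane_norm_sq_sub_pow (a b : Plane) (r : ℕ) :
    (‖a - b‖ ^ 2) ^ r = ∑ l ∈ Finset.range (r + 1), ∑ p ∈ Finset.range (2 * l + 1),
      ∑ q ∈ Finset.range (2 * (r - l) + 1),
        ((r.choose l : ℝ) * ((2 * l).choose p) * ((2 * (r - l)).choose q)) *
          ((a 0 ^ p * a 1 ^ q) * ((-b 0) ^ (2 * l - p) * (-b 1) ^ (2 * (r - l) - q))) := by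
  rw [EuclideanSpace.real_norm_sq_eq, Fin.sum_univ_two, add_pow]
  refine Finset.sum_congr rfl fun l _ => ?_
  simp only [PiLp.sub_apply]
  rw [← pow_mul, ← pow_mul, sub_eq_add_neg, sub_eq_add_neg, add_pow, add_pow,
    Finset.sum_mul_sum, Finset.sum_mul]
  refine Finset.sum_congr rfl fun p _ => ?_
  rw [Finset.sum_mul]
  refine Finset.sum_congr rfl fun q _ => ?_
  ring

/-- Expanding the power gives products of a monomial in `x i` and a monomial in `x j` of total
degree `2r ≤ 2k`. One of the two has degree at most `k`, and its weighted sum vanishes. -/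
lemma AnnihilatesMonomials.sum_norm_sq_pow_eq_zero {k : ℕ} {w : ι → ℝ} {x : ι → Plane}
    (h : AnnihilatesMonomials k w x) {r : ℕ} (hr : r ≤ k) :
    ∑ i, ∑ j, w i * w j * (‖x i - x j‖ ^ 2) ^ r = 0 := by
  simp_rw [plane_norm_sq_sub_pow, Finset.mul_sum]
  have hc : ∀ f : ι → ι → ℕ → ℝ, ∀ n, ∑ i, ∑ j, ∑ l ∈ Finset.range n, f i j l
      = ∑ l ∈ Finset.range n, ∑ i, ∑ j, f i j l := by
    intro f n
    rw [Finset.sum_comm (s := Finset.range n)]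
    refine Finset.sum_congr rfl fun i _ => ?_
    rw [Finset.sum_comm]
  rw [hc]
  refine Finset.sum_eq_zero fun l hl => ?_
  rw [hc]
  refine Finset.sum_eq_zero fun p hp => ?_
  rw [hc]
  refine Finset.sum_eq_zero fun q hq => ?_
  have hl' := Finset.mem_range.1 hl
  have hp' := Finset.mem_range.1 hp
  have hq' := Finset.mem_range.1 hq
  have h1 : ∑ i, ∑ j, w i * w j * (((r.choose l : ℝ) * ((2 * l).choose p) *
        ((2 * (r - l)).choose q)) * ((x i 0 ^ p * x i 1 ^ q) *
          ((-x j 0) ^ (2 * l - p) * (-x j 1) ^ (2 * (r - l) - q))))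
      = ((r.choose l : ℝ) * ((2 * l).choose p) * ((2 * (r - l)).choose q)
          * ((-1) ^ (2 * l - p) * (-1) ^ (2 * (r - l) - q))) *
        ((∑ i, w i * (x i 0 ^ p * x i 1 ^ q)) *
          ∑ j, w j * (x j 0 ^ (2 * l - p) * x j 1 ^ (2 * (r - l) - q))) := by
    rw [Finset.sum_mul_sum, Finset.mul_sum]
    refine Finset.sum_congr rfl fun i _ => ?_
    rw [Finset.mul_sum]
    refine Finset.sum_congr rfl fun j _ => ?_
    rw [neg_pow (x j 0), neg_pow (x j 1)]
    ring
  rw [h1]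
  rcases le_or_gt (p + q) k with hpq | hpq
  · rw [h p q hpq]; ring
  · rw [h (2 * l - p) (2 * (r - l) - q) (by omega)]; ring

lemma integral_cos_mul_exp {b : ℝ} (hb : 0 < b) (h : Plane) :
    Integrable (fun l : Plane => Real.cos (inner ℝ h l) * Real.exp (-b * ‖l‖ ^ 2)) ∧
    ∫ l : Plane, Real.cos (inner ℝ h l) * Real.exp (-b * ‖l‖ ^ 2)
      = Real.pi / b * Real.exp (-(‖h‖ ^ 2 / (4 * b))) := by
  have hb' : 0 < (b : ℂ).re := by simpa using hb
  have e1 : ∀ l : Plane, Real.cos (inner ℝ h l) * Real.exp (-b * ‖l‖ ^ 2)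
      = (Complex.exp (-(b : ℂ) * ‖l‖ ^ 2 + Complex.I * (inner ℝ h l : ℝ))).re := by
    intro l
    rw [show -(b : ℂ) * ‖l‖ ^ 2 + Complex.I * (inner ℝ h l : ℝ)
      = ((-b * ‖l‖ ^ 2 : ℝ) : ℂ) + (inner ℝ h l : ℝ) * Complex.I by push_cast; ring,
      Complex.exp_add, ← Complex.ofReal_exp, Complex.re_ofReal_mul, Complex.exp_ofReal_mul_I_re]
    ring
  have hi := GaussianFourier.integrable_cexp_neg_mul_sq_norm_add (V := Plane) hb' Complex.I h
  have hv := GaussianFourier.integral_cexp_neg_mul_sq_norm_add (V := Plane) hb' Complex.I h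
  simp_rw [e1]
  refine ⟨hi.re, ?_⟩
  have h2 := integral_re hi
  simp only [RCLike.re_to_complex] at h2
  rw [h2, hv]
  have : ((Module.finrank ℝ Plane : ℂ) / 2) = 1 := by simp
  rw [this, Complex.cpow_one, Complex.I_sq,
    show (Real.pi : ℂ) / b * Complex.exp (-1 * (‖h‖ : ℂ) ^ 2 / (4 * b))
      = ((Real.pi / b * Real.exp (-(‖h‖ ^ 2 / (4 * b))) : ℝ) : ℂ) by
        push_cast; ring_nf, Complex.ofReal_re]

/-- `e^(-‖h‖² u)` is the Fourier transform of a Gaussian probability density in `λ`. The exponential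
sum over squared distances is therefore a Gaussian average of the squared modulus of `trigSum`; in
particular it is nonnegative. -/
lemma integral_trigSum_heat (w : ι → ℝ) (x : ι → Plane) {u : ℝ} (hu : 0 < u) :
    Integrable (fun l : Plane => ‖trigSum w x l‖ ^ 2 *
      ((4 * Real.pi * u)⁻¹ * Real.exp (-(4 * u)⁻¹ * ‖l‖ ^ 2))) ∧
    ∫ l : Plane, ‖trigSum w x l‖ ^ 2 * ((4 * Real.pi * u)⁻¹ * Real.exp (-(4 * u)⁻¹ * ‖l‖ ^ 2))
      = expSum (fun ij : ι × ι => w ij.1 * w ij.2) (fun ij => ‖x ij.1 - x ij.2‖ ^ 2) u := by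
  have hb : 0 < (4 * u)⁻¹ := by positivity
  have hc := fun i j => integral_cos_mul_exp hb (x i - x j)
  have e : ∀ l : Plane, ‖trigSum w x l‖ ^ 2 *
      ((4 * Real.pi * u)⁻¹ * Real.exp (-(4 * u)⁻¹ * ‖l‖ ^ 2))
      = ∑ i, ∑ j, (w i * w j * (4 * Real.pi * u)⁻¹) *
        (Real.cos (inner ℝ (x i - x j) l) * Real.exp (-(4 * u)⁻¹ * ‖l‖ ^ 2)) := by
    intro l
    rw [norm_sq_trigSum, Finset.sum_mul]
    refine Finset.sum_congr rfl fun i _ => ?_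
    rw [Finset.sum_mul]
    exact Finset.sum_congr rfl fun j _ => by ring
  simp_rw [e]
  have hI : ∀ i j, Integrable (fun l : Plane => (w i * w j * (4 * Real.pi * u)⁻¹) *
        (Real.cos (inner ℝ (x i - x j) l) * Real.exp (-(4 * u)⁻¹ * ‖l‖ ^ 2))) :=
    fun i j => (hc i j).1.const_mul _
  refine ⟨integrable_finsetSum _ fun i _ => integrable_finsetSum _ fun j _ => hI i j, ?_⟩
  rw [integral_finsetSum _ fun i _ => integrable_finsetSum _ fun j _ => hI i j, expSum,
    Fintype.sum_prod_type]
  refine Finset.sum_congr rfl fun i _ => ?_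
  rw [integral_finsetSum _ fun j _ => hI i j]
  refine Finset.sum_congr rfl fun j _ => ?_
  rw [integral_const_mul, (hc i j).2]
  have : Real.pi ≠ 0 := Real.pi_ne_zero
  have e2 : ‖x i - x j‖ ^ 2 / (4 * (4 * u)⁻¹) = ‖x i - x j‖ ^ 2 * u := by field_simp
  rw [e2]
  field_simp

/-- The substitution `u ↦ 1/u` turns the mixture of heat kernels into a Gamma integral; this is
where the constant of the spectral density comes from. -/
lemma integral_rpow_mul_heat {s r : ℝ} (hs : 0 < s) (hr : 0 < r) :
    ∫ u in Set.Ioi (0 : ℝ), u ^ (-s - 1) * ((4 * Real.pi * u)⁻¹ *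
        Real.exp (-(4 * u)⁻¹ * r ^ 2))
      = 2 ^ (2 * s + 2) * Real.pi * Real.Gamma (1 + s) * r ^ (-(2 + 2 * s))
        * ((2 * Real.pi) ^ 2)⁻¹ := by
  have h1 := integral_comp_rpow_Ioi
    (fun v : ℝ => (4 * Real.pi)⁻¹ * (v ^ (s + 1 - 1) * Real.exp (-(r ^ 2 / 4 * v))))
    (p := -1) (by norm_num)
  rw [integral_const_mul, Real.integral_rpow_mul_exp_neg_mul_Ioi (by linarith) (by positivity)] at h1
  calc _ = ∫ u in Set.Ioi (0 : ℝ), (|(-1 : ℝ)| * u ^ ((-1 : ℝ) - 1)) • ((4 * Real.pi)⁻¹ *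
        ((u ^ (-1 : ℝ)) ^ (s + 1 - 1) * Real.exp (-(r ^ 2 / 4 * u ^ (-1 : ℝ))))) := by
        refine setIntegral_congr_fun measurableSet_Ioi fun u hu => ?_
        have hu' : (0 : ℝ) < u := hu
        have e1 : (u ^ (-1 : ℝ)) ^ (s + 1 - 1) = u ^ (-s) := by
          rw [← Real.rpow_mul hu'.le]; congr 1; ring
        have e2 : u ^ (-s - 1) = u ^ (-s) * u⁻¹ := by
          rw [← Real.rpow_neg_one, ← Real.rpow_add hu']; rfl
        have e3 : u ^ ((-1 : ℝ) - 1) = u⁻¹ * u⁻¹ := by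
          rw [← Real.rpow_neg_one, ← Real.rpow_add hu']; norm_num
        have e4 : -(r ^ 2 / 4 * u⁻¹) = -(4 * u)⁻¹ * r ^ 2 := by
          rw [mul_inv]; ring
        simp only [smul_eq_mul, abs_neg, abs_one, one_mul]
        rw [e1, e2, e3, Real.rpow_neg_one, e4, mul_inv (4 * Real.pi)]
        ring
    _ = _ := by
        rw [h1]
        have e1 : (1 / (r ^ 2 / 4)) ^ (s + 1) = 2 ^ (2 * s + 2) * r ^ (-(2 + 2 * s)) := by
          rw [one_div_div, Real.div_rpow (by norm_num) (by positivity), Real.rpow_neg hr.le,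
            show (4 : ℝ) = 2 ^ (2 : ℝ) by norm_num, ← Real.rpow_mul (by norm_num),
            ← Real.rpow_two, ← Real.rpow_mul hr.le, div_eq_mul_inv]
          congr 2
          · ring
          · ring_nf
        rw [e1, add_comm s 1]
        have : Real.pi ≠ 0 := Real.pi_ne_zero
        field_simp
        norm_num

/-- The quadratic form is the Mellin transform of an exponential sum, each value of which is a
Gaussian average over `λ`; the order of integration is then exchanged. The double integrand is
nonnegative, so its integrability follows from that of the Mellin integrand. -/
theorem spectral_representation {s : ℝ} (hs : 0 < s) {k : ℕ} (hk : s < k + 1) {w : ι → ℝ}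
    {x : ι → Plane} (h : AnnihilatesMonomials k w x) (φ₁ : ℝ) :
    Integrable (fun l : Plane => ‖trigSum w x l‖ ^ 2 * spectralDensity φ₁ s l) ∧
    ∑ i, ∑ j, w i * w j * powerLawCov φ₁ s (x i - x j)
      = ∫ l : Plane, ‖trigSum w x l‖ ^ 2 * spectralDensity φ₁ s l * ((2 * Real.pi) ^ 2)⁻¹ := by
  set W : ι × ι → ℝ := fun ij => w ij.1 * w ij.2
  set y : ι × ι → ℝ := fun ij => ‖x ij.1 - x ij.2‖ ^ 2
  have hy : ∀ ij, 0 ≤ y ij := fun ij => by positivity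
  have hW : ∀ r < k + 1, ∑ ij, W ij * y ij ^ r = 0 := by
    intro r hr
    rw [Fintype.sum_prod_type]
    exact h.sum_norm_sq_pow_eq_zero (by omega)
  have hk' : s < ((k + 1 : ℕ) : ℝ) := by exact_mod_cast hk
  set F : ℝ × Plane → ℝ := fun z => ‖trigSum w x z.2‖ ^ 2 *
    (z.1 ^ (-s - 1) * ((4 * Real.pi * z.1)⁻¹ * Real.exp (-(4 * z.1)⁻¹ * ‖z.2‖ ^ 2))) with hF
  have hFm : Measurable F := by
    have h1 : Measurable (fun z : ℝ × Plane => trigSum w x z.2) :=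
      (continuous_trigSum w x).measurable.comp measurable_snd
    fun_prop
  have hval : ∀ u ∈ Set.Ioi (0 : ℝ), Integrable (fun l => F (u, l)) ∧
      ∫ l, F (u, l) = u ^ (-s - 1) * expSum W y u := by
    intro u hu
    obtain ⟨h1, h2⟩ := integral_trigSum_heat w x hu
    have e : ∀ l, F (u, l) = u ^ (-s - 1) * (‖trigSum w x l‖ ^ 2 *
      ((4 * Real.pi * u)⁻¹ * Real.exp (-(4 * u)⁻¹ * ‖l‖ ^ 2))) := fun l => by
      simp only [hF]; ring
    simp_rw [e]
    exact ⟨h1.const_mul _, by rw [integral_const_mul, h2]⟩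
  have hFint : Integrable F ((volume.restrict (Set.Ioi 0)).prod volume) := by
    rw [integrable_prod_iff hFm.aestronglyMeasurable]
    constructor
    · filter_upwards [ae_restrict_mem measurableSet_Ioi] with u hu using (hval u hu).1
    · refine (integrableOn_expSum hy hW hk' (Or.inl hs)).congr ?_
      filter_upwards [ae_restrict_mem measurableSet_Ioi] with u hu
      rw [← (hval u hu).2]
      refine integral_congr_ae (ae_of_all _ fun l => ?_)
      have hu' : (0 : ℝ) < u := hu
      simp only [hF]
      rw [Real.norm_of_nonneg]
      positivity
  have hinner : ∀ᵐ l : Plane, ∫ u in Set.Ioi (0 : ℝ), F (u, l)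
      = ‖trigSum w x l‖ ^ 2 * spectralDensity 1 s l * ((2 * Real.pi) ^ 2)⁻¹ := by
    -- The formula for the integral over `u` needs `λ ≠ 0`; the origin is a null set.
    filter_upwards [compl_mem_ae_iff.2 (measure_singleton (0 : Plane))] with l hl
    have hl' : 0 < ‖l‖ := norm_pos_iff.2 (by simpa using hl)
    simp only [hF]
    rw [integral_const_mul, integral_rpow_mul_heat hs hl', spectralDensity]
    ring
  have hI1 : Integrable (fun l : Plane =>
      ‖trigSum w x l‖ ^ 2 * spectralDensity 1 s l * ((2 * Real.pi) ^ 2)⁻¹) :=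
    hFint.integral_prod_right.congr hinner
  have hφ : ∀ l, spectralDensity φ₁ s l = φ₁ * spectralDensity 1 s l := fun l => by
    simp only [spectralDensity]; ring
  constructor
  · refine (hI1.const_mul (φ₁ * (2 * Real.pi) ^ 2)).congr (ae_of_all _ fun l => ?_)
    have : (2 * Real.pi) ^ 2 ≠ 0 := by positivity
    simp only [hφ]
    field_simp
  · have e1 : ∑ i, ∑ j, w i * w j * powerLawCov φ₁ s (x i - x j)
        = φ₁ * ∑ ij, W ij * powerKernel s (y ij) := by
      rw [Fintype.sum_prod_type, Finset.mul_sum]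
      refine Finset.sum_congr rfl fun i _ => ?_
      rw [Finset.mul_sum]
      refine Finset.sum_congr rfl fun j _ => ?_
      rw [powerLawCov_eq_powerKernel]
      ring
    rw [e1, ← integral_expSum hy hW hk' (Or.inl hs)]
    have e2 : ∫ u in Set.Ioi (0 : ℝ), u ^ (-s - 1) * expSum W y u
        = ∫ u in Set.Ioi (0 : ℝ), ∫ l, F (u, l) :=
      setIntegral_congr_fun measurableSet_Ioi fun u hu => (hval u hu).2.symm
    rw [e2, integral_integral_swap hFint, integral_congr_ae hinner, ← integral_const_mul]
    refine integral_congr_ae (ae_of_all _ fun l => ?_)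
    simp only [hφ]
    ring

/-- Behaviour of the quadratic form of the generalized covariance under dilations. -/
theorem sum_powerLawCov_smul {φ₁ φ₂ : ℝ} (hφ₂ : 0 < φ₂) {w : ι → ℝ} {x : ι → Plane}
    (h : AnnihilatesMonomials ⌊φ₂⌋₊ w x) {c : ℝ} (hc : 0 < c) :
    ∑ i, ∑ j, w i * w j * powerLawCov φ₁ φ₂ (c • x i - c • x j)
      = c ^ (2 * φ₂) * ∑ i, ∑ j, w i * w j * powerLawCov φ₁ φ₂ (x i - x j) := by
  have hn : ∀ z : Plane, ‖c • z‖ = c * ‖z‖ := fun z => by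
    rw [norm_smul, Real.norm_of_nonneg hc.le]
  simp_rw [← smul_sub]
  by_cases hint : (⌊φ₂⌋₊ : ℝ) = φ₂
  -- For integer `φ₂` a dilation adds a multiple of `(log c) ‖z‖^(2φ₂)`. This is an even power of
  -- the distance, which the annihilation condition kills.
  · have hcov : ∀ z : Plane, powerLawCov φ₁ φ₂ (c • z) = c ^ (2 * φ₂) * powerLawCov φ₁ φ₂ z
        + (2 * φ₁ * (-1) ^ (⌊φ₂⌋₊ + 1) / (Nat.factorial ⌊φ₂⌋₊ : ℝ) * c ^ (2 * φ₂) * Real.log c)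
          * (‖z‖ ^ 2) ^ ⌊φ₂⌋₊ := by
      intro z
      have hpow : ‖z‖ ^ (2 * φ₂) = (‖z‖ ^ 2) ^ ⌊φ₂⌋₊ := by
        rw [← Real.rpow_natCast, hint, ← Real.rpow_two, ← Real.rpow_mul (norm_nonneg _)]
      simp only [powerLawCov, if_pos hint, hn]
      rw [Real.mul_rpow hc.le (norm_nonneg _)]
      rcases eq_or_ne z 0 with rfl | hz
      · have h0 : ⌊φ₂⌋₊ ≠ 0 := by
          intro h0; rw [h0] at hint; simp at hint; linarith
        simp [h0]
      · rw [Real.log_mul hc.ne' (norm_ne_zero_iff.2 hz), hpow]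
        ring
    have h0 := h.sum_norm_sq_pow_eq_zero le_rfl
    simp_rw [hcov, mul_add, Finset.sum_add_distrib, Finset.mul_sum]
    rw [add_eq_left.2]
    · exact Finset.sum_congr rfl fun i _ => Finset.sum_congr rfl fun j _ => by ring
    · set D := (2 * φ₁ * (-1) ^ (⌊φ₂⌋₊ + 1) / (Nat.factorial ⌊φ₂⌋₊ : ℝ) * c ^ (2 * φ₂)
        * Real.log c)
      calc _ = D * ∑ i, ∑ j, w i * w j * (‖x i - x j‖ ^ 2) ^ ⌊φ₂⌋₊ := by
            rw [Finset.mul_sum]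
            refine Finset.sum_congr rfl fun i _ => ?_
            rw [Finset.mul_sum]
            exact Finset.sum_congr rfl fun j _ => by ring
        _ = 0 := by rw [h0, mul_zero]
  · simp only [powerLawCov, if_neg hint, hn, Finset.mul_sum]
    refine Finset.sum_congr rfl fun i _ => Finset.sum_congr rfl fun j _ => ?_
    rw [Real.mul_rpow hc.le (norm_nonneg _)]
    ring

end Spectral

/-! ### Laws of increments of the field -/

/-- The points may coincide, as they do for overlapping stencils, so the weights are first collected
over the fibres of `x`. -/
lemma IsPowerLawField.hasLaw_sum {Ω ι : Type*} [MeasurableSpace Ω] [Fintype ι] {P : Measure Ω}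
    {φ₁ φ₂ : ℝ} {X : Plane → Ω → ℝ} (hX : IsPowerLawField φ₁ φ₂ X P) {w : ι → ℝ} {x : ι → Plane}
    (h : AnnihilatesMonomials ⌊φ₂⌋₊ w x) :
    HasLaw (fun ω => ∑ i, w i * X (x i) ω)
      (gaussianReal 0 (Real.toNNReal (∑ i, ∑ j, w i * w j * powerLawCov φ₁ φ₂ (x i - x j)))) P := by
  classical
  set S := Finset.univ.image x with hS
  set W : Plane → ℝ := fun z => ∑ i with x i = z, w i with hW
  have key : ∀ f : Plane → ℝ, ∑ z ∈ S, W z * f z = ∑ i, w i * f (x i) := by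
    intro f
    rw [← Finset.sum_fiberwise_of_maps_to (s := Finset.univ) (t := S) (g := x)
      (fun i _ => Finset.mem_image_of_mem x (Finset.mem_univ i))]
    refine Finset.sum_congr rfl fun z _ => ?_
    rw [hW, Finset.sum_mul]
    refine Finset.sum_congr rfl fun i hi => ?_
    rw [(Finset.mem_filter.1 hi).2]
  have hann : Annihilates ⌊φ₂⌋₊ S W := by
    intro q hq
    rw [key (fun z => MvPolynomial.eval (fun i => z i) q)]
    simp_rw [MvPolynomial.eval_eq', Fin.prod_univ_two, Finset.mul_sum]
    rw [Finset.sum_comm]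
    refine Finset.sum_eq_zero fun d hd => ?_
    have hdeg : d 0 + d 1 ≤ ⌊φ₂⌋₊ := by
      have := (MvPolynomial.le_totalDegree hd).trans hq
      rwa [Finsupp.sum_fintype _ _ (fun _ => rfl), Fin.sum_univ_two] at this
    have := h (d 0) (d 1) hdeg
    calc _ = MvPolynomial.coeff d q * ∑ i, w i * (x i 0 ^ d 0 * x i 1 ^ d 1) := by
          rw [Finset.mul_sum]
          exact Finset.sum_congr rfl fun i _ => by ring
      _ = 0 := by rw [this, mul_zero]
  have hlaw := hX.law S W hann
  have e1 : (fun ω => ∑ z ∈ S, W z * X z ω) = fun ω => ∑ i, w i * X (x i) ω :=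
    funext fun ω => key fun z => X z ω
  have e2 : ∑ z ∈ S, ∑ z' ∈ S, W z * W z' * powerLawCov φ₁ φ₂ (z - z')
      = ∑ i, ∑ j, w i * w j * powerLawCov φ₁ φ₂ (x i - x j) := by
    simp_rw [mul_assoc, ← Finset.mul_sum]
    rw [key (fun z => ∑ z' ∈ S, W z' * powerLawCov φ₁ φ₂ (z - z'))]
    refine Finset.sum_congr rfl fun i _ => ?_
    rw [key (fun z' => powerLawCov φ₁ φ₂ (x i - z'))]
  rwa [e1, e2] at hlaw

/-- Self-similarity of the power-law field. -/
lemma IsPowerLawField.rescale {Ω : Type*} [MeasurableSpace Ω] {P : Measure Ω}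
    {φ₁ φ₂ : ℝ} (hφ₂ : 0 < φ₂) {X : Plane → Ω → ℝ} (hX : IsPowerLawField φ₁ φ₂ X P) {c : ℝ}
    (hc : 0 < c) : IsPowerLawField φ₁ φ₂ (fun x ω => c ^ (-φ₂) * X (c • x) ω) P where
  measurable x := (hX.measurable _).const_mul _
  law s w hw := by
    have hmono : AnnihilatesMonomials ⌊φ₂⌋₊ (fun i : s => w i) (fun i : s => (i : Plane)) := by
      intro p q hpq
      have h1 := hw (MvPolynomial.X 0 ^ p * MvPolynomial.X 1 ^ q)
        ((MvPolynomial.totalDegree_mul _ _).trans ((add_le_add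
          (by simp)
          (by simp)).trans hpq))
      simp only [map_mul, map_pow, MvPolynomial.eval_X] at h1
      rw [← Finset.sum_coe_sort] at h1
      exact h1
    have hmono' : AnnihilatesMonomials ⌊φ₂⌋₊ (fun i : s => c ^ (-φ₂) * w i)
        (fun i : s => c • (i : Plane)) := by
      intro p q hpq
      have := hmono p q hpq
      calc _ = c ^ (-φ₂) * c ^ p * c ^ q * ∑ i : s, w i * ((i : Plane) 0 ^ p * (i : Plane) 1 ^ q) := by
            rw [Finset.mul_sum]
            refine Finset.sum_congr rfl fun i _ => ?_
            simp only [PiLp.smul_apply, smul_eq_mul, mul_pow]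
            ring
        _ = 0 := by rw [this, mul_zero]
    have hlaw := hX.hasLaw_sum hmono'
    have e1 : (fun ω => ∑ i : s, (c ^ (-φ₂) * w i) * X (c • (i : Plane)) ω)
        = fun ω => ∑ x ∈ s, w x * (c ^ (-φ₂) * X (c • x) ω) := by
      ext ω
      rw [← Finset.sum_coe_sort s]
      exact Finset.sum_congr rfl fun i _ => by ring
    have e2 : ∑ i : s, ∑ j : s, (c ^ (-φ₂) * w i) * (c ^ (-φ₂) * w j) *
        powerLawCov φ₁ φ₂ (c • (i : Plane) - c • (j : Plane))
        = ∑ x ∈ s, ∑ y ∈ s, w x * w y * powerLawCov φ₁ φ₂ (x - y) := by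
      have h1 := sum_powerLawCov_smul (φ₁ := φ₁) hφ₂ hmono hc
      have h2 : c ^ (-φ₂) * c ^ (-φ₂) * c ^ (2 * φ₂) = 1 := by
        rw [← Real.rpow_add hc, ← Real.rpow_add hc]; ring_nf; simp
      calc _ = c ^ (-φ₂) * c ^ (-φ₂) * ∑ i : s, ∑ j : s, w i * w j *
            powerLawCov φ₁ φ₂ (c • (i : Plane) - c • (j : Plane)) := by
            rw [Finset.mul_sum]
            refine Finset.sum_congr rfl fun i _ => ?_
            rw [Finset.mul_sum]
            exact Finset.sum_congr rfl fun j _ => by ring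
        _ = ∑ i : s, ∑ j : s, w i * w j * powerLawCov φ₁ φ₂ ((i : Plane) - (j : Plane)) := by
            rw [h1, ← mul_assoc, h2, one_mul]
        _ = _ := by
            rw [← Finset.sum_coe_sort s]
            refine Finset.sum_congr rfl fun i _ => ?_
            rw [← Finset.sum_coe_sort s]
    rwa [e1, e2] at hlaw

/-! ### Bilinear differences in the spectral domain -/

lemma sum_stencil_prod {𝕜 : Type*} [RCLike 𝕜] (m : ℕ) (f : Fin 2 → ℕ → 𝕜) :
    ∑ a ∈ stencil m, (coeff m a : 𝕜) * ∏ r, f r (a r)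
      = ∏ r, ∑ i ∈ Finset.range (m + 1), (-1) ^ i * (m.choose i : 𝕜) * f r i := by
  rw [Finset.prod_univ_sum]
  refine Finset.sum_congr rfl fun a _ => ?_
  rw [Finset.prod_mul_distrib, coeff]
  push_cast
  rfl

/-- Up to sign this is an `m`-fold forward difference, at zero, of a polynomial of degree less than
`m`. -/
lemma sum_binomial_mul_pow_eq_zero {m p : ℕ} (hp : p < m) (t d : ℝ) :
    ∑ i ∈ Finset.range (m + 1), (-1) ^ i * (m.choose i : ℝ) * (t + d * i) ^ p = 0 := by
  set Q : Polynomial ℝ := (Polynomial.C t + Polynomial.C d * Polynomial.X) ^ p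
  have hQ : Q.natDegree < m := by
    refine lt_of_le_of_lt (Polynomial.natDegree_pow_le.trans ?_) hp
    have : (Polynomial.C t + Polynomial.C d * Polynomial.X).natDegree ≤ 1 := by compute_degree
    nlinarith
  have h1 := congr_fun (Polynomial.fwdDiff_iter_eq_zero_of_degree_lt hQ) 0
  rw [fwdDiff_iter_eq_sum_shift] at h1
  have h2 : ∀ i ∈ Finset.range (m + 1), (-1) ^ i * (m.choose i : ℝ) * (t + d * i) ^ p
      = (-1) ^ m * (((-1 : ℤ) ^ (m - i) * m.choose i) • Q.eval (0 + i • (1 : ℝ))) := by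
    intro i hi
    have hi' : i ≤ m := by have := Finset.mem_range.1 hi; omega
    have h3 : (-1 : ℝ) ^ m * (-1) ^ (m - i) = (-1) ^ i := by
      rw [← pow_add, show m + (m - i) = i + 2 * (m - i) by omega, pow_add, pow_mul]
      simp
    simp only [Q, zsmul_eq_mul, Polynomial.eval_pow, Polynomial.eval_add, Polynomial.eval_C,
      Polynomial.eval_mul, Polynomial.eval_X]
    push_cast
    rw [← h3]
    simp
    ring
  rw [Finset.sum_congr rfl h2, ← Finset.mul_sum, h1]
  simp

lemma toPlane_apply (t : Site) (r : Fin 2) : toPlane t r = t r := rfl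

lemma toPlane_add_smul (t a : Site) (j : ℕ) : toPlane (t + j • a) = toPlane t + (j : ℝ) • toPlane a := by
  ext r
  simp [toPlane]

lemma inner_toPlane (t : Site) (l : Plane) : inner ℝ (toPlane t) l = ∑ r, (t r : ℝ) * l r := by
  simp [PiLp.inner_apply, toPlane, mul_comm]

/-- The transfer function that turns the unit-step difference into the difference of step `i + 1`. -/
noncomputable def transfer (m : ℕ) (i : Fin 2) (l : Plane) : ℂ :=
  ![1, ∏ r, (1 + Complex.exp (Complex.I * (l r : ℂ))) ^ m] i

@[fun_prop]
lemma continuous_transfer (m : ℕ) (i : Fin 2) : Continuous (transfer m i) := by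
  unfold transfer
  fin_cases i
  · simpa using continuous_const
  · simp only [Fin.mk_one, Matrix.cons_val_one, Matrix.cons_val_fin_one]
    fun_prop

@[fun_prop]
lemma continuous_symbol (m : ℕ) : Continuous (symbol m) := by
  unfold symbol; fun_prop

lemma sum_binomial_exp (m : ℕ) (z : ℂ) :
    ∑ i ∈ Finset.range (m + 1), (-1) ^ i * (m.choose i : ℂ) * z ^ i = (1 - z) ^ m := by
  rw [show (1 - z) = (-z) + 1 by ring, add_pow]
  refine Finset.sum_congr rfl fun i _ => ?_
  rw [neg_pow z]; simp; ring

/-- The sum factorizes over the coordinates by the binomial theorem. For step two, `1 - z² = (1 -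
z)(1 + z)` separates the unit-step symbol from the transfer function. -/
lemma sum_stencil_exp (m : ℕ) (i : Fin 2) (l : Plane) :
    ∑ a ∈ stencil m, (coeff m a : ℂ) *
        Complex.exp (inner ℝ (((i : ℕ) + 1 : ℕ) • toPlane a) l * Complex.I)
      = symbol m l * transfer m i l := by
  have h1 : ∀ a : Site, Complex.exp (inner ℝ (((i : ℕ) + 1 : ℕ) • toPlane a) l * Complex.I)
      = ∏ r, (Complex.exp (((i : ℕ) + 1 : ℕ) * (Complex.I * l r))) ^ (a r) := by
    intro a
    rw [← Nat.cast_smul_eq_nsmul ℝ, real_inner_smul_left, inner_toPlane]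
    simp_rw [← Complex.exp_nat_mul]
    rw [← Complex.exp_sum]
    congr 1
    push_cast
    rw [Finset.mul_sum, Finset.sum_mul]
    refine Finset.sum_congr rfl fun r _ => ?_
    ring
  simp_rw [h1]
  have := sum_stencil_prod (𝕜 := ℂ) m
    (fun r n => (Complex.exp (((i : ℕ) + 1 : ℕ) * (Complex.I * l r))) ^ n)
  simp only [Complex.coe_algebraMap] at this
  rw [this]
  simp_rw [sum_binomial_exp]
  fin_cases i
  · simp [symbol, transfer]
  · simp only [symbol, transfer, Fin.mk_one, Matrix.cons_val_one, Matrix.cons_val_fin_one]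
    rw [← Finset.prod_mul_distrib]
    refine Finset.prod_congr rfl fun r _ => ?_
    rw [← mul_pow]
    congr 1
    have : Complex.exp (((1 + 1 : ℕ) : ℂ) * (Complex.I * l r))
      = Complex.exp (Complex.I * l r) ^ 2 := by
      rw [← Complex.exp_nat_mul]
    rw [this]; ring

section Increments

variable {ι : Type*} [Fintype ι]

/-- Weights of the signed measure representing a linear combination of differences. -/
noncomputable def incWeight (m : ℕ) (v : ι → ℝ) (z : ι × stencil m) : ℝ := v z.1 * coeff m z.2

/-- Points of the signed measure representing a linear combination of differences. -/
noncomputable def incPoint (m : ℕ) (c : ι → Fin 2 × Site) (z : ι × stencil m) : Plane :=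
  toPlane ((c z.1).2 + (((c z.1).1 : ℕ) + 1) • (z.2 : Site))

/-- The spectral representative of a linear combination of differences, without the symbol of the
unit-step difference. -/
noncomputable def featureSum (m : ℕ) (v : ι → ℝ) (c : ι → Fin 2 × Site) (l : Plane) : ℂ :=
  ∑ i, (v i : ℂ) * (transfer m (c i).1 l * Complex.exp (inner ℝ (toPlane (c i).2) l * Complex.I))

@[fun_prop]
lemma continuous_featureSum (m : ℕ) (v : ι → ℝ) (c : ι → Fin 2 × Site) :
    Continuous (featureSum m v c) := by
  unfold featureSum; fun_prop

lemma annihilates_inc {m k : ℕ} (hk : k < m) (v : ι → ℝ) (c : ι → Fin 2 × Site) :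
    AnnihilatesMonomials k (incWeight m v) (incPoint m c) := by
  intro p q hpq
  rw [Fintype.sum_prod_type]
  refine Finset.sum_eq_zero fun i _ => ?_
  set j : ℕ := ((c i).1 : ℕ) + 1
  have h := sum_stencil_prod (𝕜 := ℝ) m
    (fun r n => (((c i).2 r : ℝ) + (j : ℝ) * n) ^ (![p, q] r))
  have h0 : ∏ r, ∑ n ∈ Finset.range (m + 1), (-1) ^ n * (m.choose n : ℝ) *
      (((c i).2 r : ℝ) + (j : ℝ) * n) ^ (![p, q] r) = 0 := by
    -- The first coordinate alone suffices: its exponent satisfies `p ≤ k < m`.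
    rw [Finset.prod_eq_zero (Finset.mem_univ (0 : Fin 2))]
    exact sum_binomial_mul_pow_eq_zero (by simp; omega) _ _
  rw [h0] at h
  calc _ = v i * ∑ a : stencil m, coeff m a *
        ∏ r, (((c i).2 r : ℝ) + (j : ℝ) * ((a : Site) r)) ^ (![p, q] r) := by
        rw [Finset.mul_sum]
        refine Finset.sum_congr rfl fun a _ => ?_
        simp only [incWeight, incPoint, toPlane_apply, Fin.prod_univ_two, Pi.add_apply,
          Pi.smul_apply, smul_eq_mul]
        push_cast
        simp [j]
        ring
    _ = 0 := by
        rw [Finset.sum_coe_sort (stencil m) (fun a : Site => coeff m a *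
          ∏ r, (((c i).2 r : ℝ) + (j : ℝ) * (a r)) ^ (![p, q] r))]
        simp only [RCLike.ofReal_real_eq_id, id] at h
        rw [h, mul_zero]

lemma trigSum_inc (m : ℕ) (v : ι → ℝ) (c : ι → Fin 2 × Site) (l : Plane) :
    trigSum (incWeight m v) (incPoint m c) l = symbol m l * featureSum m v c l := by
  rw [trigSum, Fintype.sum_prod_type, featureSum, Finset.mul_sum]
  refine Finset.sum_congr rfl fun i _ => ?_
  have h := sum_stencil_exp m (c i).1 l
  rw [← Finset.sum_coe_sort] at h
  calc _ = (v i : ℂ) * Complex.exp (inner ℝ (toPlane (c i).2) l * Complex.I) *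
        ∑ a : stencil m, (coeff m a : ℂ) *
          Complex.exp (inner ℝ ((((c i).1 : ℕ) + 1 : ℕ) • toPlane a) l * Complex.I) := by
        rw [Finset.mul_sum]
        refine Finset.sum_congr rfl fun a _ => ?_
        simp only [incWeight, incPoint]
        rw [toPlane_add_smul, inner_add_left, Nat.cast_smul_eq_nsmul]
        push_cast
        rw [add_mul, Complex.exp_add]
        ring
    _ = _ := by rw [h]; ring

/-- The spectral density of the unit-step difference of the field on the plane. -/
noncomputable def planeDensity (m : ℕ) (φ₁ φ₂ : ℝ) (l : Plane) : ℝ :=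
  ‖symbol m l‖ ^ 2 * spectralDensity φ₁ φ₂ l * ((2 * Real.pi) ^ 2)⁻¹

lemma planeDensity_inc_spectral {m : ℕ} {φ₁ φ₂ : ℝ} (hφ₂ : 0 < φ₂) (hm : ⌊φ₂⌋₊ + 1 ≤ m)
    (v : ι → ℝ) (c : ι → Fin 2 × Site) :
    Integrable (fun l => ‖featureSum m v c l‖ ^ 2 * planeDensity m φ₁ φ₂ l) ∧
    ∑ z, ∑ z', incWeight m v z * incWeight m v z' *
        powerLawCov φ₁ φ₂ (incPoint m c z - incPoint m c z')
      = ∫ l, ‖featureSum m v c l‖ ^ 2 * planeDensity m φ₁ φ₂ l := by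
  obtain ⟨h1, h2⟩ := spectral_representation hφ₂ (Nat.lt_floor_add_one φ₂)
    (annihilates_inc (show ⌊φ₂⌋₊ < m by omega) v c) φ₁
  have e : ∀ l, ‖featureSum m v c l‖ ^ 2 * planeDensity m φ₁ φ₂ l
      = ‖trigSum (incWeight m v) (incPoint m c) l‖ ^ 2 * spectralDensity φ₁ φ₂ l
        * ((2 * Real.pi) ^ 2)⁻¹ := by
    intro l
    rw [trigSum_inc, norm_mul, planeDensity]; ring
  simp_rw [e]
  exact ⟨h1.mul_const _, h2⟩

/-- Linear combinations of differences of the field are centered Gaussian. -/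
lemma IsPowerLawField.hasLaw_inc {Ω : Type*} [MeasurableSpace Ω] {P : Measure Ω}
    {φ₁ φ₂ : ℝ} {X : Plane → Ω → ℝ} (hX : IsPowerLawField φ₁ φ₂ X P) (hφ₂ : 0 < φ₂) {m : ℕ}
    (hm : ⌊φ₂⌋₊ + 1 ≤ m) (v : ι → ℝ) (c : ι → Fin 2 × Site) :
    HasLaw (fun ω => ∑ i, v i * bilinDiff m (((c i).1 : ℕ) + 1) (idSample X ω) (c i).2)
      (gaussianReal 0 (Real.toNNReal (∫ l, ‖featureSum m v c l‖ ^ 2 * planeDensity m φ₁ φ₂ l)))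
      P := by
  have h := hX.hasLaw_sum (annihilates_inc (k := ⌊φ₂⌋₊) (by omega : ⌊φ₂⌋₊ < m) v c)
  rw [(planeDensity_inc_spectral hφ₂ hm v c).2] at h
  convert h using 2 with ω
  rw [Fintype.sum_prod_type]
  refine Finset.sum_congr rfl fun i _ => ?_
  rw [bilinDiff, Finset.mul_sum, ← Finset.sum_coe_sort (stencil m)]
  refine Finset.sum_congr rfl fun a _ => ?_
  simp only [incWeight, incPoint, idSample]
  ring

end Increments

/-! ### The scale function -/

lemma scaleFun_eq_sum_powerKernel (m : ℕ) (s : ℝ) :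
    scaleFun m s = ∑ z : stencil m × stencil m, (coeff m z.1 * coeff m z.2) *
      powerKernel s (‖toPlane z.1 - toPlane z.2‖ ^ 2) := by
  rw [scaleFun, Fintype.sum_prod_type, ← Finset.sum_coe_sort (stencil m)]
  refine Finset.sum_congr rfl fun a _ => ?_
  rw [← Finset.sum_coe_sort (stencil m)]
  refine Finset.sum_congr rfl fun b _ => ?_
  rw [powerLawCov_eq_powerKernel, norm_sub_rev, one_mul]

lemma annihilates_stencil {m k : ℕ} (hk : k < m) :
    AnnihilatesMonomials k (fun a : stencil m => coeff m a) (fun a => toPlane a) := by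
  intro p q hpq
  have h := annihilates_inc hk (fun _ : Unit => 1) (fun _ => ((0 : Fin 2), (0 : Site))) p q hpq
  rw [Fintype.sum_prod_type] at h
  simpa [incWeight, incPoint] using h

lemma sum_stencil_pow_eq_zero {m r : ℕ} (hr : r < m) :
    ∑ z : stencil m × stencil m, (coeff m z.1 * coeff m z.2) *
      (‖toPlane z.1 - toPlane z.2‖ ^ 2) ^ r = 0 := by
  rw [Fintype.sum_prod_type]
  exact (annihilates_stencil hr).sum_norm_sq_pow_eq_zero le_rfl

lemma differentiableAt_scaleFun {m : ℕ} {s : ℝ} (hs : 0 < s) (hsm : s < m) :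
    DifferentiableAt ℝ (scaleFun m) s := by
  have := differentiableAt_sum_powerKernel
    (W := fun z : stencil m × stencil m => coeff m z.1 * coeff m z.2)
    (y := fun z => ‖toPlane z.1 - toPlane z.2‖ ^ 2) (fun z => by positivity)
    (fun r hr => sum_stencil_pow_eq_zero hr) hs hsm
  simp_rw [← scaleFun_eq_sum_powerKernel] at this
  exact this

lemma toPlane_injective : Function.Injective toPlane := by
  intro a b h
  ext r
  simpa [toPlane] using congrArg (fun z : Plane => z r) h

/-- In the Mellin representation the exponential sum is nonnegative, being a Gaussian average of
squares. As `u → ∞` only the diagonal terms survive, and they add up to `∑ c_a² > 0`. -/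
lemma scaleFun_pos {m : ℕ} {s : ℝ} (hs : 0 < s) (hsm : s < m) : 0 < scaleFun m s := by
  set W : stencil m × stencil m → ℝ := fun z => coeff m z.1 * coeff m z.2
  set y : stencil m × stencil m → ℝ := fun z => ‖toPlane z.1 - toPlane z.2‖ ^ 2
  have hy : ∀ z, 0 ≤ y z := fun z => by positivity
  have hW : ∀ r < m, ∑ z, W z * y z ^ r = 0 := fun r hr => sum_stencil_pow_eq_zero hr
  have hint := integrableOn_expSum hy hW hsm (Or.inl hs)
  rw [scaleFun_eq_sum_powerKernel, ← integral_expSum hy hW hsm (Or.inl hs)]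
  have hnn : ∀ u ∈ Set.Ioi (0 : ℝ), 0 ≤ expSum W y u := by
    intro u hu
    have := (integral_trigSum_heat (fun a : stencil m => coeff m a) (fun a => toPlane a) hu).2
    rw [← this]
    have hu' : (0 : ℝ) < u := hu
    exact integral_nonneg fun l => by positivity
  have hlim : Tendsto (expSum W y) atTop (𝓝 (∑ z, W z * (if z.1 = z.2 then 1 else 0))) := by
    unfold expSum
    refine tendsto_finsetSum _ fun z _ => Tendsto.const_mul _ ?_
    split_ifs with h
    · simp [y, h]
    · have hp : 0 < y z := by
        have : toPlane (z.1 : Site) - toPlane (z.2 : Site) ≠ 0 := by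
          rw [sub_ne_zero]
          exact fun h' => h (Subtype.ext (toPlane_injective h'))
        have := norm_pos_iff.2 this
        positivity
      exact Real.tendsto_exp_neg_atTop_nhds_zero.comp (tendsto_id.const_mul_atTop hp)
  have hpos : 0 < ∑ z, W z * (if z.1 = z.2 then 1 else 0) := by
    rw [Fintype.sum_prod_type]
    simp only [W, mul_ite, mul_one, mul_zero, Finset.sum_ite_eq, Finset.mem_univ, if_true]
    have h0 : (0 : Site) ∈ stencil m := by simp [stencil, grid]
    refine Finset.sum_pos' (fun a _ => mul_self_nonneg _) ⟨⟨0, h0⟩, Finset.mem_univ _, ?_⟩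
    simp [coeff]
  obtain ⟨A, hA⟩ := eventually_atTop.1 (hlim.eventually (lt_mem_nhds hpos))
  have hsub : Set.Ioi (max A 0) ⊆ Function.support (fun u : ℝ => u ^ (-s - 1) * expSum W y u) := by
    intro u hu
    have h1 : 0 < u := lt_of_le_of_lt (le_max_right _ _) hu
    have h2 : A ≤ u := (lt_of_le_of_lt (le_max_left _ _) hu).le
    have h3 := hA u h2
    have h4 : 0 < u ^ (-s - 1) * expSum W y u := mul_pos (Real.rpow_pos_of_pos h1 _) h3
    exact h4.ne'
  rw [setIntegral_pos_iff_support_of_nonneg_ae _ hint]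
  · refine lt_of_lt_of_le ?_ (measure_mono (Set.subset_inter hsub
      (Set.Ioi_subset_Ioi (le_max_right A 0))))
    simp
  · filter_upwards [ae_restrict_mem measurableSet_Ioi] with u hu
    exact mul_nonneg (Real.rpow_nonneg (le_of_lt hu) _) (hnn u hu)

/-- The variances of the differences. -/
lemma integral_featureSum_single {m : ℕ} {φ₁ φ₂ : ℝ} (hφ₂ : 0 < φ₂) (hm : ⌊φ₂⌋₊ + 1 ≤ m)
    (i : Fin 2) (t : Site) :
    ∫ l, ‖featureSum m (fun _ : Unit => 1) (fun _ => (i, t)) l‖ ^ 2 * planeDensity m φ₁ φ₂ l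
      = meanPair m φ₁ φ₂ i := by
  rw [← (planeDensity_inc_spectral hφ₂ hm _ _).2]
  -- A difference of step `j` is the unit-step stencil dilated by `j`, whence the factor `j^(2φ₂)`.
  have h := sum_powerLawCov_smul (φ₁ := φ₁) hφ₂ (annihilates_stencil (m := m) (k := ⌊φ₂⌋₊) (by omega))
    (c := ((i : ℕ) + 1 : ℕ)) (by positivity)
  have e1 : ∑ a : stencil m, ∑ b : stencil m, coeff m a * coeff m b *
      powerLawCov φ₁ φ₂ (toPlane a - toPlane b) = φ₁ * scaleFun m φ₂ := by
    rw [scaleFun_eq_sum_powerKernel, Fintype.sum_prod_type, Finset.mul_sum]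
    refine Finset.sum_congr rfl fun a _ => ?_
    rw [Finset.mul_sum]
    refine Finset.sum_congr rfl fun b _ => ?_
    rw [powerLawCov_eq_powerKernel]; ring
  rw [e1] at h
  have e2 : ((((i : ℕ) + 1 : ℕ) : ℝ)) ^ (2 * φ₂) * (φ₁ * scaleFun m φ₂) = meanPair m φ₁ φ₂ i := by
    fin_cases i
    · simp [meanPair]
    · simp [meanPair]; ring_nf
  rw [← e2, ← h, Fintype.sum_prod_type]
  simp only [Finset.univ_unique, Finset.sum_singleton, incWeight, incPoint, one_mul]
  refine Finset.sum_congr rfl fun a _ => ?_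
  rw [Fintype.sum_prod_type]
  simp only [Finset.univ_unique, Finset.sum_singleton]
  refine Finset.sum_congr rfl fun b _ => ?_
  rw [toPlane_add_smul, toPlane_add_smul, add_sub_add_left_eq_sub]

/-! ### Periodization -/

/-- The dual lattice vector `2πk`. -/
noncomputable def dualPoint (k : Fin 2 → ℤ) : Plane :=
  (2 * Real.pi) • WithLp.toLp 2 (fun i => (k i : ℝ))

lemma dualPoint_apply (k : Fin 2 → ℤ) (r : Fin 2) : dualPoint k r = 2 * Real.pi * k r := rfl

lemma measurableSet_torus : MeasurableSet torus := by
  have : torus = ⋂ i : Fin 2, (fun l : Plane => l i) ⁻¹' Set.Ioc (-Real.pi) Real.pi := by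
    ext l; simp [torus]
  rw [this]
  exact MeasurableSet.iInter fun i => (by fun_prop : Measurable fun l : Plane => l i) measurableSet_Ioc

lemma existsUnique_sub_mem_torus (l : Plane) : ∃! k : Fin 2 → ℤ, l - dualPoint k ∈ torus := by
  have h : ∀ r, ∃! n : ℤ, l r - 2 * Real.pi * n ∈ Set.Ioc (-Real.pi) Real.pi := by
    intro r
    obtain ⟨n, hn, hu⟩ := existsUnique_add_zsmul_mem_Ioc Real.two_pi_pos (l r) (-Real.pi)
    simp only [Set.mem_Ioc, zsmul_eq_mul] at hn hu ⊢
    refine ⟨-n, ?_, fun n' hn' => ?_⟩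
    · push_cast
      constructor <;> linarith [hn.1, hn.2]
    · have := hu (-n') (by
        push_cast
        constructor <;> linarith [hn'.1, hn'.2])
      omega
  choose k hk hu using h
  exact ⟨k, fun r => hk r, fun k' hk' => funext fun r => hu r (k' r) (hk' r)⟩

/-- Integration over the plane by summation over the translates of the torus. -/
theorem integral_eq_integral_torus_tsum {g : Plane → ℝ} (hg : Integrable g) :
    ∫ l, g l = ∫ l in torus, ∑' k : Fin 2 → ℤ, g (l + dualPoint k) := by
  set cell : (Fin 2 → ℤ) → Set Plane := fun k => {l | l - dualPoint k ∈ torus} with hcell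
  have hmeas : ∀ k, MeasurableSet (cell k) := fun k =>
    (by fun_prop : Measurable fun l : Plane => l - dualPoint k) measurableSet_torus
  have hunion : ⋃ k, cell k = Set.univ := by
    refine Set.eq_univ_of_forall fun l => Set.mem_iUnion.2 ?_
    obtain ⟨k, hk, -⟩ := existsUnique_sub_mem_torus l
    exact ⟨k, hk⟩
  have hdisj : Pairwise (Function.onFun Disjoint cell) := by
    intro k k' hkk
    refine Set.disjoint_left.2 fun l hl hl' => hkk ?_
    exact (existsUnique_sub_mem_torus l).unique hl hl'
  have hshift : ∀ (f : Plane → ℝ) k, ∫ l in cell k, f l = ∫ l in torus, f (l + dualPoint k) := by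
    intro f k
    have h1 := (measurePreserving_add_right (volume : Measure Plane) (dualPoint k)).setIntegral_preimage_emb
      (measurableEmbedding_addRight _) f (cell k)
    rw [← h1]
    congr 2
    ext l
    simp [hcell]
  have hS : ∀ {f : Plane → ℝ}, Integrable f →
      HasSum (fun k => ∫ l in torus, f (l + dualPoint k)) (∫ l, f l) := by
    intro f hf
    have := hasSum_integral_iUnion (f := f) hmeas hdisj hf.integrableOn
    simp_rw [hshift f, hunion, Measure.restrict_univ] at this
    exact this
  have hI : ∀ k, Integrable (fun l => g (l + dualPoint k)) (volume.restrict torus) := fun k =>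
    (hg.comp_add_right (dualPoint k)).integrableOn
  have h1 := hasSum_integral_of_summable_integral_norm hI (hS hg.norm).summable
  exact (hS hg).unique h1

lemma symbol_add_dualPoint (m : ℕ) (l : Plane) (k : Fin 2 → ℤ) :
    symbol m (l + dualPoint k) = symbol m l := by
  unfold symbol
  refine Finset.prod_congr rfl fun r _ => ?_
  have : Complex.exp (Complex.I * ((l + dualPoint k) r : ℝ)) = Complex.exp (Complex.I * (l r : ℝ)) := by
    rw [PiLp.add_apply, dualPoint_apply]
    push_cast
    rw [show Complex.I * ((l r : ℂ) + 2 * Real.pi * (k r : ℂ))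
      = Complex.I * l r + (k r : ℂ) * (2 * Real.pi * Complex.I) by ring]
    exact Complex.exp_periodic.int_mul (k r) _
  rw [this]

/-- Periodization of an integral against the spectral density on the plane. -/
theorem integral_planeDensity_eq_torus {m : ℕ} {φ₁ φ₂ : ℝ} {T : Plane → ℝ}
    (hper : ∀ l k, T (l + dualPoint k) = T l)
    (hint : Integrable fun l => T l * planeDensity m φ₁ φ₂ l) :
    ∫ l, T l * planeDensity m φ₁ φ₂ l
      = ∫ l in torus, T l * filteredDensity m φ₁ φ₂ l * ((2 * Real.pi) ^ 2)⁻¹ := by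
  rw [integral_eq_integral_torus_tsum hint]
  refine integral_congr_ae (ae_of_all _ fun l => ?_)
  simp only [planeDensity, hper, symbol_add_dualPoint, filteredDensity, aliasedDensity]
  rw [tsum_mul_left, tsum_mul_right, tsum_mul_left]
  simp only [dualPoint]
  ring

/-! ### Bounds for the filtered density -/

lemma spectralDensity_nonneg {φ₁ φ₂ : ℝ} (hφ₁ : 0 ≤ φ₁) (hφ₂ : 0 < φ₂) (l : Plane) :
    0 ≤ spectralDensity φ₁ φ₂ l := by
  have : 0 < Real.Gamma (1 + φ₂) := Real.Gamma_pos_of_pos (by linarith)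
  have := Real.pi_pos
  unfold spectralDensity
  positivity

@[fun_prop]
lemma measurable_spectralDensity (φ₁ φ₂ : ℝ) : Measurable (spectralDensity φ₁ φ₂) := by
  unfold spectralDensity; fun_prop

lemma measurable_filteredDensity {m : ℕ} {φ₁ φ₂ : ℝ} (hφ₁ : 0 ≤ φ₁) (hφ₂ : 0 < φ₂) :
    Measurable (filteredDensity m φ₁ φ₂) := by
  have h : aliasedDensity φ₁ φ₂ = fun l => (∑' k : Fin 2 → ℤ,
      ENNReal.ofReal (spectralDensity φ₁ φ₂ (l + dualPoint k))).toReal := by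
    ext l
    rw [ENNReal.tsum_toReal_eq (fun _ => ENNReal.ofReal_ne_top)]
    simp_rw [ENNReal.toReal_ofReal (spectralDensity_nonneg hφ₁ hφ₂ _)]
    rfl
  have h2 : Measurable (aliasedDensity φ₁ φ₂) := by
    rw [h]
    refine (Measurable.tsum fun k => ?_).ennreal_toReal
    fun_prop
  have h3 : Measurable (symbol m) := (continuous_symbol m).measurable
  unfold filteredDensity
  fun_prop

lemma filteredDensity_nonneg {m : ℕ} {φ₁ φ₂ : ℝ} (hφ₁ : 0 ≤ φ₁) (hφ₂ : 0 < φ₂) (l : Plane) :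
    0 ≤ filteredDensity m φ₁ φ₂ l :=
  mul_nonneg (by positivity) (tsum_nonneg fun _ => spectralDensity_nonneg hφ₁ hφ₂ _)

lemma norm_symbol_le (m : ℕ) (l : Plane) : ‖symbol m l‖ ≤ 4 ^ m := by
  rw [symbol, norm_prod, Fin.prod_univ_two]
  have h : ∀ r, ‖(1 - Complex.exp (Complex.I * (l r : ℂ))) ^ m‖ ≤ 2 ^ m := by
    intro r
    rw [norm_pow]
    gcongr
    refine (norm_sub_le _ _).trans ?_
    rw [Complex.norm_exp_I_mul_ofReal]
    norm_num
  calc _ ≤ (2 : ℝ) ^ m * 2 ^ m := mul_le_mul (h 0) (h 1) (norm_nonneg _) (by positivity)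
    _ = 4 ^ m := by rw [← mul_pow]; norm_num

lemma abs_apply_le_norm (l : Plane) (r : Fin 2) : |l r| ≤ ‖l‖ := by
  simpa using PiLp.norm_apply_le l r

lemma norm_symbol_le_pow (m : ℕ) (l : Plane) : ‖symbol m l‖ ≤ ‖l‖ ^ (2 * m) := by
  rw [symbol, norm_prod, Fin.prod_univ_two, two_mul, pow_add]
  have h : ∀ r, ‖(1 - Complex.exp (Complex.I * (l r : ℂ))) ^ m‖ ≤ ‖l‖ ^ m := by
    intro r
    rw [norm_pow, norm_sub_rev]
    gcongr
    exact (Real.norm_exp_I_mul_ofReal_sub_one_le (x := l r)).trans (abs_apply_le_norm l r)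
  exact mul_le_mul (h 0) (h 1) (norm_nonneg _) (by positivity)

/-- In the unit ball the squared symbol is at most `‖l‖^(4m)`, and `4m ≥ 2 + 2φ₂` because `m ≥ 1`
and `m > φ₂`. Outside, the symbol is bounded and the power is at most one. -/
lemma symbol_sq_mul_rpow_le {m : ℕ} {φ₂ : ℝ} (hφ₂ : 0 < φ₂) (hm : φ₂ < m) (l : Plane) :
    ‖symbol m l‖ ^ 2 * ‖l‖ ^ (-(2 + 2 * φ₂)) ≤ 16 ^ m := by
  have hm1 : (1 : ℝ) ≤ m := by
    have : 0 < m := by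
      have : (0 : ℝ) < m := hφ₂.trans hm
      exact_mod_cast this
    exact_mod_cast this
  have h16 : (1 : ℝ) ≤ 16 ^ m := one_le_pow₀ (by norm_num)
  rcases eq_or_ne l 0 with rfl | hl
  · rw [norm_zero, Real.zero_rpow (by linarith), mul_zero]; positivity
  have hl' : 0 < ‖l‖ := norm_pos_iff.2 hl
  rcases le_total 1 ‖l‖ with h | h
  · have h1 : ‖symbol m l‖ ^ 2 ≤ 16 ^ m := by
      calc ‖symbol m l‖ ^ 2 ≤ (4 ^ m) ^ 2 := by gcongr; exact norm_symbol_le m l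
        _ = 16 ^ m := by rw [← pow_mul, mul_comm, pow_mul]; norm_num
    have h2 : ‖l‖ ^ (-(2 + 2 * φ₂)) ≤ 1 := Real.rpow_le_one_of_one_le_of_nonpos h (by linarith)
    calc _ ≤ (16 : ℝ) ^ m * 1 := mul_le_mul h1 h2 (by positivity) (by positivity)
      _ = _ := mul_one _
  · calc ‖symbol m l‖ ^ 2 * ‖l‖ ^ (-(2 + 2 * φ₂))
        ≤ (‖l‖ ^ (2 * m)) ^ 2 * ‖l‖ ^ (-(2 + 2 * φ₂)) := by
          gcongr; exact norm_symbol_le_pow m l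
      _ = ‖l‖ ^ ((4 * m : ℝ) + -(2 + 2 * φ₂)) := by
          rw [Real.rpow_add hl', ← pow_mul, ← Real.rpow_natCast]
          congr 2; push_cast; ring
      _ ≤ 1 := Real.rpow_le_one hl'.le h (by linarith)
      _ ≤ _ := h16

/-- In a coordinate that realizes the sup norm of `k`, `|l r + 2πk r| ≥ 2π|k r| - π ≥ π|k r|`, since
a nonzero integer has modulus at least one. -/
lemma norm_add_dualPoint_ge {l : Plane} (hl : l ∈ torus) (k : Fin 2 → ℤ) :
    Real.pi * ‖k‖ ≤ ‖l + dualPoint k‖ ∨ k = 0 := by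
  by_cases hk : k = 0
  · exact Or.inr hk
  left
  have hpi := Real.pi_pos
  obtain ⟨r, hr⟩ : ∃ r, ‖k‖ = ‖k r‖ := by
    have : ‖k‖ = max ‖k 0‖ ‖k 1‖ := by
      refine le_antisymm ?_ (max_le (norm_le_pi_norm k 0) (norm_le_pi_norm k 1))
      rw [pi_norm_le_iff_of_nonneg (le_max_of_le_left (norm_nonneg _))]
      intro i; fin_cases i
      · exact le_max_left _ _
      · exact le_max_right _ _
    rcases max_choice ‖k 0‖ ‖k 1‖ with h | h
    · exact ⟨0, this.trans h⟩
    · exact ⟨1, this.trans h⟩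
  have hkr : (1 : ℝ) ≤ |(k r : ℝ)| := by
    have h0 : k r ≠ 0 := by
      intro h0
      rw [h0, norm_zero, norm_eq_zero] at hr
      exact hk hr
    exact_mod_cast Int.one_le_abs h0
  have hlr : |l r| ≤ Real.pi := abs_le.2 ⟨(hl r).1.le, (hl r).2⟩
  rw [hr, Int.norm_eq_abs]
  refine le_trans ?_ (abs_apply_le_norm _ r)
  rw [PiLp.add_apply, dualPoint_apply]
  have h1 : |2 * Real.pi * (k r : ℝ)| ≤ |l r + 2 * Real.pi * k r| + |l r| := by
    have := abs_sub (l r + 2 * Real.pi * k r) (l r)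
    simpa using this
  rw [abs_mul, abs_of_pos (by positivity : (0 : ℝ) < 2 * Real.pi)] at h1
  nlinarith

/-- Only the term `k = 0` of the periodization is singular on the torus, and the symbol absorbs its
singularity. The other terms are dominated by a convergent lattice sum, the exponent `2 + 2φ₂`
exceeding the dimension. -/
lemma exists_filteredDensity_le {m : ℕ} {φ₁ φ₂ : ℝ} (hφ₁ : 0 ≤ φ₁) (hφ₂ : 0 < φ₂) (hm : φ₂ < m) :
    ∃ C : ℝ, 0 ≤ C ∧ ∀ l ∈ torus, filteredDensity m φ₁ φ₂ l ≤ C := by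
  set c : ℝ := 2 ^ (2 * φ₂ + 2) * Real.pi * Real.Gamma (1 + φ₂) * φ₁ with hc
  have hc0 : 0 ≤ c := by
    have : 0 < Real.Gamma (1 + φ₂) := Real.Gamma_pos_of_pos (by linarith)
    have := Real.pi_pos
    positivity
  have hsum : Summable fun k : Fin 2 → ℤ => ‖k‖ ^ (-(2 + 2 * φ₂)) :=
    EisensteinSeries.summable_one_div_norm_rpow (by linarith)
  have hpi := Real.pi_pos
  set S := ∑' k : Fin 2 → ℤ, c * (Real.pi ^ (-(2 + 2 * φ₂)) * ‖k‖ ^ (-(2 + 2 * φ₂))) with hS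
  have hS0 : 0 ≤ S := tsum_nonneg fun k => by positivity
  refine ⟨16 ^ m * c + 16 ^ m * S, by positivity, fun l hl => ?_⟩
  have hle : ∀ k : Fin 2 → ℤ, spectralDensity φ₁ φ₂ (l + dualPoint k)
      ≤ Pi.single (M := fun _ => ℝ) 0 (spectralDensity φ₁ φ₂ l) k
        + c * (Real.pi ^ (-(2 + 2 * φ₂)) * ‖k‖ ^ (-(2 + 2 * φ₂))) := by
    intro k
    rcases norm_add_dualPoint_ge hl k with h | rfl
    · by_cases hk : k = 0
      · subst hk
        have : dualPoint 0 = 0 := by simp only [dualPoint]; ext r; simp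
        rw [this, add_zero, Pi.single_eq_same]
        have : 0 ≤ c * (Real.pi ^ (-(2 + 2 * φ₂)) * ‖(0 : Fin 2 → ℤ)‖ ^ (-(2 + 2 * φ₂))) := by
          positivity
        linarith
      · rw [Pi.single_eq_of_ne hk, zero_add, spectralDensity, ← hc,
          ← Real.mul_rpow hpi.le (norm_nonneg _)]
        refine mul_le_mul_of_nonneg_left ?_ hc0
        have : 0 < ‖k‖ := norm_pos_iff.2 hk
        exact Real.rpow_le_rpow_of_nonpos (by positivity) h (by linarith)
    · have : dualPoint 0 = 0 := by simp only [dualPoint]; ext r; simp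
      rw [this, add_zero, Pi.single_eq_same]
      have : 0 ≤ c * (Real.pi ^ (-(2 + 2 * φ₂)) * ‖(0 : Fin 2 → ℤ)‖ ^ (-(2 + 2 * φ₂))) := by
        positivity
      linarith
  have hs1 : Summable (Pi.single (M := fun _ => ℝ) (0 : Fin 2 → ℤ) (spectralDensity φ₁ φ₂ l)) :=
    (hasSum_pi_single _ _).summable
  have hs2 : Summable fun k : Fin 2 → ℤ => c * (Real.pi ^ (-(2 + 2 * φ₂)) * ‖k‖ ^ (-(2 + 2 * φ₂))) :=
    (hsum.mul_left _).mul_left _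
  have hal : aliasedDensity φ₁ φ₂ l ≤ spectralDensity φ₁ φ₂ l + S := by
    have h1 : Summable fun k => spectralDensity φ₁ φ₂ (l + dualPoint k) :=
      Summable.of_nonneg_of_le (fun k => spectralDensity_nonneg hφ₁ hφ₂ _) hle (hs1.add hs2)
    have h2 := h1.tsum_le_tsum hle (hs1.add hs2)
    rw [hs1.tsum_add hs2, (hasSum_pi_single _ _).tsum_eq] at h2
    exact h2
  have hsy : ‖symbol m l‖ ^ 2 ≤ 16 ^ m := by
    calc ‖symbol m l‖ ^ 2 ≤ (4 ^ m) ^ 2 := by gcongr; exact norm_symbol_le m l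
      _ = 16 ^ m := by rw [← pow_mul, mul_comm, pow_mul]; norm_num
  calc filteredDensity m φ₁ φ₂ l ≤ ‖symbol m l‖ ^ 2 * (spectralDensity φ₁ φ₂ l + S) :=
        mul_le_mul_of_nonneg_left hal (by positivity)
    _ = (‖symbol m l‖ ^ 2 * ‖l‖ ^ (-(2 + 2 * φ₂))) * c + ‖symbol m l‖ ^ 2 * S := by
        rw [spectralDensity, ← hc]; ring
    _ ≤ _ := by
        gcongr
        exact symbol_sq_mul_rpow_le hφ₂ hm l

/-! ### Fourier series on the torus -/

section TorusFourier

open scoped Pointwise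

noncomputable local instance : MeasureSpace UnitAddCircle := ⟨AddCircle.haarAddCircle⟩

local instance : IsProbabilityMeasure (volume : Measure UnitAddCircle) :=
  inferInstanceAs (IsProbabilityMeasure AddCircle.haarAddCircle)

/-- The representative in the torus `(-π, π]²` of a point of `(ℝ/ℤ)²`. -/
noncomputable def torusRep (x : UnitAddTorus (Fin 2)) : Plane :=
  (2 * Real.pi) • WithLp.toLp 2 (fun r => ((AddCircle.equivIoc 1 (-1 / 2) (x r) : ℝ)))

lemma measurable_torusRep : Measurable torusRep := by
  unfold torusRep
  have : Measurable fun x : UnitAddTorus (Fin 2) =>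
      (fun r => ((AddCircle.equivIoc 1 (-1 / 2) (x r) : ℝ))) := by
    refine measurable_pi_lambda _ fun r => ?_
    exact measurable_subtype_coe.comp
      ((AddCircle.measurableEquivIoc 1 (-1 / 2)).measurable.comp (measurable_pi_apply r))
  exact (by fun_prop : Measurable fun y : Fin 2 → ℝ =>
    (2 * Real.pi) • (WithLp.toLp 2 y : Plane)).comp this

lemma torusRep_mem (x : UnitAddTorus (Fin 2)) : torusRep x ∈ torus := by
  intro r
  have h := (AddCircle.equivIoc 1 (-1 / 2) (x r)).2
  have hpi := Real.pi_pos
  change 2 * Real.pi * (AddCircle.equivIoc 1 (-1 / 2) (x r) : ℝ) ∈ _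
  constructor
  · nlinarith [h.1]
  · nlinarith [h.2]

lemma mFourier_eq_exp (n : Fin 2 → ℤ) (x : UnitAddTorus (Fin 2)) :
    UnitAddTorus.mFourier n x
      = Complex.exp ((∑ r, (n r : ℝ) * torusRep x r : ℝ) * Complex.I) := by
  have h : ∀ r, fourier (n r) (x r)
      = Complex.exp (((n r : ℝ) * torusRep x r : ℝ) * Complex.I) := by
    intro r
    have h1 : x r = ((AddCircle.equivIoc 1 (-1 / 2) (x r) : ℝ) : UnitAddCircle) :=
      ((AddCircle.equivIoc 1 (-1 / 2)).symm_apply_apply (x r)).symm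
    conv_lhs => rw [h1]
    rw [fourier_coe_apply]
    congr 1
    simp only [torusRep, PiLp.smul_apply, smul_eq_mul]
    push_cast
    ring
  change ∏ r, fourier (n r) (x r) = _
  simp_rw [h]
  rw [← Complex.exp_sum]
  push_cast
  rw [Finset.sum_mul]

/-- Change of variables `λ = 2πx` from the cube `(-1/2, 1/2]²`. It accounts for the normalization
`(2π)⁻²`. -/
lemma integral_comp_torusRep {E : Type*} [NormedAddCommGroup E] [NormedSpace ℝ E]
    (Φ : Plane → E) :
    ∫ x : UnitAddTorus (Fin 2), Φ (torusRep x) = ((2 * Real.pi) ^ 2)⁻¹ • ∫ l in torus, Φ l := by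
  have hpi := Real.pi_pos
  rw [UnitAddTorus.integral_preimage (fun x => Φ (torusRep x)) (fun _ => -1 / 2)]
  have hmeas : MeasurableSet {x : Fin 2 → ℝ | ∀ i, x i ∈ Set.Ioc (-1 / 2 : ℝ) (-1 / 2 + 1)} :=
    MeasurableSet.univ_pi' fun i => measurableSet_Ioc
  have e1 : ∀ x ∈ {x : Fin 2 → ℝ | ∀ i, x i ∈ Set.Ioc (-1 / 2 : ℝ) (-1 / 2 + 1)},
      Φ (torusRep fun i => (x i : UnitAddCircle)) = Φ ((2 * Real.pi) • WithLp.toLp 2 x) := by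
    intro x hx
    have : (fun r => ((AddCircle.equivIoc 1 (-1 / 2) (x r : UnitAddCircle) : ℝ))) = x := by
      ext r
      rw [AddCircle.equivIoc_coe_of_mem (hx r)]
    rw [torusRep, this]
  rw [setIntegral_congr_fun hmeas e1]
  have h2 := (PiLp.volume_preserving_toLp (Fin 2)).setIntegral_preimage_emb
    (MeasurableEquiv.toLp 2 _).measurableEmbedding (fun l : Plane => Φ ((2 * Real.pi) • l))
    {l : Plane | ∀ i, l i ∈ Set.Ioc (-1 / 2 : ℝ) (-1 / 2 + 1)}
  have h3 : (WithLp.toLp 2 ⁻¹' {l : Plane | ∀ i, l i ∈ Set.Ioc (-1 / 2 : ℝ) (-1 / 2 + 1)})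
      = {x : Fin 2 → ℝ | ∀ i, x i ∈ Set.Ioc (-1 / 2 : ℝ) (-1 / 2 + 1)} := rfl
  rw [h3] at h2
  rw [h2, Measure.setIntegral_comp_smul_of_pos _ _ _ (by positivity : (0 : ℝ) < 2 * Real.pi)]
  have h4 : (2 * Real.pi) • {l : Plane | ∀ i, l i ∈ Set.Ioc (-1 / 2 : ℝ) (-1 / 2 + 1)} = torus := by
    ext l
    rw [Set.mem_smul_set_iff_inv_smul_mem₀ (by positivity)]
    simp only [torus, Set.mem_ofPred_eq, PiLp.smul_apply, smul_eq_mul, Set.mem_Ioc]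
    refine forall_congr' fun i => ?_
    have e : (2 * Real.pi)⁻¹ * l i = l i / (2 * Real.pi) := by ring
    rw [e, lt_div_iff₀ (by positivity), div_le_iff₀ (by positivity)]
    constructor <;> rintro ⟨h1, h2⟩ <;> constructor <;> linarith
  rw [h4]
  simp

/-- **Parseval's identity** on the torus `(-π, π]²`. -/
theorem hasSum_sq_torus_fourier {Φ : Plane → ℂ} (hΦ : Measurable Φ) {C : ℝ}
    (hC : ∀ l ∈ torus, ‖Φ l‖ ≤ C) :
    HasSum (fun n : Fin 2 → ℤ => ‖∫ l in torus,
        Complex.exp ((∑ r, (n r : ℝ) * l r : ℝ) * Complex.I) * Φ l * (((2 * Real.pi) ^ 2)⁻¹ : ℝ)‖ ^ 2)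
      (∫ l in torus, ‖Φ l‖ ^ 2 * ((2 * Real.pi) ^ 2)⁻¹) := by
  set f : UnitAddTorus (Fin 2) → ℂ := fun x => Φ (torusRep x) with hf
  have hm : MemLp f 2 volume :=
    MemLp.of_bound (hΦ.comp measurable_torusRep).aestronglyMeasurable C
      (ae_of_all _ fun x => hC _ (torusRep_mem x))
  have h1 := UnitAddTorus.hasSum_sq_mFourierCoeff (hm.toLp f)
  have h2 : ∫ t, ‖hm.toLp f t‖ ^ 2 = ∫ l in torus, ‖Φ l‖ ^ 2 * ((2 * Real.pi) ^ 2)⁻¹ := by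
    have : ∫ t, ‖hm.toLp f t‖ ^ 2 = ∫ t, ‖f t‖ ^ 2 :=
      integral_congr_ae (by filter_upwards [hm.coeFn_toLp] with t ht; rw [ht])
    rw [this]
    simp only [hf]
    rw [integral_comp_torusRep (fun l => ‖Φ l‖ ^ 2), integral_mul_const, smul_eq_mul, mul_comm]
  rw [h2] at h1
  -- Fourier coefficients are defined with the conjugate exponential; the lags are reflected to
  -- obtain `e^(i⟨n, λ⟩)`.
  rw [← (Equiv.neg (Fin 2 → ℤ)).hasSum_iff] at h1
  convert h1 using 2 with n
  congr 1
  have h3 : UnitAddTorus.mFourierCoeff (hm.toLp f : UnitAddTorus (Fin 2) → ℂ) (-n)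
      = UnitAddTorus.mFourierCoeff f (-n) :=
    integral_congr_ae (by filter_upwards [hm.coeFn_toLp] with t ht; rw [ht])
  have h4 : UnitAddTorus.mFourierCoeff f (-n)
      = ∫ x : UnitAddTorus (Fin 2), (fun l : Plane =>
        Complex.exp ((∑ r, (n r : ℝ) * l r : ℝ) * Complex.I) * Φ l) (torusRep x) := by
    rw [UnitAddTorus.mFourierCoeff]
    refine integral_congr_ae (ae_of_all _ fun x => ?_)
    simp only [neg_neg, mFourier_eq_exp, smul_eq_mul, hf]
  have h5 := integral_comp_torusRep (fun l : Plane =>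
        Complex.exp ((∑ r, (n r : ℝ) * l r : ℝ) * Complex.I) * Φ l)
  rw [Equiv.neg_apply, h3, h4.trans h5, integral_mul_const,
    norm_smul, norm_mul, Complex.norm_real, mul_comm]

/-- Orthonormality of the exponentials on the torus `(-π, π]²`. -/
theorem integral_torus_norm_sq_sum {ι : Type*} [Fintype ι] (v : ι → ℝ) {t : ι → Site}
    (ht : Function.Injective t) :
    ∫ l in torus, ‖∑ i, (v i : ℂ) * Complex.exp (inner ℝ (toPlane (t i)) l * Complex.I)‖ ^ 2
      * ((2 * Real.pi) ^ 2)⁻¹ = ∑ i, v i ^ 2 := by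
  classical
  set n : ι → (Fin 2 → ℤ) := fun i r => (t i r : ℤ) with hn
  have hninj : Function.Injective n := by
    intro i j hij
    apply ht
    ext r
    simpa [hn] using congr_fun hij r
  set g : C(UnitAddTorus (Fin 2), ℂ) := ∑ i, (v i : ℂ) • UnitAddTorus.mFourier (n i) with hg
  have hgx : ∀ x, g x = (fun l : Plane =>
      ∑ i, (v i : ℂ) * Complex.exp (inner ℝ (toPlane (t i)) l * Complex.I)) (torusRep x) := by
    intro x
    simp only [hg, ContinuousMap.coe_sum, Finset.sum_apply, ContinuousMap.coe_smul, Pi.smul_apply,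
      mFourier_eq_exp, smul_eq_mul, inner_toPlane, hn]
    refine Finset.sum_congr rfl fun i _ => ?_
    simp
  have h1 : ∫ x, ‖g x‖ ^ 2 = ∑ i, v i ^ 2 := by
    have hon : Orthonormal ℂ fun i => UnitAddTorus.mFourierLp (d := Fin 2) 2 (n i) :=
      UnitAddTorus.orthonormal_mFourier.comp n hninj
    have h2 := hon.inner_sum (fun i => (v i : ℂ)) (fun i => (v i : ℂ)) Finset.univ
    have h3 : ∑ i, (v i : ℂ) • UnitAddTorus.mFourierLp (d := Fin 2) 2 (n i)
        = ContinuousMap.toLp (E := ℂ) 2 volume ℂ g := by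
      rw [hg, map_sum]
      simp_rw [map_smul]
    rw [h3, ContinuousMap.inner_toLp] at h2
    have h4 : ∀ x, g x * (starRingEnd ℂ) (g x) = ((‖g x‖ ^ 2 : ℝ) : ℂ) := fun x => by
      rw [Complex.mul_conj, Complex.normSq_eq_norm_sq]
    simp_rw [h4] at h2
    rw [integral_complex_ofReal] at h2
    have h5 : ∑ i, (starRingEnd ℂ) (v i : ℂ) * (v i : ℂ) = ((∑ i, v i ^ 2 : ℝ) : ℂ) := by
      push_cast
      exact Finset.sum_congr rfl fun i _ => by rw [Complex.conj_ofReal, pow_two]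
    rw [h5] at h2
    exact_mod_cast h2
  simp_rw [hgx] at h1
  rw [integral_comp_torusRep (fun l : Plane => ‖∑ i, (v i : ℂ) *
    Complex.exp (inner ℝ (toPlane (t i)) l * Complex.I)‖ ^ 2)] at h1
  rw [integral_mul_const, mul_comm, ← h1, smul_eq_mul]

end TorusFourier

/-! ### Covariances of the differences -/

lemma torus_subset_closedBall : torus ⊆ Metric.closedBall (0 : Plane) (2 * Real.pi) := by
  intro l hl
  have h : ∀ r, |l r| ≤ Real.pi := fun r => abs_le.2 ⟨(hl r).1.le, (hl r).2⟩
  rw [mem_closedBall_zero_iff, EuclideanSpace.norm_eq, Fin.sum_univ_two]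
  refine Real.sqrt_le_iff.2 ⟨by positivity, ?_⟩
  simp only [Real.norm_eq_abs]
  have hpi := Real.pi_pos
  nlinarith [h 0, h 1, abs_nonneg (l 0), abs_nonneg (l 1)]

lemma integrable_torus_of_continuous {E : Type*} [NormedAddCommGroup E]
    {T : Plane → E} (hT : Continuous T) : IntegrableOn T torus :=
  (hT.continuousOn.integrableOn_compact (isCompact_closedBall (0 : Plane) (2 * Real.pi))).mono_set
    torus_subset_closedBall

section Cov

variable {m : ℕ} {φ₁ φ₂ : ℝ}

lemma integrable_mul_filteredDensity (hφ₁ : 0 ≤ φ₁) (hφ₂ : 0 < φ₂) (hm : φ₂ < m)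
    {T : Plane → ℝ} (hT : Continuous T) :
    IntegrableOn (fun l => T l * filteredDensity m φ₁ φ₂ l * ((2 * Real.pi) ^ 2)⁻¹) torus := by
  obtain ⟨C, hC0, hC⟩ := exists_filteredDensity_le hφ₁ hφ₂ hm
  refine Integrable.mul_const ?_ _
  refine Integrable.mul_bdd (c := C) (integrable_torus_of_continuous hT)
    (measurable_filteredDensity hφ₁ hφ₂).aestronglyMeasurable ?_
  filter_upwards [ae_restrict_mem measurableSet_torus] with l hl
  rw [Real.norm_of_nonneg (filteredDensity_nonneg hφ₁ hφ₂ l)]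
  exact hC l hl

/-- The character `λ ↦ exp(i⟨h, λ⟩)` times the cross-product of the transfer functions. -/
noncomputable def crossSymbol (m : ℕ) (i i' : Fin 2) (h : Fin 2 → ℤ) (l : Plane) : ℂ :=
  Complex.exp ((∑ r, (h r : ℝ) * l r : ℝ) * Complex.I) *
    (transfer m i l * (starRingEnd ℂ) (transfer m i' l))

/-- The cross-covariances of the differences of steps `i + 1` and `i' + 1`. -/
noncomputable def covFun (m : ℕ) (φ₁ φ₂ : ℝ) (i i' : Fin 2) (h : Fin 2 → ℤ) : ℝ :=
  ∫ l in torus, (crossSymbol m i i' h l).re * filteredDensity m φ₁ φ₂ l * ((2 * Real.pi) ^ 2)⁻¹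

@[fun_prop]
lemma continuous_crossSymbol (m : ℕ) (i i' : Fin 2) (h : Fin 2 → ℤ) :
    Continuous (crossSymbol m i i' h) := by
  unfold crossSymbol
  have : Continuous fun l => (starRingEnd ℂ) (transfer m i' l) :=
    Complex.continuous_conj.comp (continuous_transfer m i')
  fun_prop

lemma exp_add_dualPoint (l : Plane) (k h : Fin 2 → ℤ) :
    Complex.exp ((∑ r, (h r : ℝ) * (l + dualPoint k) r : ℝ) * Complex.I)
      = Complex.exp ((∑ r, (h r : ℝ) * l r : ℝ) * Complex.I) := by
  have : (((∑ r, (h r : ℝ) * (l + dualPoint k) r : ℝ)) : ℂ) * Complex.I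
      = ((∑ r, (h r : ℝ) * l r : ℝ) : ℂ) * Complex.I
        + ((∑ r, h r * k r : ℤ) : ℂ) * (2 * Real.pi * Complex.I) := by
    simp only [PiLp.add_apply, dualPoint_apply, Fin.sum_univ_two]
    push_cast
    ring
  rw [this]
  exact Complex.exp_periodic.int_mul _ _

lemma transfer_add_dualPoint (m : ℕ) (i : Fin 2) (l : Plane) (k : Fin 2 → ℤ) :
    transfer m i (l + dualPoint k) = transfer m i l := by
  have : ∀ r, Complex.exp (Complex.I * ((l + dualPoint k) r : ℝ))
      = Complex.exp (Complex.I * (l r : ℝ)) := by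
    intro r
    rw [PiLp.add_apply, dualPoint_apply]
    push_cast
    rw [show Complex.I * ((l r : ℂ) + 2 * Real.pi * (k r : ℂ))
      = Complex.I * l r + (k r : ℂ) * (2 * Real.pi * Complex.I) by ring]
    exact Complex.exp_periodic.int_mul (k r) _
  simp only [transfer, this]

lemma crossSymbol_add_dualPoint (m : ℕ) (i i' : Fin 2) (h : Fin 2 → ℤ) (l : Plane)
    (k : Fin 2 → ℤ) : crossSymbol m i i' h (l + dualPoint k) = crossSymbol m i i' h l := by
  simp only [crossSymbol, exp_add_dualPoint, transfer_add_dualPoint]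

lemma exp_inner_toPlane (t : Site) (l : Plane) :
    Complex.exp (inner ℝ (toPlane t) l * Complex.I)
      = Complex.exp ((∑ r, (((t r : ℤ)) : ℝ) * l r : ℝ) * Complex.I) := by
  rw [inner_toPlane]; simp

lemma featureSum_add_dualPoint {ι : Type*} [Fintype ι] (m : ℕ) (v : ι → ℝ) (c : ι → Fin 2 × Site)
    (l : Plane) (k : Fin 2 → ℤ) : featureSum m v c (l + dualPoint k) = featureSum m v c l := by
  simp only [featureSum, exp_inner_toPlane, transfer_add_dualPoint]
  refine Finset.sum_congr rfl fun i _ => ?_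
  rw [exp_add_dualPoint l k (fun r => ((c i).2 r : ℤ))]

/-- Half-angle formula: `|1 + e^(ix)|² = 4 cos²(x/2)`. -/
lemma norm_transfer_sq (m : ℕ) (i : Fin 2) (l : Plane) :
    ‖transfer m i l‖ ^ 2 = multiplier m i l := by
  have h : ∀ x : ℝ, ‖1 + Complex.exp (Complex.I * x)‖ ^ 2 = (2 * Real.cos (x / 2)) ^ 2 := by
    intro x
    rw [← Complex.normSq_eq_norm_sq, mul_comm, Complex.normSq_apply]
    simp only [Complex.add_re, Complex.one_re, Complex.exp_ofReal_mul_I_re, Complex.add_im,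
      Complex.one_im, Complex.exp_ofReal_mul_I_im, zero_add]
    have h1 : Real.cos x = 2 * Real.cos (x / 2) ^ 2 - 1 := by
      rw [← Real.cos_two_mul]; congr 1; ring
    have h2 := Real.sin_sq_add_cos_sq x
    nlinarith
  fin_cases i
  · simp [transfer, multiplier]
  · simp only [transfer, multiplier, Fin.mk_one, Matrix.cons_val_one, Matrix.cons_val_fin_one]
    rw [norm_prod, ← Finset.prod_pow]
    refine Finset.prod_congr rfl fun r _ => ?_
    rw [norm_pow, ← pow_mul, mul_comm m 2, pow_mul, h, ← pow_mul]

lemma norm_transfer_sq_le (m : ℕ) (i : Fin 2) (l : Plane) : ‖transfer m i l‖ ^ 2 ≤ 16 ^ m := by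
  rw [norm_transfer_sq]
  fin_cases i
  · simp [multiplier, one_le_pow₀]
  · simp only [multiplier, Fin.mk_one, Matrix.cons_val_one, Matrix.cons_val_fin_one,
      Fin.prod_univ_two]
    have h : ∀ x : ℝ, (2 * Real.cos x) ^ (2 * m) ≤ 4 ^ m := by
      intro x
      rw [pow_mul]
      gcongr
      nlinarith [Real.sin_sq_add_cos_sq x, sq_nonneg (Real.sin x)]
    calc _ ≤ (4 : ℝ) ^ m * 4 ^ m :=
          mul_le_mul (h _) (h _) (by rw [pow_mul]; positivity) (by positivity)
      _ = 16 ^ m := by rw [← mul_pow]; norm_num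

/-- The covariance matrix of a family of differences. -/
noncomputable def covMatrix {ι : Type*} (m : ℕ) (φ₁ φ₂ : ℝ) (c : ι → Fin 2 × Site) :
    Matrix ι ι ℝ :=
  Matrix.of fun i i' => covFun m φ₁ φ₂ (c i).1 (c i').1
    (fun r => ((c i).2 r : ℤ) - ((c i').2 r : ℤ))

variable {ι : Type*} [Fintype ι]

lemma norm_featureSum_sq (m : ℕ) (v : ι → ℝ) (c : ι → Fin 2 × Site) (l : Plane) :
    ‖featureSum m v c l‖ ^ 2 = ∑ i, ∑ i', v i * v i' *
      (crossSymbol m (c i).1 (c i').1 (fun r => ((c i).2 r : ℤ) - ((c i').2 r : ℤ)) l).re := by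
  have h1 : ((‖featureSum m v c l‖ ^ 2 : ℝ) : ℂ) = ∑ i, ∑ i', ((v i * v i' : ℝ) : ℂ) *
      crossSymbol m (c i).1 (c i').1 (fun r => ((c i).2 r : ℤ) - ((c i').2 r : ℤ)) l := by
    rw [← Complex.normSq_eq_norm_sq, ← Complex.mul_conj, featureSum, map_sum, Finset.sum_mul_sum]
    refine Finset.sum_congr rfl fun i _ => Finset.sum_congr rfl fun i' _ => ?_
    rw [map_mul, map_mul, Complex.conj_ofReal, ← Complex.exp_conj, map_mul, Complex.conj_ofReal,
      Complex.conj_I, crossSymbol, inner_toPlane, inner_toPlane]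
    have : Complex.exp (((∑ r, ((((c i).2 r : ℤ) - ((c i').2 r : ℤ) : ℤ) : ℝ) * l r : ℝ) : ℂ) *
        Complex.I) = Complex.exp (((∑ r, ((c i).2 r : ℝ) * l r : ℝ) : ℂ) * Complex.I) *
          Complex.exp (((∑ r, ((c i').2 r : ℝ) * l r : ℝ) : ℂ) * -Complex.I) := by
      rw [← Complex.exp_add]
      congr 1
      simp only [Fin.sum_univ_two]
      push_cast
      ring
    rw [this]
    push_cast
    ring
  have h2 := congrArg Complex.re h1
  rw [Complex.ofReal_re] at h2
  rw [h2, Complex.re_sum]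
  refine Finset.sum_congr rfl fun i _ => ?_
  rw [Complex.re_sum]
  exact Finset.sum_congr rfl fun i' _ => by rw [Complex.re_ofReal_mul]

lemma quadForm_covMatrix (hφ₁ : 0 ≤ φ₁) (hφ₂ : 0 < φ₂) (hm : φ₂ < m) (v : ι → ℝ)
    (c : ι → Fin 2 × Site) :
    v ⬝ᵥ (covMatrix m φ₁ φ₂ c).mulVec v
      = ∫ l in torus, ‖featureSum m v c l‖ ^ 2 * filteredDensity m φ₁ φ₂ l
        * ((2 * Real.pi) ^ 2)⁻¹ := by
  simp_rw [norm_featureSum_sq, Finset.sum_mul]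
  have hI : ∀ i i', IntegrableOn (fun l => v i * v i' *
      (crossSymbol m (c i).1 (c i').1 (fun r => ((c i).2 r : ℤ) - ((c i').2 r : ℤ)) l).re *
      filteredDensity m φ₁ φ₂ l * ((2 * Real.pi) ^ 2)⁻¹) torus := fun i i' =>
    integrable_mul_filteredDensity hφ₁ hφ₂ hm
      (continuous_const.mul (Complex.continuous_re.comp (continuous_crossSymbol m _ _ _)))
  rw [integral_finsetSum _ fun i _ => integrable_finsetSum _ fun i' _ => hI i i']
  simp only [dotProduct, Matrix.mulVec, Finset.mul_sum]
  refine Finset.sum_congr rfl fun i _ => ?_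
  rw [integral_finsetSum _ fun i' _ => hI i i']
  refine Finset.sum_congr rfl fun i' _ => ?_
  rw [covMatrix, Matrix.of_apply, covFun]
  rw [mul_comm _ (v i'), ← mul_assoc, ← integral_const_mul]
  refine integral_congr_ae (ae_of_all _ fun l => ?_)
  ring

/-- The squared feature sum is `2π`-periodic, so the plane folds onto the torus and the density
becomes `F`. This identifies `covMatrix` with the covariances prescribed by the field. -/
lemma quadForm_covMatrix_eq_integral (hφ₁ : 0 ≤ φ₁) (hφ₂ : 0 < φ₂) (hm : ⌊φ₂⌋₊ + 1 ≤ m)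
    (v : ι → ℝ) (c : ι → Fin 2 × Site) :
    v ⬝ᵥ (covMatrix m φ₁ φ₂ c).mulVec v
      = ∫ l, ‖featureSum m v c l‖ ^ 2 * planeDensity m φ₁ φ₂ l := by
  rw [quadForm_covMatrix hφ₁ hφ₂ ((Nat.floor_lt hφ₂.le).1 (by omega)),
    integral_planeDensity_eq_torus (fun l k => by rw [featureSum_add_dualPoint])
      (planeDensity_inc_spectral hφ₂ hm v c).1]

lemma conj_crossSymbol (m : ℕ) (i i' : Fin 2) (h : Fin 2 → ℤ) (l : Plane) :
    (starRingEnd ℂ) (crossSymbol m i i' h l) = crossSymbol m i' i (-h) l := by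
  simp only [crossSymbol, map_mul, Complex.conj_conj, ← Complex.exp_conj, Complex.conj_ofReal,
    Complex.conj_I, Pi.neg_apply]
  rw [mul_comm (transfer m i' l)]
  congr 2
  push_cast
  simp [Fin.sum_univ_two]
  ring

lemma covFun_symm (m : ℕ) (φ₁ φ₂ : ℝ) (i i' : Fin 2) (h : Fin 2 → ℤ) :
    covFun m φ₁ φ₂ i' i (-h) = covFun m φ₁ φ₂ i i' h := by
  simp only [covFun, ← conj_crossSymbol, Complex.conj_re]

lemma covMatrix_isSymm {κ : Type*} (m : ℕ) (φ₁ φ₂ : ℝ) (c : κ → Fin 2 × Site)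
    (i i' : κ) : covMatrix m φ₁ φ₂ c i' i = covMatrix m φ₁ φ₂ c i i' := by
  simp only [covMatrix, Matrix.of_apply]
  rw [← covFun_symm]
  congr 1
  ext r
  simp

lemma covMatrix_posSemidef (hφ₁ : 0 ≤ φ₁) (hφ₂ : 0 < φ₂) (hm : φ₂ < m) (c : ι → Fin 2 × Site) :
    (covMatrix m φ₁ φ₂ c).PosSemidef := by
  refine Matrix.PosSemidef.of_dotProduct_mulVec_nonneg ?_ fun v => ?_
  · ext i i'
    rw [Matrix.conjTranspose_apply, star_trivial, covMatrix_isSymm]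
  · rw [star_trivial, quadForm_covMatrix hφ₁ hφ₂ hm]
    refine integral_nonneg fun l => ?_
    have := filteredDensity_nonneg (m := m) hφ₁ hφ₂ l
    positivity

lemma covMatrix_self {κ : Type*} (hφ₁ : 0 ≤ φ₁) (hφ₂ : 0 < φ₂) (hm : ⌊φ₂⌋₊ + 1 ≤ m)
    (c : κ → Fin 2 × Site) (i : κ) : covMatrix m φ₁ φ₂ c i i = meanPair m φ₁ φ₂ (c i).1 := by
  have h := quadForm_covMatrix_eq_integral hφ₁ hφ₂ hm (fun _ : Unit => 1) (fun _ => c i)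
  have h' := integral_featureSum_single (φ₁ := φ₁) hφ₂ hm (c i).1 (c i).2
  rw [Prod.mk.eta] at h'
  rw [h'] at h
  rw [← h]
  simp [covMatrix, dotProduct, Matrix.mulVec]

/-- The spectral norm of the covariance matrix of distinct differences is bounded. -/
lemma exists_quadForm_covMatrix_le (hφ₁ : 0 ≤ φ₁) (hφ₂ : 0 < φ₂) (hm : φ₂ < m) :
    ∃ κ : ℝ, 0 ≤ κ ∧ ∀ {ι : Type} [Fintype ι] (c : ι → Fin 2 × Site), Function.Injective c →
      ∀ v : ι → ℝ, v ⬝ᵥ (covMatrix m φ₁ φ₂ c).mulVec v ≤ κ * ∑ i, v i ^ 2 := by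
  classical
  obtain ⟨C, hC0, hC⟩ := exists_filteredDensity_le hφ₁ hφ₂ hm
  -- `C` bounds `F`, `16^m` bounds the squared transfer functions, and `2` comes from `(a + b)² ≤
  -- 2(a² + b²)` for the two steps. Indices are grouped by step because a site may occur once for
  -- each step; within one group the characters are orthonormal.
  refine ⟨2 * 16 ^ m * C, by positivity, fun {ι} _ c hc v => ?_⟩
  rw [quadForm_covMatrix hφ₁ hφ₂ hm]
  set S : Fin 2 → Plane → ℂ := fun j l => ∑ i : {i // (c i).1 = j},
    (v i : ℂ) * Complex.exp (inner ℝ (toPlane (c i).2) l * Complex.I) with hS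
  have hSc : ∀ j, Continuous (S j) := fun j => by simp only [hS]; fun_prop
  have hSint : ∀ j, ∫ l in torus, ‖S j l‖ ^ 2 * ((2 * Real.pi) ^ 2)⁻¹
      = ∑ i : {i // (c i).1 = j}, v i ^ 2 := by
    intro j
    refine integral_torus_norm_sq_sum (fun i : {i // (c i).1 = j} => v i)
      (t := fun i => (c i).2) ?_
    rintro ⟨i, hi⟩ ⟨i', hi'⟩ h
    exact Subtype.ext (hc (Prod.ext (hi.trans hi'.symm) h))
  have hsplit : ∀ l, featureSum m v c l = ∑ j, transfer m j l * S j l := by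
    intro l
    rw [featureSum, ← Fintype.sum_fiberwise (fun i => (c i).1)]
    refine Finset.sum_congr rfl fun j _ => ?_
    simp only [hS, Finset.mul_sum]
    refine Finset.sum_congr rfl fun i _ => ?_
    rw [i.2]; ring
  have hb : ∀ l ∈ torus, ‖featureSum m v c l‖ ^ 2 * filteredDensity m φ₁ φ₂ l
        * ((2 * Real.pi) ^ 2)⁻¹
      ≤ ∑ j, 2 * 16 ^ m * C * (‖S j l‖ ^ 2 * ((2 * Real.pi) ^ 2)⁻¹) := by
    intro l hl
    have h1 : ‖featureSum m v c l‖ ^ 2 ≤ 2 * 16 ^ m * ∑ j, ‖S j l‖ ^ 2 := by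
      rw [hsplit]
      have h2 : ‖∑ j, transfer m j l * S j l‖
          ≤ ‖transfer m 0 l‖ * ‖S 0 l‖ + ‖transfer m 1 l‖ * ‖S 1 l‖ := by
        rw [Fin.sum_univ_two, ← norm_mul, ← norm_mul]
        exact norm_add_le _ _
      have h3 := norm_transfer_sq_le m 0 l
      have h4 := norm_transfer_sq_le m 1 l
      calc _ ≤ (‖transfer m 0 l‖ * ‖S 0 l‖ + ‖transfer m 1 l‖ * ‖S 1 l‖) ^ 2 := by gcongr
        _ ≤ 2 * (‖transfer m 0 l‖ ^ 2 * ‖S 0 l‖ ^ 2 + ‖transfer m 1 l‖ ^ 2 * ‖S 1 l‖ ^ 2) := by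
          nlinarith [sq_nonneg (‖transfer m 0 l‖ * ‖S 0 l‖ - ‖transfer m 1 l‖ * ‖S 1 l‖)]
        _ ≤ 2 * (16 ^ m * ‖S 0 l‖ ^ 2 + 16 ^ m * ‖S 1 l‖ ^ 2) := by gcongr
        _ = _ := by rw [Fin.sum_univ_two]; ring
    have h0 := filteredDensity_nonneg (m := m) hφ₁ hφ₂ l
    calc _ ≤ (2 * 16 ^ m * ∑ j, ‖S j l‖ ^ 2) * C * ((2 * Real.pi) ^ 2)⁻¹ := by
          gcongr
          exact hC l hl
      _ = _ := by rw [Fin.sum_univ_two, Fin.sum_univ_two]; ring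
  have hSI : ∀ j, IntegrableOn (fun l => 2 * 16 ^ m * C * (‖S j l‖ ^ 2 * ((2 * Real.pi) ^ 2)⁻¹))
      torus := fun j => integrable_torus_of_continuous (by have := hSc j; fun_prop)
  calc _ ≤ ∫ l in torus, ∑ j, 2 * 16 ^ m * C * (‖S j l‖ ^ 2 * ((2 * Real.pi) ^ 2)⁻¹) := by
        refine setIntegral_mono_on (integrable_mul_filteredDensity hφ₁ hφ₂ hm (by fun_prop))
          (integrable_finsetSum _ fun j _ => hSI j) measurableSet_torus hb
    _ = ∑ j, 2 * 16 ^ m * C * ∑ i : {i // (c i).1 = j}, v i ^ 2 := by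
        rw [integral_finsetSum _ fun j _ => hSI j]
        refine Finset.sum_congr rfl fun j _ => ?_
        rw [integral_const_mul, hSint]
    _ = _ := by
        rw [← Finset.mul_sum, Fintype.sum_fiberwise (fun i => (c i).1) (fun i => v i ^ 2)]

/-- Linear combinations of differences are Gaussian, with the covariances `covMatrix`. -/
lemma IsPowerLawField.hasLaw_bilinDiff {Ω : Type*} [MeasurableSpace Ω] {P : Measure Ω}
    {X : Plane → Ω → ℝ} (hX : IsPowerLawField φ₁ φ₂ X P) (hφ₁ : 0 ≤ φ₁) (hφ₂ : 0 < φ₂)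
    (hm : ⌊φ₂⌋₊ + 1 ≤ m) (c : ι → Fin 2 × Site) (v : ι → ℝ) :
    HasLaw (fun ω => ∑ i, v i * bilinDiff m (((c i).1 : ℕ) + 1) (idSample X ω) (c i).2)
      (gaussianReal 0 (Real.toNNReal (v ⬝ᵥ (covMatrix m φ₁ φ₂ c).mulVec v))) P := by
  rw [quadForm_covMatrix_eq_integral hφ₁ hφ₂ hm]
  exact hX.hasLaw_inc hφ₂ hm v c

/-! ### Summation of the squared covariances -/

lemma norm_crossSymbol_le (m : ℕ) (i i' : Fin 2) (h : Fin 2 → ℤ) (l : Plane) :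
    ‖crossSymbol m i i' h l‖ ≤ 16 ^ m := by
  rw [crossSymbol, norm_mul, Complex.norm_exp_ofReal_mul_I, one_mul, norm_mul, RCLike.norm_conj]
  nlinarith [norm_transfer_sq_le m i l, norm_transfer_sq_le m i' l,
    sq_nonneg (‖transfer m i l‖ - ‖transfer m i' l‖)]

lemma transfer_neg (m : ℕ) (i : Fin 2) (l : Plane) :
    transfer m i (-l) = (starRingEnd ℂ) (transfer m i l) := by
  fin_cases i
  · simp [transfer]
  · simp [transfer, ← Complex.exp_conj]

lemma crossSymbol_neg (m : ℕ) (i i' : Fin 2) (h : Fin 2 → ℤ) (l : Plane) :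
    crossSymbol m i i' h (-l) = (starRingEnd ℂ) (crossSymbol m i i' h l) := by
  simp only [crossSymbol, transfer_neg, map_mul, Complex.conj_conj, ← Complex.exp_conj,
    Complex.conj_ofReal, Complex.conj_I]
  congr 2
  push_cast
  simp [Fin.sum_univ_two]
  ring

lemma norm_symbol_neg (m : ℕ) (l : Plane) : ‖symbol m (-l)‖ = ‖symbol m l‖ := by
  have : symbol m (-l) = (starRingEnd ℂ) (symbol m l) := by
    simp [symbol, ← Complex.exp_conj]
  rw [this, RCLike.norm_conj]

lemma planeDensity_neg (m : ℕ) (φ₁ φ₂ : ℝ) (l : Plane) :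
    planeDensity m φ₁ φ₂ (-l) = planeDensity m φ₁ φ₂ l := by
  simp only [planeDensity, norm_symbol_neg, spectralDensity, norm_neg]

/-- The feature sum of the unit-step difference at the origin is identically one. -/
lemma integrable_planeDensity (hφ₂ : 0 < φ₂) (hm : ⌊φ₂⌋₊ + 1 ≤ m) :
    Integrable (planeDensity m φ₁ φ₂) := by
  have h := (planeDensity_inc_spectral (φ₁ := φ₁) hφ₂ hm (fun _ : Unit => 1)
    (fun _ => ((0 : Fin 2), (0 : Site)))).1
  refine h.congr (ae_of_all _ fun l => ?_)
  simp [featureSum, transfer, toPlane]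

/-- The imaginary part is odd in `λ` and the density is even. The reflection is carried out on the
plane, since the half-open torus is not symmetric. -/
lemma integral_crossSymbol_im (hφ₂ : 0 < φ₂) (hm : ⌊φ₂⌋₊ + 1 ≤ m) (i i' : Fin 2)
    (h : Fin 2 → ℤ) :
    ∫ l in torus, (crossSymbol m i i' h l).im * filteredDensity m φ₁ φ₂ l
      * ((2 * Real.pi) ^ 2)⁻¹ = 0 := by
  have hint : Integrable fun l => (crossSymbol m i i' h l).im * planeDensity m φ₁ φ₂ l := by
    refine Integrable.bdd_mul (c := 16 ^ m) (integrable_planeDensity hφ₂ hm)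
      (Complex.continuous_im.comp (continuous_crossSymbol m i i' h)).aestronglyMeasurable
      (ae_of_all _ fun l => ?_)
    exact (Complex.abs_im_le_norm _).trans (norm_crossSymbol_le m i i' h l)
  rw [← integral_planeDensity_eq_torus (fun l k => by rw [crossSymbol_add_dualPoint]) hint]
  have h1 := integral_neg_eq_self
    (fun l => (crossSymbol m i i' h l).im * planeDensity m φ₁ φ₂ l) volume
  simp only [crossSymbol_neg, Complex.conj_im, planeDensity_neg, neg_mul, integral_neg] at h1
  linarith

/-- The cross-covariances are the Fourier coefficients of the product of the transfer functions and
`F`. Parseval sums their squares to the integral of `b_i b_i' F²`, which is half of `Σ`. -/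
lemma hasSum_covFun_sq (hφ₁ : 0 ≤ φ₁) (hφ₂ : 0 < φ₂) (hm : ⌊φ₂⌋₊ + 1 ≤ m) (i i' : Fin 2) :
    HasSum (fun h => covFun m φ₁ φ₂ i i' h ^ 2) (asympCov m φ₁ φ₂ i i' / 2) := by
  have hm' : φ₂ < m := (Nat.floor_lt hφ₂.le).1 (by omega)
  obtain ⟨C, hC0, hC⟩ := exists_filteredDensity_le hφ₁ hφ₂ hm'
  set Φ : Plane → ℂ := fun l =>
    transfer m i l * (starRingEnd ℂ) (transfer m i' l) * (filteredDensity m φ₁ φ₂ l : ℂ) with hΦ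
  have hΦm : Measurable Φ := by
    have h1 := (continuous_transfer m i).measurable
    have h2 : Measurable fun l => (starRingEnd ℂ) (transfer m i' l) :=
      (Complex.continuous_conj.comp (continuous_transfer m i')).measurable
    have h3 := measurable_filteredDensity (m := m) hφ₁ hφ₂
    exact (h1.mul h2).mul (Complex.measurable_ofReal.comp h3)
  have hΦn : ∀ l, ‖Φ l‖ = ‖transfer m i l‖ * ‖transfer m i' l‖ * filteredDensity m φ₁ φ₂ l := by
    intro l
    rw [norm_mul, norm_mul, RCLike.norm_conj, Complex.norm_real,
      Real.norm_of_nonneg (filteredDensity_nonneg hφ₁ hφ₂ l)]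
  have hΦb : ∀ l ∈ torus, ‖Φ l‖ ≤ 16 ^ m * C := by
    intro l hl
    rw [hΦn]
    have h0 := filteredDensity_nonneg (m := m) hφ₁ hφ₂ l
    refine mul_le_mul ?_ (hC l hl) h0 (by positivity)
    nlinarith [norm_transfer_sq_le m i l, norm_transfer_sq_le m i' l,
      sq_nonneg (‖transfer m i l‖ - ‖transfer m i' l‖)]
  have key := hasSum_sq_torus_fourier hΦm hΦb
  have e1 : ∫ l in torus, ‖Φ l‖ ^ 2 * ((2 * Real.pi) ^ 2)⁻¹ = asympCov m φ₁ φ₂ i i' / 2 := by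
    rw [asympCov, Matrix.of_apply, mul_div_cancel_left₀ _ two_ne_zero]
    refine integral_congr_ae (ae_of_all _ fun l => ?_)
    simp only [hΦn, mul_pow, norm_transfer_sq]
  rw [e1] at key
  convert key using 2 with h
  have hI : ∀ T : ℂ → ℝ, Continuous T → IntegrableOn (fun l => T (crossSymbol m i i' h l) *
      filteredDensity m φ₁ φ₂ l * ((2 * Real.pi) ^ 2)⁻¹) torus := fun T hT =>
    integrable_mul_filteredDensity hφ₁ hφ₂ hm' (hT.comp (continuous_crossSymbol m i i' h))
  have e2 : ∫ l in torus, Complex.exp ((∑ r, (h r : ℝ) * l r : ℝ) * Complex.I) * Φ l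
      * (((2 * Real.pi) ^ 2)⁻¹ : ℝ) = (covFun m φ₁ φ₂ i i' h : ℂ) := by
    have e3 : ∀ l, Complex.exp ((∑ r, (h r : ℝ) * l r : ℝ) * Complex.I) * Φ l
        * (((2 * Real.pi) ^ 2)⁻¹ : ℝ)
        = (((crossSymbol m i i' h l).re * filteredDensity m φ₁ φ₂ l
            * ((2 * Real.pi) ^ 2)⁻¹ : ℝ) : ℂ)
          + (((crossSymbol m i i' h l).im * filteredDensity m φ₁ φ₂ l
            * ((2 * Real.pi) ^ 2)⁻¹ : ℝ) : ℂ) * Complex.I := by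
      intro l
      have : Complex.exp ((∑ r, (h r : ℝ) * l r : ℝ) * Complex.I) * Φ l
          = crossSymbol m i i' h l * filteredDensity m φ₁ φ₂ l := by
        simp only [hΦ, crossSymbol]; ring
      rw [this]
      conv_lhs => rw [← Complex.re_add_im (crossSymbol m i i' h l)]
      push_cast
      ring
    simp_rw [e3]
    rw [integral_add (hI _ Complex.continuous_re).ofReal
      ((hI _ Complex.continuous_im).ofReal.mul_const _), integral_mul_const,
      integral_complex_ofReal, integral_complex_ofReal, integral_crossSymbol_im hφ₂ hm]
    simp [covFun]
  rw [e2, Complex.norm_real, Real.norm_eq_abs, sq_abs]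

@[fun_prop]
lemma continuous_multiplier (m : ℕ) (i : Fin 2) : Continuous (multiplier m i) := by
  unfold multiplier
  fin_cases i
  · simpa using continuous_const
  · simp only [Fin.mk_one, Matrix.cons_val_one, Matrix.cons_val_fin_one]
    fun_prop

/-- A Gram matrix: it is proportional to the matrix of inner products of the multipliers with
respect to the weight `F²`. -/
lemma asympCov_posSemidef (hφ₁ : 0 ≤ φ₁) (hφ₂ : 0 < φ₂) (hm : φ₂ < m) :
    (asympCov m φ₁ φ₂).PosSemidef := by
  obtain ⟨C, hC0, hC⟩ := exists_filteredDensity_le hφ₁ hφ₂ hm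
  refine Matrix.PosSemidef.of_dotProduct_mulVec_nonneg ?_ fun v => ?_
  · ext i j
    simp only [Matrix.conjTranspose_apply, star_trivial, asympCov, Matrix.of_apply]
    simp_rw [mul_comm (multiplier m j _)]
  · have hI : ∀ i j, IntegrableOn (fun l => multiplier m i l * multiplier m j l *
        filteredDensity m φ₁ φ₂ l ^ 2 * ((2 * Real.pi) ^ 2)⁻¹) torus := by
      intro i j
      refine Integrable.mul_const ?_ _
      refine Integrable.mul_bdd (c := C ^ 2) (integrable_torus_of_continuous (by fun_prop))
        ((measurable_filteredDensity hφ₁ hφ₂).pow_const 2).aestronglyMeasurable ?_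
      filter_upwards [ae_restrict_mem measurableSet_torus] with l hl
      have h0 := filteredDensity_nonneg (m := m) hφ₁ hφ₂ l
      rw [norm_pow, Real.norm_of_nonneg h0]
      gcongr
      exact hC l hl
    have e : star v ⬝ᵥ (asympCov m φ₁ φ₂).mulVec v = 2 * ∫ l in torus,
        (∑ i, v i * multiplier m i l) ^ 2 * filteredDensity m φ₁ φ₂ l ^ 2
          * ((2 * Real.pi) ^ 2)⁻¹ := by
      have e1 : ∀ l, (∑ i, v i * multiplier m i l) ^ 2 * filteredDensity m φ₁ φ₂ l ^ 2
          * ((2 * Real.pi) ^ 2)⁻¹ = ∑ i, ∑ j, v i * v j * (multiplier m i l * multiplier m j l *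
        filteredDensity m φ₁ φ₂ l ^ 2 * ((2 * Real.pi) ^ 2)⁻¹) := by
        intro l
        simp only [Fin.sum_univ_two]; ring
      simp_rw [e1]
      rw [integral_finsetSum _ fun i _ => integrable_finsetSum _ fun j _ => (hI i j).const_mul _]
      simp only [dotProduct, Matrix.mulVec, Finset.mul_sum, star_trivial]
      refine Finset.sum_congr rfl fun i _ => ?_
      rw [integral_finsetSum _ fun j _ => (hI i j).const_mul _, Finset.mul_sum]
      refine Finset.sum_congr rfl fun j _ => ?_
      rw [integral_const_mul, asympCov, Matrix.of_apply]
      ring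
    rw [e]
    have : 0 ≤ ∫ l in torus, (∑ i, v i * multiplier m i l) ^ 2 * filteredDensity m φ₁ φ₂ l ^ 2
          * ((2 * Real.pi) ^ 2)⁻¹ := integral_nonneg fun l => by positivity
    linarith

end Cov

/-! ### Averages of stationary arrays -/

lemma mem_grid {n : ℕ} {t : Site} : t ∈ grid n ↔ ∀ i, t i < n := by
  simp [grid]

lemma card_grid (n : ℕ) : (grid n).card = n ^ 2 := by
  simp [grid]

lemma tendsto_natSub_div (a : ℕ) :
    Tendsto (fun n : ℕ => ((n - a : ℕ) : ℝ) / n) atTop (𝓝 1) := by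
  have h : Tendsto (fun n : ℕ => 1 - (a : ℝ) / n) atTop (𝓝 (1 - 0)) :=
    (tendsto_const_div_atTop_nhds_zero_nat (a : ℝ)).const_sub 1
  rw [sub_zero] at h
  refine h.congr' ?_
  filter_upwards [eventually_ge_atTop (a + 1)] with n hn
  have : (n : ℝ) ≠ 0 := by
    have : n ≠ 0 := by omega
    exact_mod_cast this
  rw [Nat.cast_sub (by omega)]
  field_simp

/-- The difference of two sites. -/
def siteSub (t t' : Site) : Fin 2 → ℤ := fun r => (t r : ℤ) - (t' r : ℤ)

/-- Each second site has at most one partner at lag `h`. -/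
lemma card_pairs_le (n a b : ℕ) (h : Fin 2 → ℤ) :
    ∑ t ∈ grid (n - a), ∑ t' ∈ grid (n - b), (if siteSub t t' = h then (1 : ℝ) else 0)
      ≤ (n : ℝ) ^ 2 := by
  rw [Finset.sum_comm]
  have h1 : ∀ t' ∈ grid (n - b),
      ∑ t ∈ grid (n - a), (if siteSub t t' = h then (1 : ℝ) else 0) ≤ 1 := by
    intro t' _
    rw [Finset.sum_boole]
    have : (Finset.filter (fun t => siteSub t t' = h) (grid (n - a))).card ≤ 1 := by
      refine Finset.card_le_one.2 fun t ht s hs => ?_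
      have h2 := (Finset.mem_filter.1 ht).2.trans (Finset.mem_filter.1 hs).2.symm
      ext r
      have := congr_fun h2 r
      simp only [siteSub] at this
      omega
    exact_mod_cast this
  refine (Finset.sum_le_sum h1).trans ?_
  rw [Finset.sum_const, card_grid, nsmul_eq_mul, mul_one]
  have : (n - b) ^ 2 ≤ n ^ 2 := Nat.pow_le_pow_left (by omega) 2
  exact_mod_cast this

/-- Sites at distance at least `H` from the boundary of a smaller box have their partner at lag `h`
in the grid, hence the translation by `H`. For small `n` the truncated subtraction makes the bound
zero. -/
lemma le_card_pairs (n a b : ℕ) (h : Fin 2 → ℤ) :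
    ((n - (a + b + 2 * ∑ r, (h r).natAbs) : ℕ) : ℝ) ^ 2
      ≤ ∑ t ∈ grid (n - a), ∑ t' ∈ grid (n - b), (if siteSub t t' = h then (1 : ℝ) else 0) := by
  set H := ∑ r, (h r).natAbs with hH
  have hr : ∀ r, (h r).natAbs ≤ H := fun r =>
    Finset.single_le_sum (f := fun r => (h r).natAbs) (fun _ _ => Nat.zero_le _) (Finset.mem_univ r)
  rw [Finset.sum_comm]
  set e : Site → Site := fun s r => s r + H with he
  have heinj : Function.Injective e := by
    intro s s' hss
    ext r
    have := congr_fun hss r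
    simpa [he] using this
  have h1 : ∀ t' ∈ (grid (n - (a + b + 2 * H))).image e, (1 : ℝ)
      ≤ ∑ t ∈ grid (n - a), (if siteSub t t' = h then (1 : ℝ) else 0) := by
    intro t' ht'
    obtain ⟨s, hs, rfl⟩ := Finset.mem_image.1 ht'
    rw [mem_grid] at hs
    have hmem : (fun r => ((e s r : ℤ) + h r).toNat) ∈ grid (n - a) := by
      rw [mem_grid]
      intro r
      have := hs r; have := hr r
      simp only [he]; omega
    have hone : siteSub (fun r => ((e s r : ℤ) + h r).toNat) (e s) = h := by
      ext r
      have := hr r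
      simp only [siteSub, he]
      omega
    have := Finset.single_le_sum (f := fun t => if siteSub t (e s) = h then (1 : ℝ) else 0)
      (fun t _ => by split_ifs <;> norm_num) hmem
    simpa only [hone, if_true] using this
  have hsub : (grid (n - (a + b + 2 * H))).image e ⊆ grid (n - b) := by
    intro t' ht'
    obtain ⟨s, hs, rfl⟩ := Finset.mem_image.1 ht'
    rw [mem_grid] at hs ⊢
    intro r
    have := hs r
    simp only [he]; omega
  calc ((n - (a + b + 2 * H) : ℕ) : ℝ) ^ 2
      = ∑ t' ∈ (grid (n - (a + b + 2 * H))).image e, (1 : ℝ) := by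
        rw [Finset.sum_const, Finset.card_image_of_injective _ heinj, card_grid]; simp
    _ ≤ _ := Finset.sum_le_sum h1
    _ ≤ _ := Finset.sum_le_sum_of_subset_of_nonneg hsub fun t' _ _ =>
        Finset.sum_nonneg fun t _ => by split_ifs <;> norm_num

/-- Averages over pairs of sites of a summable function of their difference. -/
lemma tendsto_sum_grid_pairs {u : (Fin 2 → ℤ) → ℝ} (hu : Summable u) (a b : ℕ) :
    Tendsto (fun n : ℕ => (∑ t ∈ grid (n - a), ∑ t' ∈ grid (n - b), u (siteSub t t')) / (n : ℝ) ^ 2)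
      atTop (𝓝 (∑' h, u h)) := by
  set K : ℕ → (Fin 2 → ℤ) → ℝ := fun n h =>
    ∑ t ∈ grid (n - a), ∑ t' ∈ grid (n - b), (if siteSub t t' = h then (1 : ℝ) else 0) with hK
  have hK0 : ∀ n h, 0 ≤ K n h := fun n h =>
    Finset.sum_nonneg fun t _ => Finset.sum_nonneg fun t' _ => by split_ifs <;> norm_num
  have e1 : ∀ n : ℕ, (∑ t ∈ grid (n - a), ∑ t' ∈ grid (n - b), u (siteSub t t')) / (n : ℝ) ^ 2
      = ∑' h, u h * (K n h / (n : ℝ) ^ 2) := by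
    intro n
    have h1 : HasSum (fun h => ∑ t ∈ grid (n - a), ∑ t' ∈ grid (n - b),
        (if h = siteSub t t' then u (siteSub t t') else 0))
        (∑ t ∈ grid (n - a), ∑ t' ∈ grid (n - b), u (siteSub t t')) :=
      hasSum_sum fun t _ => hasSum_sum fun t' _ => hasSum_ite_eq _ _
    rw [← (h1.div_const ((n : ℝ) ^ 2)).tsum_eq]
    refine tsum_congr fun h => ?_
    rw [mul_div_assoc', hK, Finset.mul_sum]
    congr 1
    refine Finset.sum_congr rfl fun t _ => ?_
    rw [Finset.mul_sum]
    refine Finset.sum_congr rfl fun t' _ => ?_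
    by_cases h2 : siteSub t t' = h
    · rw [if_pos h2, if_pos h2.symm, h2, mul_one]
    · rw [if_neg h2, if_neg (fun h3 => h2 h3.symm), mul_zero]
  simp_rw [e1]
  -- The proportion of pairs at a fixed lag lies in `[0, 1]` and tends to one, so `|u|` is a
  -- dominating function.
  refine tendsto_tsum_of_dominated_convergence (bound := fun h => |u h|) hu.abs (fun h => ?_)
    (Eventually.of_forall fun n h => ?_)
  · have h1 : Tendsto (fun n : ℕ => K n h / (n : ℝ) ^ 2) atTop (𝓝 1) := by
      have hlo := (tendsto_natSub_div (a + b + 2 * ∑ r, (h r).natAbs)).pow 2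
      rw [one_pow] at hlo
      refine tendsto_of_tendsto_of_tendsto_of_le_of_le' hlo tendsto_const_nhds ?_ ?_
      · filter_upwards with n
        rw [div_pow]
        gcongr
        exact le_card_pairs n a b h
      · filter_upwards [eventually_gt_atTop 0] with n hn
        have : (0 : ℝ) < n := by exact_mod_cast hn
        rw [div_le_one (by positivity)]
        exact card_pairs_le n a b h
    simpa using h1.const_mul (u h)
  · rw [norm_mul, Real.norm_eq_abs]
    have : ‖K n h / (n : ℝ) ^ 2‖ ≤ 1 := by
      rw [Real.norm_of_nonneg (div_nonneg (hK0 n h) (by positivity))]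
      exact div_le_one_of_le₀ (card_pairs_le n a b h) (by positivity)
    nlinarith [abs_nonneg (u h)]

/-! ### The central limit theorem for the full-grid quadratic variations -/

/-- The pair `(Q₁, Q₂)` of full-grid quadratic variations. -/
noncomputable def fullPair (m n : ℕ) (x : Site → ℝ) : Plane :=
  !₂[quadVar m 1 n x, quadVar m 2 n x]

lemma fullPair_apply (m n : ℕ) (x : Site → ℝ) (i : Fin 2) :
    fullPair m n x i = quadVar m ((i : ℕ) + 1) n x := by
  fin_cases i <;> simp [fullPair]

/-- The index set of the differences entering `(Q₁, Q₂)`. -/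
def incIndex (m n : ℕ) : Finset (Fin 2 × Site) :=
  (Finset.univ ×ˢ grid n).filter fun c => c.2 ∈ grid (n - ((c.1 : ℕ) + 1) * m)

lemma sum_incIndex {E : Type*} [AddCommMonoid E] (m n : ℕ) (f : Fin 2 × Site → E) :
    ∑ c ∈ incIndex m n, f c = ∑ i : Fin 2, ∑ t ∈ grid (n - ((i : ℕ) + 1) * m), f (i, t) := by
  refine Finset.sum_finset_product _ _ _ fun c => ?_
  simp only [incIndex, Finset.mem_filter, Finset.mem_product, Finset.mem_univ, true_and,
    and_iff_right_iff_imp, mem_grid]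
  intro h r
  have := h r
  omega

lemma measurable_bilinDiff {Ω : Type*} [MeasurableSpace Ω] {X : Plane → Ω → ℝ}
    (hX : ∀ x, Measurable (X x)) (m j : ℕ) (t : Site) :
    Measurable fun ω => bilinDiff m j (idSample X ω) t := by
  unfold bilinDiff idSample
  fun_prop

lemma measurable_fullPair {Ω : Type*} [MeasurableSpace Ω] {X : Plane → Ω → ℝ}
    (hX : ∀ x, Measurable (X x)) (m n : ℕ) :
    Measurable fun ω => fullPair m n (idSample X ω) := by
  have h : ∀ j, Measurable fun ω => quadVar m j n (idSample X ω) := by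
    intro j
    unfold quadVar
    have := measurable_bilinDiff hX m j
    fun_prop
  have h' : Measurable fun ω i => fullPair m n (idSample X ω) i := by
    refine measurable_pi_lambda _ fun i => ?_
    simp_rw [fullPair_apply]
    exact h _
  exact (WithLp.measurable_toLp 2 _).comp h'

section CLT

variable {m : ℕ} {φ₁ φ₂ : ℝ}

/-- Coefficients of the linear combination of squared differences with frequency vector `u`. -/
noncomputable def freqCoeff (m n : ℕ) (u : Plane) (i : Fin 2) : ℝ :=
  n * u i / ((n - ((i : ℕ) + 1) * m : ℕ) : ℝ) ^ 2

/-- For each pair of steps this is an average of squared covariances over pairs of sites, corrected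
by ratios of grid sizes that tend to one. The half of `Σ` left by Parseval is exactly the half in
the Gaussian exponent. -/
lemma sum_freqCoeff_cov_tendsto (hφ₁ : 0 ≤ φ₁) (hφ₂ : 0 < φ₂) (hm : ⌊φ₂⌋₊ + 1 ≤ m) (u : Plane) :
    Tendsto (fun n : ℕ => ∑ c : incIndex m n, ∑ c' : incIndex m n,
      freqCoeff m n u c.1.1 * freqCoeff m n u c'.1.1 *
        covMatrix m φ₁ φ₂ (fun c : incIndex m n => c.1) c c' ^ 2) atTop
      (𝓝 (u ⬝ᵥ (asympCov m φ₁ φ₂).mulVec u / 2)) := by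
  have e1 : ∀ n : ℕ, (∑ c : incIndex m n, ∑ c' : incIndex m n,
      freqCoeff m n u c.1.1 * freqCoeff m n u c'.1.1 *
        covMatrix m φ₁ φ₂ (fun c : incIndex m n => c.1) c c' ^ 2)
      = ∑ i, ∑ i', freqCoeff m n u i * freqCoeff m n u i' *
        ∑ t ∈ grid (n - ((i : ℕ) + 1) * m), ∑ t' ∈ grid (n - ((i' : ℕ) + 1) * m),
          covFun m φ₁ φ₂ i i' (siteSub t t') ^ 2 := by
    intro n
    simp only [covMatrix, Matrix.of_apply]
    rw [Finset.sum_coe_sort (incIndex m n) fun c => ∑ c' : incIndex m n,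
      freqCoeff m n u c.1 * freqCoeff m n u c'.1.1 * covFun m φ₁ φ₂ c.1 c'.1.1
        (fun r => (c.2 r : ℤ) - (c'.1.2 r : ℤ)) ^ 2, sum_incIndex]
    refine Finset.sum_congr rfl fun i _ => ?_
    have h1 : ∀ t, ∑ c' : incIndex m n, freqCoeff m n u i * freqCoeff m n u c'.1.1 *
        covFun m φ₁ φ₂ i c'.1.1 (fun r => (t r : ℤ) - (c'.1.2 r : ℤ)) ^ 2
        = ∑ i' : Fin 2, ∑ t' ∈ grid (n - ((i' : ℕ) + 1) * m), freqCoeff m n u i * freqCoeff m n u i' *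
          covFun m φ₁ φ₂ i i' (siteSub t t') ^ 2 := by
      intro t
      rw [Finset.sum_coe_sort (incIndex m n) fun c' => freqCoeff m n u i * freqCoeff m n u c'.1 *
        covFun m φ₁ φ₂ i c'.1 (fun r => (t r : ℤ) - (c'.2 r : ℤ)) ^ 2, sum_incIndex]
      rfl
    simp_rw [h1]
    rw [Finset.sum_comm]
    simp_rw [Finset.mul_sum]
  have e2 : u ⬝ᵥ (asympCov m φ₁ φ₂).mulVec u / 2
      = ∑ i, ∑ i', u i * u i' * (asympCov m φ₁ φ₂ i i' / 2) := by
    simp only [dotProduct, Matrix.mulVec, Fin.sum_univ_two]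
    ring
  rw [e2]
  simp_rw [e1]
  refine tendsto_finsetSum _ fun i _ => tendsto_finsetSum _ fun i' _ => ?_
  have hs := hasSum_covFun_sq hφ₁ hφ₂ hm i i'
  have h1 := tendsto_sum_grid_pairs hs.summable (((i : ℕ) + 1) * m) (((i' : ℕ) + 1) * m)
  rw [hs.tsum_eq] at h1
  have h2 : ∀ a : ℕ, Tendsto (fun n : ℕ => (((n - a : ℕ) : ℝ) / n) ^ 2) atTop (𝓝 1) := fun a => by
    simpa using (tendsto_natSub_div a).pow 2
  have h3 := (((h2 (((i : ℕ) + 1) * m)).mul (h2 (((i' : ℕ) + 1) * m))).inv₀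
    (by norm_num)).const_mul (u i * u i')
  have h4 := h3.mul h1
  simp only [mul_one, inv_one] at h4
  refine h4.congr' ?_
  filter_upwards [eventually_gt_atTop ((((i : ℕ) + 1) * m) + (((i' : ℕ) + 1) * m))] with n hn
  have hn0 : (n : ℝ) ≠ 0 := by
    have : n ≠ 0 := by omega
    exact_mod_cast this
  have ha : ((n - ((i : ℕ) + 1) * m : ℕ) : ℝ) ≠ 0 := by
    have : n - ((i : ℕ) + 1) * m ≠ 0 := by omega
    exact_mod_cast this
  have hb : ((n - ((i' : ℕ) + 1) * m : ℕ) : ℝ) ≠ 0 := by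
    have : n - ((i' : ℕ) + 1) * m ≠ 0 := by omega
    exact_mod_cast this
  unfold freqCoeff
  field_simp

lemma abs_freqCoeff_le {n : ℕ} (hn : 2 * m < n) (u : Plane) (i : Fin 2) :
    |freqCoeff m n u i| ≤ ‖u‖ * (n / ((n - 2 * m : ℕ) : ℝ) ^ 2) := by
  have h0 : (0 : ℝ) < ((n - 2 * m : ℕ) : ℝ) := by
    have : 0 < n - 2 * m := by omega
    exact_mod_cast this
  have h1 : ((n - 2 * m : ℕ) : ℝ) ≤ ((n - ((i : ℕ) + 1) * m : ℕ) : ℝ) := by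
    have : ((i : ℕ) + 1) * m ≤ 2 * m := Nat.mul_le_mul_right m (by omega)
    have : n - 2 * m ≤ n - ((i : ℕ) + 1) * m := by omega
    exact_mod_cast this
  rw [freqCoeff, abs_div, abs_mul, abs_pow, Nat.abs_cast, Nat.abs_cast]
  calc (n : ℝ) * |u i| / ((n - ((i : ℕ) + 1) * m : ℕ) : ℝ) ^ 2
      ≤ (n : ℝ) * ‖u‖ / ((n - 2 * m : ℕ) : ℝ) ^ 2 := by
        gcongr
        exact abs_apply_le_norm u i
    _ = _ := by ring

lemma tendsto_freq_bound (m : ℕ) (u : Plane) :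
    Tendsto (fun n : ℕ => ‖u‖ * (n / ((n - 2 * m : ℕ) : ℝ) ^ 2)) atTop (𝓝 0) := by
  have h1 := ((tendsto_natSub_div (2 * m)).pow 2).inv₀ (by norm_num)
  have h2 := (h1.mul (tendsto_const_div_atTop_nhds_zero_nat (1 : ℝ))).const_mul ‖u‖
  simp only [mul_zero] at h2
  refine h2.congr' ?_
  filter_upwards [eventually_gt_atTop (2 * m)] with n hn
  have hn0 : (n : ℝ) ≠ 0 := by
    have : n ≠ 0 := by omega
    exact_mod_cast this
  have ha : ((n - 2 * m : ℕ) : ℝ) ≠ 0 := by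
    have : n - 2 * m ≠ 0 := by omega
    exact_mod_cast this
  field_simp

lemma inner_fullPair_sub {n : ℕ} (hn : 2 * m < n) (x : Site → ℝ) (q u : Plane) :
    inner ℝ (Real.sqrt (sampleSize n) • (fullPair m n x - q)) u
      = ∑ c : incIndex m n, freqCoeff m n u c.1.1 *
        (bilinDiff m ((c.1.1 : ℕ) + 1) x c.1.2 ^ 2 - q c.1.1) := by
  rw [Finset.sum_coe_sort (incIndex m n) fun c => freqCoeff m n u c.1 *
        (bilinDiff m ((c.1 : ℕ) + 1) x c.2 ^ 2 - q c.1), sum_incIndex, PiLp.inner_apply]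
  refine Finset.sum_congr rfl fun i _ => ?_
  dsimp only
  rw [← Finset.mul_sum, Finset.sum_sub_distrib, Finset.sum_const, nsmul_eq_mul, card_grid]
  simp only [PiLp.smul_apply, PiLp.sub_apply, fullPair_apply, smul_eq_mul, quadVar, card_grid,
    sampleSize, RCLike.inner_apply, conj_trivial, freqCoeff]
  rw [Real.sqrt_sq (by positivity)]
  have ha : ((n - ((i : ℕ) + 1) * m : ℕ) : ℝ) ≠ 0 := by
    have : ((i : ℕ) + 1) * m ≤ 2 * m := Nat.mul_le_mul_right m (by omega)
    have : n - ((i : ℕ) + 1) * m ≠ 0 := by omega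
    exact_mod_cast this
  push_cast
  field_simp

/-- Central limit theorem for the full-grid quadratic variations of a sequence of fields. -/
theorem tendstoGaussian_fullPair {Ω : Type*} [MeasurableSpace Ω] {P : Measure Ω}
    [IsProbabilityMeasure P] (hφ₁ : 0 ≤ φ₁) (hφ₂ : 0 < φ₂) (hm : ⌊φ₂⌋₊ + 1 ≤ m)
    {X : ℕ → Plane → Ω → ℝ} (hX : ∀ n, IsPowerLawField φ₁ φ₂ (X n) P) :
    TendstoGaussian P (fun n ω => Real.sqrt (sampleSize n) •
      (fullPair m n (idSample (X n) ω) - meanPair m φ₁ φ₂)) (asympCov m φ₁ φ₂) := by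
  classical
  have hm' : φ₂ < m := (Nat.floor_lt hφ₂.le).1 (by omega)
  have hY : ∀ n, Measurable fun ω => Real.sqrt (sampleSize n) •
      (fullPair m n (idSample (X n) ω) - meanPair m φ₁ φ₂) := fun n => by
    have := measurable_fullPair (hX n).measurable m n
    fun_prop
  refine ⟨fun n => (hY n).aemeasurable, by fun_prop, ?_⟩
  refine ProbabilityMeasure.tendsto_iff_tendsto_charFun.2 fun u => ?_
  simp only [ProbabilityMeasure.coe_mk, Measure.map_id]
  rw [charFun_multivariateGaussian (asympCov_posSemidef hφ₁ hφ₂ hm')]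
  have e1 : ∀ n, charFun (P.map fun ω => Real.sqrt (sampleSize n) •
      (fullPair m n (idSample (X n) ω) - meanPair m φ₁ φ₂)) u
      = ∫ ω, Complex.exp ((inner ℝ (Real.sqrt (sampleSize n) •
      (fullPair m n (idSample (X n) ω) - meanPair m φ₁ φ₂)) u : ℝ) * Complex.I) ∂P := by
    intro n
    rw [charFun_apply, integral_map (hY n).aemeasurable]
    exact (by fun_prop : Continuous fun x : Plane =>
      Complex.exp ((inner ℝ x u : ℝ) * Complex.I)).aestronglyMeasurable
  simp_rw [e1]
  set W : ℕ → ℝ := fun n => ∑ c : incIndex m n, ∑ c' : incIndex m n,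
      freqCoeff m n u c.1.1 * freqCoeff m n u c'.1.1 *
        covMatrix m φ₁ φ₂ (fun c : incIndex m n => c.1) c c' ^ 2 with hW
  have hWlim : Tendsto W atTop _ := sum_freqCoeff_cov_tendsto hφ₁ hφ₂ hm u
  obtain ⟨C, hC0, hC⟩ := exists_charFun_chiSq_bound
  obtain ⟨κ, hκ0, hκ⟩ := exists_quadForm_covMatrix_le hφ₁ hφ₂ hm'
  set α : ℕ → ℝ := fun n => ‖u‖ * (n / ((n - 2 * m : ℕ) : ℝ) ^ 2) with hα
  have hαlim : Tendsto α atTop (𝓝 0) := tendsto_freq_bound m u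
  -- The diagonal of the covariance matrix consists of the means `q_j`, so centering the squares at
  -- their variances is centering the variations at `q`.
  have hbound : ∀ᶠ n in atTop, ‖(∫ ω, Complex.exp ((inner ℝ (Real.sqrt (sampleSize n) •
      (fullPair m n (idSample (X n) ω) - meanPair m φ₁ φ₂)) u : ℝ) * Complex.I) ∂P)
      - Complex.exp (-(W n : ℂ))‖ ≤ C * (α n * κ + (α n * κ) ^ 2) * W n := by
    filter_upwards [eventually_gt_atTop (2 * m)] with n hn
    have h := charFun_gaussian_quadratic hC0 hC
      (fun (c : incIndex m n) ω => bilinDiff m ((c.1.1 : ℕ) + 1) (idSample (X n) ω) c.1.2)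
      (fun c => measurable_bilinDiff (hX n).measurable m _ _)
      (covMatrix m φ₁ φ₂ fun c : incIndex m n => c.1) (covMatrix_posSemidef hφ₁ hφ₂ hm' _)
      (fun v => (hX n).hasLaw_bilinDiff hφ₁ hφ₂ hm _ v)
      (fun c => freqCoeff m n u c.1.1) (α n) κ (fun c => abs_freqCoeff_le hn u c.1.1)
      (by positivity) (hκ _ Subtype.val_injective)
    simp_rw [covMatrix_self hφ₁ hφ₂ hm] at h
    simp_rw [inner_fullPair_sub hn]
    exact h
  have hzero : Tendsto (fun n => C * (α n * κ + (α n * κ) ^ 2) * W n) atTop (𝓝 0) := by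
    have h1 := hαlim.mul_const κ
    have h2 := ((h1.add (h1.pow 2)).const_mul C).mul hWlim
    simpa using h2
  have h1 := squeeze_zero_norm' hbound hzero
  have h2 : Tendsto (fun n => Complex.exp (-(W n : ℂ))) atTop
      (𝓝 (Complex.exp (-((u ⬝ᵥ (asympCov m φ₁ φ₂).mulVec u / 2 : ℝ) : ℂ)))) :=
    (Complex.continuous_exp.tendsto _).comp
      ((Complex.continuous_ofReal.tendsto _).comp hWlim).neg
  have h3 := h1.add h2
  simp only [sub_add_cancel, zero_add] at h3
  convert h3 using 2
  simp

end CLT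

/-! ### Convergence in probability -/

section InMeasure

variable {Ω : Type*} [MeasurableSpace Ω] {P : Measure Ω}

/-- Continuous mapping for convergence in probability to a constant. -/
lemma tendstoInMeasure_comp_const {E F : Type*} [PseudoMetricSpace E] [PseudoMetricSpace F]
    {Y : ℕ → Ω → E} {c : E} (h : TendstoInMeasure P Y atTop (fun _ => c)) {g : E → F}
    (hg : ContinuousAt g c) :
    TendstoInMeasure P (fun n ω => g (Y n ω)) atTop (fun _ => g c) := by
  rw [tendstoInMeasure_iff_dist] at h ⊢
  intro ε hε
  obtain ⟨δ, hδ, hgδ⟩ := Metric.continuousAt_iff.1 hg ε hε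
  refine tendsto_of_tendsto_of_tendsto_of_le_of_le tendsto_const_nhds (h δ hδ)
    (fun n => zero_le) fun n => measure_mono fun ω hω => ?_
  by_contra hlt
  exact absurd (hgδ (not_le.1 hlt)) (not_lt.2 hω)

/-- A sequence dominated, where the dominating sequence is small, by a sequence that tends to zero
in probability. -/
lemma tendstoInMeasure_zero_of_dominated {E : Type*} [SeminormedAddCommGroup E]
    {A : ℕ → Ω → ℝ} (hA : TendstoInMeasure P A atTop (fun _ => 0)) {R : ℕ → Ω → E}
    (h : ∀ᶠ n in atTop, ∀ ω, |A n ω| < 1 → ‖R n ω‖ ≤ |A n ω|) :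
    TendstoInMeasure P R atTop (fun _ => 0) := by
  rw [tendstoInMeasure_iff_norm] at hA ⊢
  intro ε hε
  refine tendsto_of_tendsto_of_tendsto_of_le_of_le' tendsto_const_nhds
    (hA (min ε 1) (by positivity)) (Eventually.of_forall fun n => zero_le) ?_
  filter_upwards [h] with n hn
  refine measure_mono fun ω hω => ?_
  simp only [Set.mem_ofPred_eq, sub_zero, Real.norm_eq_abs] at hω ⊢
  by_contra hlt
  rw [not_le, lt_min_iff] at hlt
  exact absurd (hn ω hlt.2) (by linarith)

/-- Convergence in probability to zero from convergence of the means. -/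
lemma tendstoInMeasure_zero_of_integral [IsFiniteMeasure P] {A : ℕ → Ω → ℝ}
    (h0 : ∀ n ω, 0 ≤ A n ω) (hint : ∀ n, Integrable (A n) P)
    (hlim : Tendsto (fun n => ∫ ω, A n ω ∂P) atTop (𝓝 0)) :
    TendstoInMeasure P A atTop (fun _ => 0) := by
  rw [tendstoInMeasure_iff_measureReal_norm]
  intro ε hε
  have h1 : ∀ n, P.real {ω | ε ≤ ‖A n ω - 0‖} ≤ ε⁻¹ * ∫ ω, A n ω ∂P := by
    intro n
    have := mul_meas_ge_le_integral_of_nonneg (ae_of_all P (h0 n)) (hint n) ε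
    have e : {ω | ε ≤ ‖A n ω - 0‖} = {ω | ε ≤ A n ω} := by
      ext ω
      simp only [Set.mem_ofPred_eq, sub_zero, Real.norm_of_nonneg (h0 n ω)]
    rw [e, inv_mul_eq_div, le_div_iff₀ hε]
    linarith
  have h2 := hlim.const_mul ε⁻¹
  rw [mul_zero] at h2
  exact squeeze_zero (fun n => measureReal_nonneg) h1 h2

/-- Convergence in distribution to a constant implies convergence in probability. -/
lemma tendstoInMeasure_of_tendstoInDistribution_const [IsProbabilityMeasure P]
    {Ω' : Type*} [MeasurableSpace Ω'] {P' : Measure Ω'} [IsProbabilityMeasure P']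
    {E : Type*} [PseudoMetricSpace E] [MeasurableSpace E] [BorelSpace E] {Y : ℕ → Ω → E} {c : E}
    (h : TendstoInDistribution Y atTop (fun _ : Ω' => c) (fun _ => P) P') :
    TendstoInMeasure P Y atTop (fun _ => c) := by
  rw [tendstoInMeasure_iff_dist]
  intro ε hε
  have hcl : IsClosed {y : E | ε ≤ dist y c} := isClosed_le continuous_const (by fun_prop)
  have hnull : (P'.map (fun _ : Ω' => c)) (frontier {y : E | ε ≤ dist y c}) = 0 := by
    rw [Measure.map_const, measure_univ, one_smul,
      Measure.dirac_apply' _ isClosed_frontier.measurableSet, Set.indicator_of_notMem]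
    intro hc
    have := hcl.frontier_subset hc
    simp only [Set.mem_ofPred_eq, dist_self] at this
    linarith
  have h1 := ProbabilityMeasure.tendsto_measure_of_null_frontier_of_tendsto' h.tendsto hnull
  simp only [ProbabilityMeasure.coe_mk] at h1
  have h2 : (P'.map (fun _ : Ω' => c)) {y : E | ε ≤ dist y c} = 0 := by
    rw [Measure.map_const, measure_univ, one_smul, Measure.dirac_apply' _ hcl.measurableSet,
      Set.indicator_of_notMem]
    simp only [Set.mem_ofPred_eq, dist_self]
    linarith
  rw [h2] at h1
  refine h1.congr fun n => ?_
  rw [Measure.map_apply_of_aemeasurable (h.forall_aemeasurable n) hcl.measurableSet]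
  rfl

lemma tendstoInMeasure_const {E : Type*} [PseudoMetricSpace E] {a : ℕ → E} {c : E}
    (h : Tendsto a atTop (𝓝 c)) : TendstoInMeasure P (fun n _ => a n) atTop (fun _ => c) := by
  rw [tendstoInMeasure_iff_dist]
  intro ε hε
  refine (tendsto_const_nhds (x := 0)).congr' ?_
  filter_upwards [Metric.tendsto_atTop'.1 h ε hε |>.elim fun N hN => (eventually_gt_atTop N).mono hN]
    with n hn
  simp [not_le.2 hn]

end InMeasure

/-! ### Slutsky-type rules for Gaussian limits. -/

section Gaussian

variable {Ω : Type*} [MeasurableSpace Ω] {P : Measure Ω} [IsProbabilityMeasure P]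
  {Y : ℕ → Ω → Plane} {S : Matrix (Fin 2) (Fin 2) ℝ}

/-- **Slutsky's theorem** for Gaussian limits in the plane. -/
lemma TendstoGaussian.slutsky (hY : TendstoGaussian P Y S) {E : Type*} [SeminormedAddCommGroup E]
    [SecondCountableTopology E] [MeasurableSpace E] [BorelSpace E] {V : ℕ → Ω → E} {c : E}
    (hV : TendstoInMeasure P V atTop (fun _ => c)) (hVm : ∀ n, AEMeasurable (V n) P)
    {g : Plane × E → Plane} (hg : Continuous g) (hgc : ∀ y, g (y, c) = y) :
    TendstoGaussian P (fun n ω => g (Y n ω, V n ω)) S := by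
  have h := TendstoInDistribution.continuous_comp_prodMk_of_tendstoInMeasure_const hg hY hV hVm
  have e : (fun y : Plane => g (id y, c)) = id := funext hgc
  rw [e] at h
  exact h

/-- Modification on events of vanishing probability. -/
lemma TendstoGaussian.congr_of_small (hY : TendstoGaussian P Y S) {Y' : ℕ → Ω → Plane}
    (hY' : ∀ n, AEMeasurable (Y' n) P) {A : ℕ → Ω → ℝ}
    (hA : TendstoInMeasure P A atTop (fun _ => 0))
    (h : ∀ᶠ n in atTop, ∀ ω, |A n ω| < 1 → Y' n ω = Y n ω) : TendstoGaussian P Y' S := by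
  refine tendstoInDistribution_of_tendstoInMeasure_sub (X := Y) Y' id hY ?_ hY'
  refine tendstoInMeasure_zero_of_dominated hA ?_
  filter_upwards [h] with n hn ω hω
  simp [hn ω hω]

/-- A null sequence times a sequence converging in distribution tends to zero in probability. -/
lemma TendstoGaussian.smul_tendstoInMeasure (hY : TendstoGaussian P Y S) {a : ℕ → ℝ}
    (ha : Tendsto a atTop (𝓝 0)) :
    TendstoInMeasure P (fun n ω => a n • Y n ω) atTop (fun _ => 0) := by
  have h := TendstoInDistribution.continuous_comp_prodMk_of_tendstoInMeasure_const
    (g := fun z : Plane × ℝ => z.2 • z.1) (by fun_prop) hY (tendstoInMeasure_const (P := P) ha)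
    (fun n => aemeasurable_const)
  simp only [zero_smul] at h
  exact tendstoInMeasure_of_tendstoInDistribution_const h

end Gaussian

/-! ### Moments of the differences -/

section Moments

variable {Ω : Type*} [MeasurableSpace Ω] {P : Measure Ω}
  {m : ℕ} {φ₁ φ₂ : ℝ} {X : Plane → Ω → ℝ}

lemma meanPair_pos (hφ₁ : 0 < φ₁) (hφ₂ : 0 < φ₂) (hm : φ₂ < m) (i : Fin 2) :
    0 < meanPair m φ₁ φ₂ i := by
  have := scaleFun_pos hφ₂ hm
  fin_cases i
  · simp only [meanPair, Fin.zero_eta, PiLp.toLp_apply, Matrix.cons_val_zero]; positivity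
  · simp only [meanPair, Fin.mk_one, PiLp.toLp_apply, Matrix.cons_val_one,
      Matrix.cons_val_fin_one]; positivity

lemma IsPowerLawField.integrable_sq_bilinDiff (hX : IsPowerLawField φ₁ φ₂ X P) (hφ₁ : 0 < φ₁)
    (hφ₂ : 0 < φ₂) (hm : ⌊φ₂⌋₊ + 1 ≤ m) (i : Fin 2) (t : Site) :
    Integrable (fun ω => bilinDiff m ((i : ℕ) + 1) (idSample X ω) t ^ 2) P ∧
    ∫ ω, bilinDiff m ((i : ℕ) + 1) (idSample X ω) t ^ 2 ∂P = meanPair m φ₁ φ₂ i := by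
  have hm' : φ₂ < m := (Nat.floor_lt hφ₂.le).1 (by omega)
  have h := hX.hasLaw_inc hφ₂ hm (fun _ : Unit => 1) (fun _ => (i, t))
  rw [integral_featureSum_single hφ₂ hm] at h
  simp only [Finset.univ_unique, Finset.sum_singleton, one_mul] at h
  set v := (meanPair m φ₁ φ₂ i).toNNReal with hv
  have hid : MemLp (fun x : ℝ => x) 2 (gaussianReal 0 v) := memLp_id_gaussianReal 2
  have hsq : Integrable (fun x : ℝ => x ^ 2) (gaussianReal 0 v) := hid.integrable_sq
  have hvar : ∫ x, x ^ 2 ∂(gaussianReal 0 v) = meanPair m φ₁ φ₂ i := by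
    have h1 := variance_fun_id_gaussianReal (μ := 0) (v := v)
    rw [variance_of_integral_eq_zero hid.aestronglyMeasurable.aemeasurable
      integral_id_gaussianReal] at h1
    rw [h1, hv, Real.coe_toNNReal _ (meanPair_pos hφ₁ hφ₂ hm' i).le]
  constructor
  · have := hsq
    rw [← h.map_eq] at this
    exact this.comp_aemeasurable h.aemeasurable
  · rw [← hvar]
    exact h.integral_comp hsq.aestronglyMeasurable

/-- The full-grid quadratic variations are unbiased. -/
lemma IsPowerLawField.integral_quadVar (hX : IsPowerLawField φ₁ φ₂ X P) (hφ₁ : 0 < φ₁)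
    (hφ₂ : 0 < φ₂) (hm : ⌊φ₂⌋₊ + 1 ≤ m) {n : ℕ} (hn : 2 * m < n) (i : Fin 2) :
    ∫ ω, quadVar m ((i : ℕ) + 1) n (idSample X ω) ∂P = meanPair m φ₁ φ₂ i := by
  simp only [quadVar]
  rw [integral_div, integral_finsetSum _ fun t _ =>
    (hX.integrable_sq_bilinDiff hφ₁ hφ₂ hm i t).1]
  simp_rw [(hX.integrable_sq_bilinDiff hφ₁ hφ₂ hm i _).2]
  rw [Finset.sum_const, nsmul_eq_mul, mul_div_cancel_left₀]
  rw [card_grid]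
  have : ((i : ℕ) + 1) * m ≤ 2 * m := Nat.mul_le_mul_right m (by omega)
  have : n - ((i : ℕ) + 1) * m ≠ 0 := by omega
  positivity

end Moments

/-! ### Thinning -/

open Classical in
/-- The indicator that the difference of step `j` at `t` touches a deleted site. -/
noncomputable def lossInd (m j : ℕ) (b : Site → Bool) (t : Site) : ℝ :=
  if ∀ a ∈ stencil m, b (t + j • a) = true then 0 else 1

lemma lossInd_nonneg (m j : ℕ) (b : Site → Bool) (t : Site) : 0 ≤ lossInd m j b t := by
  unfold lossInd; split_ifs <;> norm_num

lemma lossInd_le_one (m j : ℕ) (b : Site → Bool) (t : Site) : lossInd m j b t ≤ 1 := by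
  unfold lossInd; split_ifs <;> norm_num

/-- The stencils based in `Λ_{n-jm}` stay inside `Λ_n`, so retention outside the grid is irrelevant.
-/
lemma lossInd_congr {m j n : ℕ} {b b' : Site → Bool} (h : ∀ s ∈ grid n, b s = b' s) {t : Site}
    (ht : t ∈ grid (n - j * m)) : lossInd m j b t = lossInd m j b' t := by
  have : ∀ a ∈ stencil m, b (t + j • a) = b' (t + j • a) := by
    intro a ha
    apply h
    rw [stencil, mem_grid] at ha
    rw [mem_grid] at ht ⊢
    intro r
    have h1 := ha r
    have h2 := ht r
    have h3 : j * a r ≤ j * m := Nat.mul_le_mul_left j (by omega)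
    simp only [Pi.add_apply, Pi.smul_apply, smul_eq_mul]
    omega
  unfold lossInd
  congr 1
  exact propext (forall₂_congr fun a ha => by rw [this a ha])

lemma sum_keptSites (m j n : ℕ) (b : Site → Bool) (f : Site → ℝ) :
    ∑ t ∈ keptSites m j n b, f t = ∑ t ∈ grid (n - j * m), (1 - lossInd m j b t) * f t := by
  rw [keptSites, Finset.sum_filter]
  refine Finset.sum_congr rfl fun t _ => ?_
  unfold lossInd
  split_ifs <;> simp

lemma card_keptSites (m j n : ℕ) (b : Site → Bool) :
    ((keptSites m j n b).card : ℝ) = ∑ t ∈ grid (n - j * m), (1 - lossInd m j b t) := by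
  have := sum_keptSites m j n b fun _ => 1
  simpa using this

/-- The total weight of the lost differences, with the squared differences, their mean and `1` as
weights. -/
noncomputable def lossWeight (m j n : ℕ) (q : ℝ) (b : Site → Bool) (x : Site → ℝ) : ℝ :=
  ∑ t ∈ grid (n - j * m), (bilinDiff m j x t ^ 2 + q + 1) * lossInd m j b t

/-- The average over `Λ_{n-jm}` of the loss indicators. -/
noncomputable def lossFrac (m j n : ℕ) (b : Site → Bool) : ℝ :=
  (∑ t ∈ grid (n - j * m), lossInd m j b t) / ((grid (n - j * m)).card : ℝ)

/-- The average over `Λ_{n-jm}` of the centered squares of the lost differences. -/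
noncomputable def lossDev (m j n : ℕ) (q : ℝ) (b : Site → Bool) (x : Site → ℝ) : ℝ :=
  (∑ t ∈ grid (n - j * m), (bilinDiff m j x t ^ 2 - q) * lossInd m j b t)
    / ((grid (n - j * m)).card : ℝ)

lemma lossWeight_nonneg {m j n : ℕ} {q : ℝ} (hq : 0 ≤ q) (b : Site → Bool) (x : Site → ℝ) :
    0 ≤ lossWeight m j n q b x :=
  Finset.sum_nonneg fun t _ => mul_nonneg (by positivity) (lossInd_nonneg m j b t)

lemma abs_lossFrac_le {m j n : ℕ} {q : ℝ} (hq : 0 ≤ q) (b : Site → Bool) (x : Site → ℝ) :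
    |lossFrac m j n b| ≤ lossWeight m j n q b x / ((grid (n - j * m)).card : ℝ) := by
  rw [lossFrac, abs_div, Nat.abs_cast]
  gcongr
  rw [abs_of_nonneg (Finset.sum_nonneg fun t _ => lossInd_nonneg m j b t)]
  refine Finset.sum_le_sum fun t _ => le_mul_of_one_le_left (lossInd_nonneg m j b t) ?_
  nlinarith [sq_nonneg (bilinDiff m j x t)]

lemma abs_lossDev_le {m j n : ℕ} {q : ℝ} (hq : 0 ≤ q) (b : Site → Bool) (x : Site → ℝ) :
    |lossDev m j n q b x| ≤ lossWeight m j n q b x / ((grid (n - j * m)).card : ℝ) := by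
  rw [lossDev, abs_div, Nat.abs_cast]
  gcongr
  refine (Finset.abs_sum_le_sum_abs _ _).trans (Finset.sum_le_sum fun t _ => ?_)
  rw [abs_mul, abs_of_nonneg (lossInd_nonneg m j b t)]
  refine mul_le_mul_of_nonneg_right ?_ (lossInd_nonneg m j b t)
  rw [abs_le]
  constructor <;> nlinarith [sq_nonneg (bilinDiff m j x t)]

/-- The thinned quadratic variation in terms of the full-grid one and of the losses. -/
lemma thinnedQuadVar_sub {m j n : ℕ} (hn : j * m < n) (q : ℝ) (b : Site → Bool) (x : Site → ℝ)
    (hb : lossFrac m j n b < 1) :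
    thinnedQuadVar m j n b x - q
      = (1 - lossFrac m j n b)⁻¹ * ((quadVar m j n x - q) - lossDev m j n q b x) := by
  have hN : ((grid (n - j * m)).card : ℝ) ≠ 0 := by
    rw [card_grid]
    have : n - j * m ≠ 0 := by omega
    positivity
  have hK : ((keptSites m j n b).card : ℝ)
      = ((grid (n - j * m)).card : ℝ) * (1 - lossFrac m j n b) := by
    rw [card_keptSites, lossFrac, Finset.sum_sub_distrib, mul_sub, mul_div_cancel₀ _ hN]
    simp
  have hb' : 1 - lossFrac m j n b ≠ 0 := by linarith
  rw [thinnedQuadVar, hK, sum_keptSites, eq_inv_mul_iff_mul_eq₀ hb']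
  have h1 : lossDev m j n q b x = (∑ t ∈ grid (n - j * m), lossInd m j b t * bilinDiff m j x t ^ 2)
      / ((grid (n - j * m)).card : ℝ) - q * lossFrac m j n b := by
    rw [lossDev, lossFrac, mul_div_assoc', ← sub_div, Finset.mul_sum, ← Finset.sum_sub_distrib]
    congr 1
    exact Finset.sum_congr rfl fun t _ => by ring
  have h2 : ∑ t ∈ grid (n - j * m), (1 - lossInd m j b t) * bilinDiff m j x t ^ 2
      = ∑ t ∈ grid (n - j * m), bilinDiff m j x t ^ 2
        - ∑ t ∈ grid (n - j * m), lossInd m j b t * bilinDiff m j x t ^ 2 := by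
    rw [← Finset.sum_sub_distrib]
    exact Finset.sum_congr rfl fun t _ => by ring
  rw [h1, h2, quadVar]
  field_simp
  ring

/-! ### Expected losses at a fixed stage. -/

section Stage

variable {Ω : Type*} [MeasurableSpace Ω] {P : Measure Ω} [IsProbabilityMeasure P] {m n : ℕ}
  {B : Site → Ω → Bool}

open Classical in
/-- Extension of a retention pattern on `Λ_n` to all sites. -/
noncomputable def extendPattern {n : ℕ} (b : grid n → Bool) (s : Site) : Bool :=
  if h : s ∈ grid n then b ⟨s, h⟩ else true

/-- This exhibits the loss as a function of the pattern on the finite grid, from which its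
measurability and its independence of the field are read off. -/
lemma lossInd_eq_extend {m n j : ℕ} {t : Site} (ht : t ∈ grid (n - j * m)) (b : Site → Bool) :
    lossInd m j b t = lossInd m j (extendPattern fun s : grid n => b s) t :=
  lossInd_congr (fun s hs => by simp [extendPattern, hs]) ht

lemma measurable_lossInd_extend (m j : ℕ) (t : Site) :
    Measurable fun b : grid n → Bool => lossInd m j (extendPattern b) t :=
  measurable_of_countable _

lemma measurable_pattern (hB : ∀ t ∈ grid n, Measurable (B t)) :
    Measurable fun ω (t : grid n) => B t ω :=
  measurable_pi_lambda _ fun t => hB t t.2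

lemma measurable_lossInd (hB : ∀ t ∈ grid n, Measurable (B t)) {j : ℕ} {t : Site}
    (ht : t ∈ grid (n - j * m)) : Measurable fun ω => lossInd m j (fun s => B s ω) t := by
  have h3 : (fun ω => lossInd m j (fun s => B s ω) t)
      = fun ω => lossInd m j (extendPattern fun s : grid n => B s ω) t :=
    funext fun ω => lossInd_eq_extend ht _
  rw [h3]
  exact (measurable_lossInd_extend m j t).comp (measurable_pattern hB)

/-- Union bound over the `(m+1)²` sites of the stencil, each deleted with probability `1 - p`. -/
lemma integral_lossInd_le (hB : ∀ t ∈ grid n, Measurable (B t)) {p : ℝ}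
    (hp : ∀ t ∈ grid n, P.real {ω | B t ω = true} = p) {j : ℕ} {t : Site}
    (ht : t ∈ grid (n - j * m)) :
    ∫ ω, lossInd m j (fun s => B s ω) t ∂P ≤ ((m : ℝ) + 1) ^ 2 * (1 - p) := by
  have hmem : ∀ a ∈ stencil m, t + j • a ∈ grid n := by
    intro a ha
    rw [stencil, mem_grid] at ha
    rw [mem_grid] at ht ⊢
    intro r
    have h1 := ha r
    have h2 := ht r
    have h3 : j * a r ≤ j * m := Nat.mul_le_mul_left j (by omega)
    simp only [Pi.add_apply, Pi.smul_apply, smul_eq_mul]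
    omega
  set E : Site → Set Ω := fun a => {ω | B (t + j • a) ω = true}ᶜ with hE
  have hEm : ∀ a ∈ stencil m, MeasurableSet {ω | B (t + j • a) ω = true} := fun a ha =>
    hB _ (hmem a ha) (measurableSet_singleton true)
  have hle : ∀ ω, lossInd m j (fun s => B s ω) t
      ≤ ∑ a ∈ stencil m, (E a).indicator (fun _ => (1 : ℝ)) ω := by
    intro ω
    unfold lossInd
    split_ifs with h
    · exact Finset.sum_nonneg fun a _ => Set.indicator_nonneg (fun _ _ => zero_le_one) _
    · push Not at h
      obtain ⟨a, ha, hb⟩ := h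
      have h1 := Finset.single_le_sum (f := fun a => (E a).indicator (fun _ => (1 : ℝ)) ω)
        (fun a _ => Set.indicator_nonneg (fun _ _ => zero_le_one) _) ha
      have h2 : (E a).indicator (fun _ => (1 : ℝ)) ω = 1 :=
        Set.indicator_of_mem (by simpa [hE] using hb) _
      simpa only [h2] using h1
  have hi : ∀ a ∈ stencil m, Integrable ((E a).indicator fun _ => (1 : ℝ)) P := fun a ha =>
    (integrable_const 1).indicator (hEm a ha).compl
  have hl : Integrable (fun ω => lossInd m j (fun s => B s ω) t) P := by
    refine Integrable.of_bound (C := 1) (measurable_lossInd hB ht).aestronglyMeasurable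
      (ae_of_all _ fun ω => ?_)
    rw [Real.norm_of_nonneg (lossInd_nonneg _ _ _ _)]
    exact lossInd_le_one _ _ _ _
  refine (integral_mono hl (integrable_finsetSum _ hi) hle).trans_eq ?_
  rw [integral_finsetSum _ hi]
  have h1 : ∀ a ∈ stencil m, ∫ ω, (E a).indicator (fun _ => (1 : ℝ)) ω ∂P = 1 - p := by
    intro a ha
    rw [integral_indicator_const _ (hEm a ha).compl, smul_eq_mul, mul_one,
      probReal_compl_eq_one_sub (hEm a ha), hp _ (hmem a ha)]
  rw [Finset.sum_congr rfl h1, Finset.sum_const, stencil, card_grid, nsmul_eq_mul]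
  push_cast
  ring

/-- Independence of pattern and field factorizes each expectation into `E(D² + q + 1) = 2q + 1` and
the probability of loss. -/
lemma lossWeight_mean {φ₁ φ₂ : ℝ} {X : Plane → Ω → ℝ} (hX : IsPowerLawField φ₁ φ₂ X P)
    (hφ₁ : 0 < φ₁) (hφ₂ : 0 < φ₂) (hm : ⌊φ₂⌋₊ + 1 ≤ m) (hB : ∀ t ∈ grid n, Measurable (B t)) {p : ℝ}
    (hp : ∀ t ∈ grid n, P.real {ω | B t ω = true} = p)
    (hind : IndepFun (fun ω (x : Plane) => X x ω) (fun ω (t : grid n) => B t ω) P) (i : Fin 2) :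
    Integrable (fun ω => lossWeight m ((i : ℕ) + 1) n (meanPair m φ₁ φ₂ i) (fun s => B s ω)
      (idSample X ω)) P ∧
    ∫ ω, lossWeight m ((i : ℕ) + 1) n (meanPair m φ₁ φ₂ i) (fun s => B s ω) (idSample X ω) ∂P
      ≤ ((grid (n - ((i : ℕ) + 1) * m)).card : ℝ) *
        ((2 * meanPair m φ₁ φ₂ i + 1) * (((m : ℝ) + 1) ^ 2 * (1 - p))) := by
  have hm' : φ₂ < m := (Nat.floor_lt hφ₂.le).1 (by omega)
  set q := meanPair m φ₁ φ₂ i with hq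
  have hq0 : 0 < q := meanPair_pos hφ₁ hφ₂ hm' i
  set j := (i : ℕ) + 1 with hj
  have hsq : ∀ t, Integrable (fun ω => bilinDiff m j (idSample X ω) t ^ 2 + q + 1) P := fun t =>
    ((hX.integrable_sq_bilinDiff hφ₁ hφ₂ hm i t).1.add (integrable_const q)).add (integrable_const 1)
  have hsqi : ∀ t, ∫ ω, (bilinDiff m j (idSample X ω) t ^ 2 + q + 1) ∂P = 2 * q + 1 := by
    intro t
    have h1 := hX.integrable_sq_bilinDiff hφ₁ hφ₂ hm i t
    have h2 : Integrable (fun ω => bilinDiff m j (idSample X ω) t ^ 2 + q) P :=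
      h1.1.add (integrable_const q)
    rw [integral_add h2 (integrable_const 1), integral_add h1.1 (integrable_const q), h1.2]
    simp
    ring
  have hl : ∀ t ∈ grid (n - j * m), Integrable (fun ω => lossInd m j (fun s => B s ω) t) P := by
    intro t ht
    refine Integrable.of_bound (C := 1) (measurable_lossInd hB ht).aestronglyMeasurable
      (ae_of_all _ fun ω => ?_)
    rw [Real.norm_of_nonneg (lossInd_nonneg _ _ _ _)]
    exact lossInd_le_one _ _ _ _
  have hindt : ∀ t ∈ grid (n - j * m), IndepFun
      (fun ω => bilinDiff m j (idSample X ω) t ^ 2 + q + 1)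
      (fun ω => lossInd m j (fun s => B s ω) t) P := by
    intro t ht
    have h1 : Measurable fun f : Plane → ℝ =>
        bilinDiff m j (fun s => f (toPlane s)) t ^ 2 + q + 1 := by
      unfold bilinDiff
      fun_prop
    have h2 := hind.comp h1 (measurable_lossInd_extend m j t)
    have h3 : (fun ω => lossInd m j (fun s => B s ω) t)
        = fun ω => lossInd m j (extendPattern fun s : grid n => B s ω) t :=
      funext fun ω => lossInd_eq_extend ht _
    rw [h3]
    exact h2
  have hmul : ∀ t ∈ grid (n - j * m), Integrable (fun ω =>
      (bilinDiff m j (idSample X ω) t ^ 2 + q + 1) * lossInd m j (fun s => B s ω) t) P :=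
    fun t ht => (hindt t ht).integrable_mul (hsq t) (hl t ht)
  constructor
  · exact integrable_finsetSum _ hmul
  · simp only [lossWeight]
    rw [integral_finsetSum _ hmul]
    have h1 : ∀ t ∈ grid (n - j * m),
        ∫ ω, (bilinDiff m j (idSample X ω) t ^ 2 + q + 1) * lossInd m j (fun s => B s ω) t ∂P
        ≤ (2 * q + 1) * (((m : ℝ) + 1) ^ 2 * (1 - p)) := by
      intro t ht
      rw [(hindt t ht).integral_fun_mul_eq_mul_integral (hsq t).aestronglyMeasurable
        (hl t ht).aestronglyMeasurable, hsqi]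
      exact mul_le_mul_of_nonneg_left (integral_lossInd_le hB hp ht) (by positivity)
    refine (Finset.sum_le_sum h1).trans_eq ?_
    rw [Finset.sum_const, nsmul_eq_mul]

lemma measurable_lossFrac (hB : ∀ t ∈ grid n, Measurable (B t)) (j : ℕ) :
    Measurable fun ω => lossFrac m j n fun s => B s ω :=
  (Finset.measurable_fun_sum _ fun _ ht => measurable_lossInd hB ht).div_const _

lemma measurable_lossDev {X : Plane → Ω → ℝ} (hX : ∀ x, Measurable (X x))
    (hB : ∀ t ∈ grid n, Measurable (B t)) (j : ℕ) (q : ℝ) :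
    Measurable fun ω => lossDev m j n q (fun s => B s ω) (idSample X ω) :=
  (Finset.measurable_fun_sum _ fun t ht =>
    (((measurable_bilinDiff hX m j t).pow_const 2).sub_const q).mul
      (measurable_lossInd hB ht)).div_const _

lemma thinnedPair_apply (m n : ℕ) (b : Site → Bool) (x : Site → ℝ) (i : Fin 2) :
    thinnedPair m n b x i = thinnedQuadVar m ((i : ℕ) + 1) n b x := by
  fin_cases i <;> simp [thinnedPair]

lemma measurable_thinnedPair {X : Plane → Ω → ℝ} (hX : ∀ x, Measurable (X x))
    (hB : ∀ t ∈ grid n, Measurable (B t)) :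
    Measurable fun ω => thinnedPair m n (fun s => B s ω) (idSample X ω) := by
  have h : ∀ j, Measurable fun ω => thinnedQuadVar m j n (fun s => B s ω) (idSample X ω) := by
    intro j
    unfold thinnedQuadVar
    simp_rw [sum_keptSites, card_keptSites]
    exact (Finset.measurable_fun_sum _ fun t ht => ((measurable_lossInd hB ht).const_sub 1).mul
      ((measurable_bilinDiff hX m j t).pow_const 2)).div
      (Finset.measurable_fun_sum _ fun t ht => (measurable_lossInd hB ht).const_sub 1)
  have h' : Measurable fun ω i => thinnedPair m n (fun s => B s ω) (idSample X ω) i := by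
    refine measurable_pi_lambda _ fun i => ?_
    simp_rw [thinnedPair_apply]
    exact h _
  exact (WithLp.measurable_toLp 2 _).comp h'

end Stage

/-- Central limit theorem for the thinned quadratic variations of a sequence of fields. -/
theorem tendstoGaussian_thinnedPair {Ω : Type*} [MeasurableSpace Ω] {P : Measure Ω}
    [IsProbabilityMeasure P] {m : ℕ} {φ₁ φ₂ : ℝ} (hφ₁ : 0 < φ₁) (hφ₂ : 0 < φ₂)
    (hm : ⌊φ₂⌋₊ + 1 ≤ m) {X : ℕ → Plane → Ω → ℝ} (hX : ∀ n, IsPowerLawField φ₁ φ₂ (X n) P)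
    {p : ℕ → ℝ} {B : ℕ → Site → Ω → Bool} (hB : ∀ n, ∀ t ∈ grid n, Measurable (B n t))
    (hp : ∀ n, ∀ t ∈ grid n, P.real {ω | B n t ω = true} = p n)
    (hind : ∀ n, IndepFun (fun ω (x : Plane) => X n x ω) (fun ω (t : grid n) => B n t ω) P)
    (hret : Tendsto (fun n => (1 - p n) * Real.sqrt (sampleSize n)) atTop (𝓝 0)) :
    TendstoGaussian P (fun n ω => Real.sqrt (sampleSize n) •
      (thinnedPair m n (fun t => B n t ω) (idSample (X n) ω) - meanPair m φ₁ φ₂))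
      (asympCov m φ₁ φ₂) := by
  have hm' : φ₂ < m := (Nat.floor_lt hφ₂.le).1 (by omega)
  set q := meanPair m φ₁ φ₂ with hqdef
  have hq : ∀ i, 0 < q i := meanPair_pos hφ₁ hφ₂ hm'
  -- A single nonnegative quantity dominates both the loss fraction (once `√N ≥ 1`) and `√N` times
  -- the lost centered squares. Its mean is `O(√N (1 - p_n))`.
  set W : ℕ → Fin 2 → Ω → ℝ := fun n i ω => Real.sqrt (sampleSize n) *
    (lossWeight m ((i : ℕ) + 1) n (q i) (fun s => B n s ω) (idSample (X n) ω)
      / ((grid (n - ((i : ℕ) + 1) * m)).card : ℝ)) with hW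
  have hW0 : ∀ n i ω, 0 ≤ W n i ω := fun n i ω => by
    have := lossWeight_nonneg (m := m) (j := (i : ℕ) + 1) (n := n) (hq i).le (fun s => B n s ω)
      (idSample (X n) ω)
    positivity
  have hmean := fun n i => lossWeight_mean (hX n) hφ₁ hφ₂ hm (hB n) (hp n) (hind n) i
  have hWi : ∀ n i, Integrable (W n i) P := fun n i =>
    ((hmean n i).1.div_const _).const_mul _
  set A : ℕ → Ω → ℝ := fun n ω => ∑ i, W n i ω with hA
  have hAlim : TendstoInMeasure P A atTop (fun _ => 0) := by
    refine tendstoInMeasure_zero_of_integral (fun n ω => Finset.sum_nonneg fun i _ => hW0 n i ω)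
      (fun n => integrable_finsetSum _ fun i _ => hWi n i) ?_
    have e : ∀ n, ∫ ω, A n ω ∂P = ∑ i, ∫ ω, W n i ω ∂P := fun n =>
      integral_finsetSum _ fun i _ => hWi n i
    simp_rw [e]
    rw [show (0 : ℝ) = ∑ i : Fin 2, (0 : ℝ) by simp]
    refine tendsto_finsetSum _ fun i _ => ?_
    have hup := hret.const_mul ((2 * q i + 1) * ((m : ℝ) + 1) ^ 2)
    rw [mul_zero] at hup
    refine tendsto_of_tendsto_of_tendsto_of_le_of_le' tendsto_const_nhds hup
      (Eventually.of_forall fun n => integral_nonneg fun ω => hW0 n i ω) ?_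
    filter_upwards [eventually_gt_atTop (2 * m)] with n hn
    have hN : (0 : ℝ) < ((grid (n - ((i : ℕ) + 1) * m)).card : ℝ) := by
      rw [card_grid]
      have : ((i : ℕ) + 1) * m ≤ 2 * m := Nat.mul_le_mul_right m (by omega)
      have : n - ((i : ℕ) + 1) * m ≠ 0 := by omega
      positivity
    simp only [hW]
    rw [integral_const_mul, integral_div]
    calc _ ≤ Real.sqrt (sampleSize n) * (((2 * q i + 1) * (((m : ℝ) + 1) ^ 2 * (1 - p n)))) := by
          gcongr
          rw [div_le_iff₀ hN, mul_comm _ ((grid (n - ((i : ℕ) + 1) * m)).card : ℝ)]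
          exact (hmean n i).2
      _ = _ := by ring
  set V : ℕ → Ω → (Fin 2 → ℝ) × (Fin 2 → ℝ) := fun n ω =>
    (fun i => lossFrac m ((i : ℕ) + 1) n fun s => B n s ω,
      fun i => Real.sqrt (sampleSize n) *
        lossDev m ((i : ℕ) + 1) n (q i) (fun s => B n s ω) (idSample (X n) ω)) with hV
  have hsqrt : ∀ n : ℕ, 1 ≤ n → 1 ≤ Real.sqrt (sampleSize n) := by
    intro n hn
    rw [sampleSize, Real.sqrt_sq (by positivity)]
    exact_mod_cast hn
  have hWA : ∀ n i ω, W n i ω ≤ |A n ω| := fun n i ω =>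
    (Finset.single_le_sum (f := fun i => W n i ω) (fun i _ => hW0 n i ω)
      (Finset.mem_univ i)).trans (le_abs_self _)
  have hfrac : ∀ n : ℕ, 1 ≤ n → ∀ (i : Fin 2) ω,
      |lossFrac m ((i : ℕ) + 1) n fun s => B n s ω| ≤ |A n ω| := by
    intro n hn i ω
    refine (abs_lossFrac_le (hq i).le (fun s => B n s ω) (idSample (X n) ω)).trans
      (le_trans ?_ (hWA n i ω))
    refine le_mul_of_one_le_left ?_ (hsqrt n hn)
    have := lossWeight_nonneg (m := m) (j := (i : ℕ) + 1) (n := n) (hq i).le (fun s => B n s ω)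
      (idSample (X n) ω)
    positivity
  have hVlim : TendstoInMeasure P V atTop (fun _ => 0) := by
    refine tendstoInMeasure_zero_of_dominated hAlim ?_
    filter_upwards [eventually_ge_atTop 1] with n hn ω _
    rw [Prod.norm_def, max_le_iff, pi_norm_le_iff_of_nonneg (abs_nonneg _),
      pi_norm_le_iff_of_nonneg (abs_nonneg _)]
    refine ⟨fun i => hfrac n hn i ω, fun i => ?_⟩
    simp only [hV]
    rw [norm_mul, Real.norm_of_nonneg (Real.sqrt_nonneg _)]
    refine le_trans ?_ (hWA n i ω)
    exact mul_le_mul_of_nonneg_left (abs_lossDev_le (hq i).le _ _) (Real.sqrt_nonneg _)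
  set ψ : (Fin 2 → ℝ) × (Fin 2 → ℝ) → (Fin 2 → ℝ) × (Fin 2 → ℝ) := fun z =>
    (fun i => (1 - z.1 i)⁻¹, z.2) with hψ
  have hψm : Measurable ψ := by fun_prop
  have hψc : ContinuousAt ψ 0 := by
    refine ContinuousAt.prodMk ?_ (by fun_prop)
    refine continuousAt_pi.2 fun i => ContinuousAt.inv₀ (by fun_prop) (by simp)
  have hVm : ∀ n, Measurable (V n) := fun n =>
    (measurable_pi_lambda _ fun i => measurable_lossFrac (hB n) _).prodMk
      (measurable_pi_lambda _ fun i => (measurable_lossDev (hX n).measurable (hB n) _ _).const_mul _)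
  have hfull := tendstoGaussian_fullPair hφ₁.le hφ₂ hm hX
  have h1 := hfull.slutsky (tendstoInMeasure_comp_const hVlim hψc)
    (fun n => (hψm.comp (hVm n)).aemeasurable)
    (g := fun z => WithLp.toLp 2 fun i => z.2.1 i * (z.1 i - z.2.2 i)) (by fun_prop)
    (fun y => by ext i; simp [hψ])
  -- Where `|A| < 1` the loss fraction is below one, so some differences survive and the exact
  -- decomposition of the thinned variation applies; the complementary event has vanishing
  -- probability.
  refine h1.congr_of_small (fun n => ?_) hAlim ?_
  · have := measurable_thinnedPair (m := m) (hX n).measurable (hB n)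
    exact (by fun_prop : Measurable _).aemeasurable
  · filter_upwards [eventually_gt_atTop (2 * m), eventually_ge_atTop 1] with n hn hn1 ω hω
    ext i
    have hi : ((i : ℕ) + 1) * m < n :=
      lt_of_le_of_lt (Nat.mul_le_mul_right m (by omega)) hn
    have hlt : lossFrac m ((i : ℕ) + 1) n (fun s => B n s ω) < 1 :=
      lt_of_le_of_lt ((le_abs_self _).trans (hfrac n hn1 i ω)) hω
    have h2 := thinnedQuadVar_sub hi (q i) (fun s => B n s ω) (idSample (X n) ω) hlt
    simp only [PiLp.smul_apply, PiLp.sub_apply, thinnedPair_apply, fullPair_apply, smul_eq_mul,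
      hψ, hV]
    rw [h2]
    ring

/-! ### The moment map -/

/-- Gamma is the pointwise limit of Euler's sequence. Measurability on the whole line is wanted
because the estimators evaluate the kernel at random exponents. -/
lemma measurable_Gamma : Measurable Real.Gamma := by
  refine measurable_of_tendsto_metrizable (f := fun n s => Real.GammaSeq s n) (fun n => ?_)
    (tendsto_pi_nhds.2 Real.GammaSeq_tendsto_Gamma)
  unfold Real.GammaSeq
  fun_prop

lemma measurable_powerLawCov (φ₁ : ℝ) (h : Plane) : Measurable fun s => powerLawCov φ₁ s h := by
  unfold powerLawCov
  have hfl : Measurable fun s : ℝ => ⌊s⌋₊ := Nat.measurable_floor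
  have h1 : Measurable fun s : ℝ => (-1 : ℝ) ^ (⌊s⌋₊ + 1) :=
    (measurable_of_countable fun k : ℕ => (-1 : ℝ) ^ (k + 1)).comp hfl
  have h2 : Measurable fun s : ℝ => ((Nat.factorial ⌊s⌋₊ : ℕ) : ℝ) :=
    (measurable_of_countable fun k : ℕ => ((Nat.factorial k : ℕ) : ℝ)).comp hfl
  have h3 : Measurable fun s : ℝ => (⌊s⌋₊ : ℝ) :=
    (measurable_of_countable fun k : ℕ => (k : ℝ)).comp hfl
  have h4 : Measurable fun s : ℝ => Real.Gamma (-s) := measurable_Gamma.comp measurable_neg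
  exact Measurable.ite (measurableSet_eq_fun h3 measurable_id) (by fun_prop) (by fun_prop)

lemma measurable_scaleFun (m : ℕ) : Measurable (scaleFun m) := by
  unfold scaleFun
  have := fun a b : Site => measurable_powerLawCov 1 (toPlane b - toPlane a)
  fun_prop

lemma measurable_vec2 {α : Type*} [MeasurableSpace α] {f g : α → ℝ} (hf : Measurable f)
    (hg : Measurable g) : Measurable fun x => (!₂[f x, g x] : Plane) := by
  refine (WithLp.measurable_toLp 2 (Fin 2 → ℝ)).comp (measurable_pi_lambda _ fun i => ?_)
  fin_cases i
  · exact hf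
  · exact hg

lemma continuous_vec2 {α : Type*} [TopologicalSpace α] {f g : α → ℝ} (hf : Continuous f)
    (hg : Continuous g) : Continuous fun x => (!₂[f x, g x] : Plane) := by
  refine (PiLp.continuous_toLp 2 (fun _ : Fin 2 => ℝ)).comp (continuous_pi fun i => ?_)
  fin_cases i
  · exact hf
  · exact hg

lemma measurable_momentMap (m : ℕ) : Measurable (momentMap m) := by
  have h1 : Measurable fun y : Plane => Real.logb 2 (y 1 / y 0) / 2 := by
    unfold Real.logb
    fun_prop
  have h2 : Measurable fun y : Plane => y 0 / scaleFun m (Real.logb 2 (y 1 / y 0) / 2) :=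
    (by fun_prop : Measurable fun y : Plane => y 0).div ((measurable_scaleFun m).comp h1)
  exact measurable_vec2 h2 h1

section MomentMap

variable {m : ℕ} {φ₁ φ₂ : ℝ}

lemma logb_meanPair (hφ₁ : 0 < φ₁) (hφ₂ : 0 < φ₂) (hm : φ₂ < m) :
    Real.logb 2 (meanPair m φ₁ φ₂ 1 / meanPair m φ₁ φ₂ 0) / 2 = φ₂ := by
  have h := scaleFun_pos hφ₂ hm
  have : meanPair m φ₁ φ₂ 1 / meanPair m φ₁ φ₂ 0 = 2 ^ (2 * φ₂) := by
    simp only [meanPair, PiLp.toLp_apply, Matrix.cons_val_one, Matrix.cons_val_fin_one,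
      Matrix.cons_val_zero]
    field_simp
  rw [this, Real.logb_rpow (by norm_num) (by norm_num)]
  ring

lemma momentMap_meanPair (hφ₁ : 0 < φ₁) (hφ₂ : 0 < φ₂) (hm : φ₂ < m) :
    momentMap m (meanPair m φ₁ φ₂) = !₂[φ₁, φ₂] := by
  have h := scaleFun_pos hφ₂ hm
  rw [momentMap, logb_meanPair hφ₁ hφ₂ hm]
  have : meanPair m φ₁ φ₂ 0 / scaleFun m φ₂ = φ₁ := by
    simp only [meanPair, PiLp.toLp_apply, Matrix.cons_val_zero]
    field_simp
  rw [this]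

lemma differentiableAt_momentMap (hφ₁ : 0 < φ₁) (hφ₂ : 0 < φ₂) (hm : φ₂ < m) :
    DifferentiableAt ℝ (momentMap m) (meanPair m φ₁ φ₂) := by
  have hq := meanPair_pos hφ₁ hφ₂ hm
  have hc : ∀ i : Fin 2, DifferentiableAt ℝ (fun y : Plane => y i) (meanPair m φ₁ φ₂) := fun i => by
    fun_prop
  have h1 : DifferentiableAt ℝ (fun y : Plane => Real.logb 2 (y 1 / y 0) / 2)
      (meanPair m φ₁ φ₂) := by
    unfold Real.logb
    have hdiv : DifferentiableAt ℝ (fun y : Plane => y 1 / y 0) (meanPair m φ₁ φ₂) := by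
      simp only [div_eq_mul_inv]
      exact (hc 1).mul ((hc 0).inv (hq 0).ne')
    have hlog : DifferentiableAt ℝ (fun y : Plane => Real.log (y 1 / y 0)) (meanPair m φ₁ φ₂) :=
      hdiv.log (div_pos (hq 1) (hq 0)).ne'
    simpa only [div_eq_mul_inv] using (hlog.mul_const (Real.log 2)⁻¹).mul_const 2⁻¹
  have hsc : DifferentiableAt ℝ (scaleFun m)
      (Real.logb 2 (meanPair m φ₁ φ₂ 1 / meanPair m φ₁ φ₂ 0) / 2) := by
    rw [logb_meanPair hφ₁ hφ₂ hm]
    exact differentiableAt_scaleFun hφ₂ hm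
  have h2 : DifferentiableAt ℝ
      (fun y : Plane => y 0 / scaleFun m (Real.logb 2 (y 1 / y 0) / 2)) (meanPair m φ₁ φ₂) := by
    have hcomp : DifferentiableAt ℝ (fun y : Plane => scaleFun m (Real.logb 2 (y 1 / y 0) / 2))
      (meanPair m φ₁ φ₂) := DifferentiableAt.comp (g := scaleFun m)
        (f := fun y : Plane => Real.logb 2 (y 1 / y 0) / 2) (meanPair m φ₁ φ₂) hsc h1
    simp only [div_eq_mul_inv (_ : ℝ) (scaleFun m _)]
    refine (hc 0).mul (hcomp.inv ?_)
    rw [logb_meanPair hφ₁ hφ₂ hm]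
    exact (scaleFun_pos hφ₂ hm).ne'
  refine differentiableAt_euclidean.2 fun i => ?_
  fin_cases i
  · exact h2
  · exact h1

/-- The second coordinate of the moment map depends only on the ratio of the variations, so a common
factor affects the first coordinate alone, linearly. This turns rescaled fixed-domain variations
into `τ̂₁/τ₁`. -/
lemma momentMap_smul_zero (m : ℕ) {c : ℝ} (hc : c ≠ 0) (y : Plane) :
    momentMap m (c • y) 0 = c * momentMap m y 0 := by
  simp only [momentMap, PiLp.smul_apply, smul_eq_mul, PiLp.toLp_apply, Matrix.cons_val_zero,
    mul_div_mul_left _ _ hc]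
  ring

lemma momentMap_smul_one (m : ℕ) {c : ℝ} (hc : c ≠ 0) (y : Plane) :
    momentMap m (c • y) 1 = momentMap m y 1 := by
  simp only [momentMap, PiLp.smul_apply, smul_eq_mul, PiLp.toLp_apply, Matrix.cons_val_one,
    Matrix.cons_val_fin_one, mul_div_mul_left _ _ hc]

end MomentMap

/-! ### Linear images and the delta method -/

lemma map_clm_multivariateGaussian {S : Matrix (Fin 2) (Fin 2) ℝ} (hS : S.PosSemidef)
    (L : Plane →L[ℝ] Plane) (M : Matrix (Fin 2) (Fin 2) ℝ)
    (hM : ∀ y i, L y i = ∑ j, M i j * y j) :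
    (multivariateGaussian 0 S).map L = multivariateGaussian 0 (M * S * M.transpose) := by
  have hS' : (M * S * M.transpose).PosSemidef := by
    have := hS.mul_mul_conjTranspose_same M
    rwa [Matrix.conjTranspose_eq_transpose_of_trivial] at this
  have : IsProbabilityMeasure ((multivariateGaussian 0 S).map L) :=
    Measure.isProbabilityMeasure_map L.continuous.aemeasurable
  refine Measure.ext_of_charFun (funext fun t => ?_)
  set s : Plane := WithLp.toLp 2 fun j => ∑ i, M i j * t i with hs
  have hst : ∀ x, inner ℝ (L x) t = inner ℝ x s := by
    intro x
    simp only [PiLp.inner_apply, RCLike.inner_apply, conj_trivial, hM, hs, Fin.sum_univ_two]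
    ring
  have h1 : charFun ((multivariateGaussian 0 S).map L) t = charFun (multivariateGaussian 0 S) s := by
    rw [charFun_apply, charFun_apply, integral_map L.continuous.aemeasurable]
    · simp_rw [hst]
    · exact (by fun_prop : Continuous fun x : Plane =>
        Complex.exp ((inner ℝ x t : ℝ) * Complex.I)).aestronglyMeasurable
  rw [h1, charFun_multivariateGaussian hS, charFun_multivariateGaussian hS']
  have h2 : s ⬝ᵥ S.mulVec s = t ⬝ᵥ (M * S * M.transpose).mulVec t := by
    simp only [dotProduct, Matrix.mulVec, Matrix.mul_apply, Matrix.transpose_apply, hs,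
      Fin.sum_univ_two]
    ring
  rw [h2]
  simp

section Delta

variable {Ω : Type*} [MeasurableSpace Ω] {P : Measure Ω} [IsProbabilityMeasure P]
  {S : Matrix (Fin 2) (Fin 2) ℝ}

lemma TendstoGaussian.of_map {Y : ℕ → Ω → Plane} (hS : S.PosSemidef) {L : Plane →L[ℝ] Plane}
    {M : Matrix (Fin 2) (Fin 2) ℝ} (hM : ∀ y i, L y i = ∑ j, M i j * y j)
    (h : TendstoInDistribution Y atTop (fun y => L y) (fun _ => P) (multivariateGaussian 0 S)) :
    TendstoGaussian P Y (M * S * M.transpose) := by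
  refine ⟨h.forall_aemeasurable, by fun_prop, ?_⟩
  have e := map_clm_multivariateGaussian hS L M hM
  have h1 := h.tendsto
  convert h1 using 2
  refine congrArg 𝓝 (Subtype.ext ?_)
  exact Measure.map_id.trans e.symm

/-- Linear images of sequences with Gaussian limits. -/
lemma TendstoGaussian.map_clm {Y : ℕ → Ω → Plane} (hY : TendstoGaussian P Y S)
    (hS : S.PosSemidef) (L : Plane →L[ℝ] Plane) {M : Matrix (Fin 2) (Fin 2) ℝ}
    (hM : ∀ y i, L y i = ∑ j, M i j * y j) :
    TendstoGaussian P (fun n ω => L (Y n ω)) (M * S * M.transpose) :=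
  TendstoGaussian.of_map hS hM (TendstoInDistribution.continuous_comp L.continuous hY)

lemma tendsto_inv_sqrt_sampleSize :
    Tendsto (fun n => (Real.sqrt (sampleSize n))⁻¹) atTop (𝓝 0) := by
  have : (fun n : ℕ => (Real.sqrt (sampleSize n))⁻¹) = fun n : ℕ => ((n : ℝ))⁻¹ := by
    ext n
    rw [sampleSize, Real.sqrt_sq (by positivity)]
  rw [this]
  exact tendsto_inv_atTop_nhds_zero_nat

lemma sqrt_sampleSize_pos {n : ℕ} (hn : 1 ≤ n) : 0 < Real.sqrt (sampleSize n) := by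
  rw [sampleSize, Real.sqrt_sq (by positivity)]
  exact_mod_cast hn

/-- The **delta method** for the rate `√N`. -/
lemma TendstoGaussian.delta_method {Q : ℕ → Ω → Plane} {q : Plane}
    (hY : TendstoGaussian P (fun n ω => Real.sqrt (sampleSize n) • (Q n ω - q)) S)
    (hS : S.PosSemidef) (hQ : ∀ n, Measurable (Q n)) {h : Plane → Plane} (hm : Measurable h)
    (hd : DifferentiableAt ℝ h q) :
    TendstoGaussian P (fun n ω => Real.sqrt (sampleSize n) • (h (Q n ω) - h q))
      (jacobian h q * S * (jacobian h q).transpose) := by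
  set L := fderiv ℝ h q with hL
  -- The normalized remainder of differentiability, equal to zero at `q` because `0⁻¹ = 0`; it is
  -- continuous there. Then `h(Q) - h(q) = L(Q - q) + ‖Q - q‖ ψ(Q)` exactly, and Slutsky's theorem
  -- removes the last term.
  set ψ : Plane → Plane := fun y => ‖y - q‖⁻¹ • (h y - h q - L (y - q)) with hψ
  have hψq : ψ q = 0 := by simp [hψ]
  have hψc : ContinuousAt ψ q := by
    have h1 := hasFDerivAt_iff_tendsto.1 hd.hasFDerivAt
    rw [ContinuousAt, hψq, tendsto_zero_iff_norm_tendsto_zero]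
    refine h1.congr fun y => ?_
    rw [hψ, norm_smul, norm_inv, norm_norm]
  have hψm : Measurable ψ := by
    have := L.continuous.measurable
    fun_prop
  have hQlim : TendstoInMeasure P Q atTop (fun _ => q) := by
    have h1 := hY.smul_tendstoInMeasure tendsto_inv_sqrt_sampleSize
    have h2 := tendstoInMeasure_comp_const h1 (g := fun z => z + q) (by fun_prop)
    rw [zero_add] at h2
    refine h2.congr' ?_ EventuallyEq.rfl
    filter_upwards [eventually_ge_atTop 1] with n hn
    refine ae_of_all _ fun ω => ?_
    simp [inv_smul_smul₀ (sqrt_sampleSize_pos hn).ne']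
  have hM : ∀ y i, L y i = ∑ j, jacobian h q i j * y j := by
    intro y i
    have e : y = ∑ j, y j • EuclideanSpace.single j (1 : ℝ) := by
      ext r
      fin_cases r <;> simp [Fin.sum_univ_two]
    conv_lhs => rw [e, map_sum]
    simp [jacobian, ← hL, Fin.sum_univ_two, mul_comm]
  have key := TendstoInDistribution.continuous_comp_prodMk_of_tendstoInMeasure_const
    (g := fun z : Plane × Plane => L z.1 + ‖z.1‖ • z.2) (by fun_prop) hY
    (tendstoInMeasure_comp_const hQlim hψc) (fun n => (hψm.comp (hQ n)).aemeasurable)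
  refine TendstoGaussian.of_map hS hM ?_
  convert key using 2 with n y
  · ext1 ω
    simp only [hψ]
    set a := Real.sqrt (sampleSize n)
    have ha : 0 ≤ a := Real.sqrt_nonneg _
    rw [norm_smul, Real.norm_of_nonneg ha, map_smul]
    by_cases h0 : Q n ω - q = 0
    · rw [sub_eq_zero.1 h0]; simp
    · have : ‖Q n ω - q‖ ≠ 0 := norm_ne_zero_iff.2 h0
      rw [smul_smul, mul_assoc, mul_inv_cancel₀ this, mul_one, smul_sub a _ (L _),
        add_sub_cancel]
  · simp [hψq]

end Delta

/-! ### Plug-in scale estimators -/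

section PlugIn

variable {Ω : Type*} [MeasurableSpace Ω] {P : Measure Ω} [IsProbabilityMeasure P]
  {S : Matrix (Fin 2) (Fin 2) ℝ} {R T : ℕ → Ω → ℝ} {c : ℝ}

lemma TendstoGaussian.coord_tendstoInMeasure {Y : ℕ → Ω → Plane} (hY : TendstoGaussian P Y S)
    {a : ℕ → ℝ} (ha : Tendsto a atTop (𝓝 0)) (i : Fin 2) :
    TendstoInMeasure P (fun n ω => a n * Y n ω i) atTop (fun _ => 0) := by
  have := tendstoInMeasure_comp_const (hY.smul_tendstoInMeasure ha)
    (g := fun z : Plane => z i) (by fun_prop)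
  simpa using this

/-- Since `N = n²`, this is `4 (log n)²/n`: the order of the quadratic remainder in the plug-in
expansion. -/
lemma tendsto_log_sq_div :
    Tendsto (fun n => Real.log (sampleSize n) ^ 2 * (Real.sqrt (sampleSize n))⁻¹) atTop (𝓝 0) := by
  have h := (Real.isLittleO_pow_log_id_atTop (n := 2)).tendsto_div_nhds_zero.comp
    tendsto_natCast_atTop_atTop
  have h2 := h.const_mul 4
  rw [mul_zero] at h2
  refine h2.congr fun n => ?_
  simp only [Function.comp_apply, id, sampleSize]
  rw [Real.sqrt_sq (by positivity), Real.log_pow]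
  push_cast
  ring

/-- The plug-in form: `R` estimates `1`, `T` estimates `c`, and the scale is read off from
`e^δ R` with `δ = (log N)(T - c)`. -/
lemma TendstoGaussian.plugIn (hR : ∀ n, Measurable (R n)) (hT : ∀ n, Measurable (T n))
    (hY : TendstoGaussian P
      (fun n ω => Real.sqrt (sampleSize n) • (!₂[R n ω - 1, T n ω - c] : Plane)) S) :
    TendstoGaussian P (fun n ω => Real.sqrt (sampleSize n) •
      (!₂[Real.exp (Real.log (sampleSize n) * (T n ω - c)) * R n ω - 1
        - Real.log (sampleSize n) * (T n ω - c), T n ω - c] : Plane)) S := by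
  set D : ℕ → Ω → ℝ := fun n ω => Real.log (sampleSize n) * (T n ω - c) with hD
  have hDm : ∀ n, Measurable (D n) := fun n => ((hT n).sub_const c).const_mul _
  set A : ℕ → Ω → ℝ := fun n ω => Real.log (sampleSize n) * D n ω with hA
  have hAlim : TendstoInMeasure P A atTop (fun _ => 0) := by
    refine (hY.coord_tendstoInMeasure tendsto_log_sq_div 1).congr' ?_ EventuallyEq.rfl
    filter_upwards [eventually_ge_atTop 1] with n hn
    refine ae_of_all _ fun ω => ?_
    have := (sqrt_sampleSize_pos hn).ne'
    simp [hA, hD]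
    field_simp
  have hlog : ∀ᶠ n : ℕ in atTop, 1 ≤ Real.log (sampleSize n) := by
    have : Tendsto (fun n : ℕ => Real.log (sampleSize n)) atTop atTop :=
      Real.tendsto_log_atTop.comp
        ((tendsto_pow_atTop two_ne_zero).comp tendsto_natCast_atTop_atTop)
    exact this.eventually_ge_atTop 1
  -- With `δ = (log N)(T - c)`, the remainder `√N(e^δ - 1 - δ)` equals `√N(T - c)` times the second
  -- component. As `|e^δ - 1 - δ| ≤ δ²` for `|δ| ≤ 1`, that component is at most `(log N)|δ|`, which
  -- tends to zero in probability. When `δ = 0` the quotient is zero.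
  set V : ℕ → Ω → ℝ × ℝ := fun n ω =>
    (D n ω, Real.log (sampleSize n) * ((Real.exp (D n ω) - 1 - D n ω) / D n ω)) with hV
  have hVlim : TendstoInMeasure P V atTop (fun _ => 0) := by
    refine tendstoInMeasure_zero_of_dominated hAlim ?_
    filter_upwards [hlog] with n hn ω hω
    have h1 : |A n ω| = Real.log (sampleSize n) * |D n ω| := by
      rw [hA, abs_mul, abs_of_nonneg (by linarith)]
    have h2 : |D n ω| ≤ |A n ω| := by
      rw [h1]
      exact le_mul_of_one_le_left (abs_nonneg _) hn
    rw [Prod.norm_def, max_le_iff]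
    refine ⟨h2, ?_⟩
    simp only [hV]
    rw [h1, norm_mul, Real.norm_of_nonneg (by linarith : 0 ≤ Real.log (sampleSize n)),
      Real.norm_eq_abs, abs_div]
    refine mul_le_mul_of_nonneg_left ?_ (by linarith)
    refine div_le_of_le_mul₀ (abs_nonneg _) (abs_nonneg _) ?_
    rw [← pow_two, sq_abs]
    exact Real.abs_exp_sub_one_sub_id_le (h2.trans hω.le)
  have hVm : ∀ n, Measurable (V n) := fun n => by
    have := hDm n
    fun_prop
  have h1 := hY.slutsky hVlim (fun n => (hVm n).aemeasurable)
    (g := fun z => !₂[Real.exp z.2.1 * z.1 0 + z.1 1 * z.2.2, z.1 1])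
    (continuous_vec2 (by fun_prop) (by fun_prop))
    (fun y => by ext i; fin_cases i <;> simp)
  refine h1.congr_of_small (fun n => ?_) hAlim ?_
  · have h2 : Measurable fun ω => (!₂[Real.exp (D n ω) * R n ω - 1 - D n ω, T n ω - c] : Plane) := by
      have := hDm n
      have := hR n
      have := hT n
      exact measurable_vec2 (by fun_prop) (by fun_prop)
    exact (Measurable.const_smul h2 (Real.sqrt (sampleSize n))).aemeasurable
  · filter_upwards [hlog] with n hn ω _
    ext i
    fin_cases i
    · simp only [hV, Fin.zero_eta, PiLp.smul_apply, Matrix.cons_val_zero,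
        Matrix.cons_val_one, Matrix.cons_val_fin_one, smul_eq_mul]
      change _ * (Real.exp (D n ω) * R n ω - 1 - D n ω) = _
      by_cases h0 : T n ω - c = 0
      · have : D n ω = 0 := by simp [hD, h0]
        simp [this, h0]
      · have h3 : Real.log (sampleSize n) * ((Real.exp (D n ω) - 1 - D n ω) / D n ω)
            = (Real.exp (D n ω) - 1 - D n ω) / (T n ω - c) := by
          have : Real.log (sampleSize n) ≠ 0 := by linarith
          simp only [hD]
          field_simp
        rw [h3]
        field_simp
        ring
    · simp

/-- The logarithmic form of the plug-in limit. -/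
lemma TendstoGaussian.log_plugIn (hR : ∀ n, Measurable (R n)) (hT : ∀ n, Measurable (T n))
    (hY : TendstoGaussian P
      (fun n ω => Real.sqrt (sampleSize n) • (!₂[R n ω - 1, T n ω - c] : Plane)) S) :
    TendstoGaussian P (fun n ω => Real.sqrt (sampleSize n) •
      (!₂[Real.log (Real.exp (Real.log (sampleSize n) * (T n ω - c)) * R n ω)
        - Real.log (sampleSize n) * (T n ω - c), T n ω - c] : Plane)) S := by
  set f : ℝ → ℝ := fun x => Real.log (1 + x) with hf
  have hfd : HasDerivAt f 1 0 := by
    have h1 : HasDerivAt (fun x : ℝ => 1 + x) 1 0 := (hasDerivAt_id 0).const_add 1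
    have h2 := h1.log (by norm_num)
    simpa using h2
  -- `l(x) = log(1 + x)/x`, continued by `l(0) = 1`. It gives `log R = (R - 1) l(R - 1)` with no
  -- remainder, and `l(R - 1) → 1` in probability.
  set l : ℝ → ℝ := dslope f 0 with hl
  have hl0 : l 0 = 1 := by rw [hl, dslope_same, hfd.deriv]
  have hlc : ContinuousAt l 0 := continuousAt_dslope_same.2 hfd.differentiableAt
  have hlm : Measurable l := by
    have : l = fun x => if x = 0 then 1 else x⁻¹ * Real.log (1 + x) := by
      ext x
      split_ifs with h
      · rw [h, hl0]
      · rw [hl, dslope_of_ne _ h, slope_def_field]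
        simp [hf]
        ring
    rw [this]
    exact Measurable.ite (measurableSet_singleton 0) measurable_const (by fun_prop)
  have hlmul : ∀ x, x * l x = Real.log (1 + x) := by
    intro x
    have := sub_smul_dslope f 0 x
    simpa [hf] using this
  have hRlim : TendstoInMeasure P (fun n ω => R n ω - 1) atTop (fun _ => 0) := by
    refine (hY.coord_tendstoInMeasure tendsto_inv_sqrt_sampleSize 0).congr' ?_ EventuallyEq.rfl
    filter_upwards [eventually_ge_atTop 1] with n hn
    refine ae_of_all _ fun ω => ?_
    have := (sqrt_sampleSize_pos hn).ne'
    simp [this]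
  have hRm : ∀ n, Measurable fun ω => R n ω - 1 := fun n => (hR n).sub_const 1
  have h1 := hY.slutsky (tendstoInMeasure_comp_const hRlim hlc)
    (fun n => (hlm.comp (hRm n)).aemeasurable)
    (g := fun z => !₂[z.1 0 * z.2, z.1 1])
    (continuous_vec2 (by fun_prop) (by fun_prop))
    (fun y => by ext i; fin_cases i <;> simp [hl0])
  refine h1.congr_of_small (fun n => ?_) hRlim ?_
  · have h2 : Measurable fun ω => (!₂[Real.log (Real.exp (Real.log (sampleSize n) *
        (T n ω - c)) * R n ω) - Real.log (sampleSize n) * (T n ω - c), T n ω - c] : Plane) := by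
      have := hR n
      have := hT n
      exact measurable_vec2 (by fun_prop) (by fun_prop)
    exact (Measurable.const_smul h2 (Real.sqrt (sampleSize n))).aemeasurable
  · refine Eventually.of_forall fun n ω hω => ?_
    -- `|R - 1| < 1` excludes `R = 0`, so the logarithm of the product splits and `δ` cancels.
    have hR0 : R n ω ≠ 0 := by
      intro h0
      simp [h0] at hω
    ext i
    fin_cases i
    · simp only [Fin.zero_eta, PiLp.smul_apply, Matrix.cons_val_zero,
        Matrix.cons_val_one, Matrix.cons_val_fin_one, smul_eq_mul]
      rw [Real.log_mul (Real.exp_ne_zero _) hR0, Real.log_exp, add_sub_cancel_left, mul_assoc,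
        hlmul, add_sub_cancel]
    · simp

end PlugIn

/-! ### The fixed-domain sample -/

section FixedDomain

variable {Ω : Type*}

/-- The field rescaled so that its unit-lattice sample is the amplitude-rescaled fixed-domain
sample of the original one. -/
noncomputable def rescaledField (φ₂ : ℝ) (X : Plane → Ω → ℝ) (n : ℕ) (x : Plane) (ω : Ω) : ℝ :=
  (if n = 0 then 1 else (n : ℝ)⁻¹) ^ (-φ₂) * X ((if n = 0 then 1 else (n : ℝ)⁻¹) • x) ω

/-- The dilation factor is set to `1` at `n = 0`, so that it is positive and self-similarity applies
at every stage. -/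
lemma IsPowerLawField.rescaledField [MeasurableSpace Ω] {P : Measure Ω} {φ₁ φ₂ : ℝ} (hφ₂ : 0 < φ₂)
    {X : Plane → Ω → ℝ} (hX : IsPowerLawField φ₁ φ₂ X P) (n : ℕ) :
    IsPowerLawField φ₁ φ₂ (rescaledField φ₂ X n) P := by
  refine hX.rescale hφ₂ ?_
  split_ifs with h
  · norm_num
  · positivity

lemma thinnedPair_mul (m n : ℕ) (b : Site → Bool) (x : Site → ℝ) (c : ℝ) :
    thinnedPair m n b (fun t => c * x t) = c ^ 2 • thinnedPair m n b x := by
  have h : ∀ j, thinnedQuadVar m j n b (fun t => c * x t) = c ^ 2 * thinnedQuadVar m j n b x := by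
    intro j
    have h1 : ∀ t, bilinDiff m j (fun t => c * x t) t = c * bilinDiff m j x t := by
      intro t
      rw [bilinDiff, bilinDiff, Finset.mul_sum]
      exact Finset.sum_congr rfl fun a _ => by ring
    simp only [thinnedQuadVar, h1, mul_pow, ← Finset.mul_sum, mul_div_assoc]
  ext i
  rw [PiLp.smul_apply, thinnedPair_apply, thinnedPair_apply, h, smul_eq_mul]

/-- Multiplying the data by `n^φ₂` multiplies the quadratic variations by `n^(2φ₂) = N^φ₂`. -/
lemma thinnedPair_rescaledField {φ₂ : ℝ} (X : Plane → Ω → ℝ) (m : ℕ) {n : ℕ} (hn : n ≠ 0)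
    (b : Site → Bool) (ω : Ω) :
    thinnedPair m n b (idSample (rescaledField φ₂ X n) ω)
      = sampleSize n ^ φ₂ • thinnedPair m n b (fdSample X n ω) := by
  have hn' : (0 : ℝ) < n := by positivity
  have e : idSample (rescaledField φ₂ X n) ω
      = fun t => ((n : ℝ)⁻¹ ^ (-φ₂)) * fdSample X n ω t := by
    ext t
    simp [idSample, fdSample, rescaledField, hn]
  rw [e, thinnedPair_mul]
  congr 1
  rw [Real.inv_rpow hn'.le, Real.rpow_neg hn'.le, inv_inv, sampleSize, ← Real.rpow_natCast,
    ← Real.rpow_natCast, ← Real.rpow_mul hn'.le, ← Real.rpow_mul hn'.le, mul_comm]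

end FixedDomain

/-! ### The estimators -/

section Estimators

variable {Ω : Type*} [MeasurableSpace Ω] {P : Measure Ω} [IsProbabilityMeasure P]
  {m : ℕ} {φ₁ φ₂ : ℝ} {Q : ℕ → Ω → Plane}

/-- The moment estimators inherit the Gaussian limit of the quadratic variations. -/
lemma tendstoGaussian_momentMap (hφ₁ : 0 < φ₁) (hφ₂ : 0 < φ₂) (hm : φ₂ < m)
    (hQ : ∀ n, Measurable (Q n))
    (h : TendstoGaussian P (fun n ω => Real.sqrt (sampleSize n) • (Q n ω - meanPair m φ₁ φ₂))
      (asympCov m φ₁ φ₂)) :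
    TendstoGaussian P (fun n ω => Real.sqrt (sampleSize n) •
      (momentMap m (Q n ω) - !₂[φ₁, φ₂])) (deltaCov m φ₁ φ₂) := by
  have h1 := h.delta_method (asympCov_posSemidef hφ₁.le hφ₂ hm) hQ (measurable_momentMap m)
    (differentiableAt_momentMap hφ₁ hφ₂ hm)
  rw [momentMap_meanPair hφ₁ hφ₂ hm] at h1
  exact h1

lemma deltaCov_posSemidef (hφ₁ : 0 < φ₁) (hφ₂ : 0 < φ₂) (hm : φ₂ < m) :
    (deltaCov m φ₁ φ₂).PosSemidef := by
  have := (asympCov_posSemidef hφ₁.le hφ₂ hm).mul_mul_conjTranspose_same (deltaJac m φ₁ φ₂)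
  rwa [Matrix.conjTranspose_eq_transpose_of_trivial] at this

/-- The ratio form of the limit of the moment estimators. -/
lemma tendstoGaussian_momentMap_ratio (hφ₁ : 0 < φ₁) (hφ₂ : 0 < φ₂) (hm : φ₂ < m)
    (hQ : ∀ n, Measurable (Q n))
    (h : TendstoGaussian P (fun n ω => Real.sqrt (sampleSize n) • (Q n ω - meanPair m φ₁ φ₂))
      (asympCov m φ₁ φ₂)) :
    TendstoGaussian P (fun n ω => Real.sqrt (sampleSize n) •
      (!₂[momentMap m (Q n ω) 0 / φ₁ - 1, momentMap m (Q n ω) 1 - φ₂] : Plane))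
      (ratioCov m φ₁ φ₂) := by
  have h1 := (tendstoGaussian_momentMap hφ₁ hφ₂ hm hQ h).map_clm (deltaCov_posSemidef hφ₁ hφ₂ hm)
    (Matrix.toEuclideanCLM (𝕜 := ℝ) (Matrix.diagonal ![1 / φ₁, 1]))
    (M := Matrix.diagonal ![1 / φ₁, 1]) (fun y i => by
      rw [Matrix.ofLp_toEuclideanCLM]; rfl)
  have e : Matrix.diagonal ![1 / φ₁, 1] * deltaCov m φ₁ φ₂ *
      (Matrix.diagonal ![1 / φ₁, 1]).transpose = ratioCov m φ₁ φ₂ := by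
    simp only [ratioCov, ratioJac, deltaCov, Matrix.transpose_mul, Matrix.mul_assoc]
  rw [e] at h1
  convert h1 using 3 with n ω
  ext i
  rw [map_smul, PiLp.smul_apply, PiLp.smul_apply, Matrix.ofLp_toEuclideanCLM,
    Matrix.mulVec_diagonal]
  congr 1
  fin_cases i
  · simp
    field_simp
  · simp

end Estimators

end ThinnedGrid

/-! ### Assembly of the increasing-domain and fixed-domain limits. -/

theorem mainTheorem7 {Ω : Type*} [MeasurableSpace Ω] (P : Measure Ω) [IsProbabilityMeasure P]
    (φ₁ φ₂ : ℝ) (hφ₁ : 0 < φ₁) (hφ₂ : 0 < φ₂) (m : ℕ) (hm : ⌊φ₂⌋₊ + 1 ≤ m)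
    (X : Plane → Ω → ℝ) (hX : IsPowerLawField φ₁ φ₂ X P)
    (p : ℕ → ℝ) (hp : ∀ n, p n ∈ Set.Ioc (0 : ℝ) 1)
    (B : ℕ → Site → Ω → Bool) (hB : IsBernoulliThinning p B X P)
    (hret : Tendsto (fun n => (1 - p n) * Real.sqrt (sampleSize n)) atTop (𝓝 0)) :
    -- the centering constants are the means of the full-grid quadratic variations
    (∀ n : ℕ, 2 * m < n → ∀ i : Fin 2,
      ∫ ω, quadVar m ((i : ℕ) + 1) n (idSample X ω) ∂P = meanPair m φ₁ φ₂ i) ∧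
    -- increasing domain: CLT for the quadratic variations
    TendstoGaussian P
      (fun n ω => Real.sqrt (sampleSize n) • (idPair m X B n ω - meanPair m φ₁ φ₂))
      (asympCov m φ₁ φ₂) ∧
    -- increasing domain: delta-method limit for the estimators
    TendstoGaussian P
      (fun n ω => Real.sqrt (sampleSize n) • (idEst m X B n ω - !₂[φ₁, φ₂]))
      (deltaCov m φ₁ φ₂) ∧
    -- increasing domain: ratio form
    TendstoGaussian P
      (fun n ω => Real.sqrt (sampleSize n) •
        !₂[idEst m X B n ω 0 / φ₁ - 1, idEst m X B n ω 1 - φ₂])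
      (ratioCov m φ₁ φ₂) ∧
    -- fixed domain: CLT for the amplitude-rescaled quadratic variations
    TendstoGaussian P
      (fun n ω => Real.sqrt (sampleSize n) •
        ((sampleSize n ^ φ₂) • fdPair m X B n ω - meanPair m φ₁ φ₂))
      (asympCov m φ₁ φ₂) ∧
    -- fixed domain: ratio CLT for the estimators
    TendstoGaussian P
      (fun n ω => Real.sqrt (sampleSize n) •
        !₂[fdEst m X B n ω 0 / fdScale φ₁ φ₂ n - 1, fdEst m X B n ω 1 - φ₂])
      (ratioCov m φ₁ φ₂) ∧
    -- fixed domain: plug-in form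
    TendstoGaussian P
      (fun n ω => Real.sqrt (sampleSize n) •
        !₂[sampleSize n ^ (fdEst m X B n ω 1) * fdEst m X B n ω 0 / φ₁ - 1
            - Real.log (sampleSize n) * (fdEst m X B n ω 1 - φ₂),
          fdEst m X B n ω 1 - φ₂])
      (ratioCov m φ₁ φ₂) ∧
    -- fixed domain: log form
    TendstoGaussian P
      (fun n ω => Real.sqrt (sampleSize n) •
        !₂[Real.log (sampleSize n ^ (fdEst m X B n ω 1) * fdEst m X B n ω 0 / φ₁)
            - Real.log (sampleSize n) * (fdEst m X B n ω 1 - φ₂),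
          fdEst m X B n ω 1 - φ₂])
      (ratioCov m φ₁ φ₂) := by
  have hm' : φ₂ < m := (Nat.floor_lt hφ₂.le).1 (by omega)
  have hQm : ∀ n, Measurable (idPair m X B n) := fun n =>
    measurable_thinnedPair hX.measurable (hB.measurable n)
  have hid : TendstoGaussian P
      (fun n ω => Real.sqrt (sampleSize n) • (idPair m X B n ω - meanPair m φ₁ φ₂))
      (asympCov m φ₁ φ₂) :=
    tendstoGaussian_thinnedPair hφ₁ hφ₂ hm (fun _ => hX) hB.measurable hB.prob hB.indep_field hret
  -- the fixed-domain sample, seen as the unit-lattice sample of a rescaled field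
  set Q : ℕ → Ω → Plane := fun n ω =>
    thinnedPair m n (fun t => B n t ω) (idSample (rescaledField φ₂ X n) ω) with hQ
  have hX' : ∀ n, IsPowerLawField φ₁ φ₂ (rescaledField φ₂ X n) P := hX.rescaledField hφ₂
  -- The rescaled field is a measurable function of the original one, so it inherits the
  -- independence of the retention pattern.
  have hind : ∀ n, IndepFun (fun ω (x : Plane) => rescaledField φ₂ X n x ω)
      (fun ω (t : grid n) => B n t ω) P := by
    intro n
    have h1 : Measurable fun (f : Plane → ℝ) (x : Plane) =>
        (if n = 0 then 1 else (n : ℝ)⁻¹) ^ (-φ₂) * f ((if n = 0 then 1 else (n : ℝ)⁻¹) • x) :=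
      measurable_pi_lambda _ fun x => (measurable_pi_apply _).const_mul _
    exact (hB.indep_field n).comp h1 measurable_id
  have hQm' : ∀ n, Measurable (Q n) := fun n =>
    measurable_thinnedPair (hX' n).measurable (hB.measurable n)
  have hfd : TendstoGaussian P
      (fun n ω => Real.sqrt (sampleSize n) • (Q n ω - meanPair m φ₁ φ₂)) (asympCov m φ₁ φ₂) :=
    tendstoGaussian_thinnedPair hφ₁ hφ₂ hm hX' hB.measurable hB.prob hind hret
  have hQe : ∀ n, n ≠ 0 → ∀ ω, Q n ω = sampleSize n ^ φ₂ • fdPair m X B n ω := fun n hn ω =>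
    thinnedPair_rescaledField X m hn _ ω
  have hN : ∀ n : ℕ, n ≠ 0 → 0 < sampleSize n := fun n hn => by
    unfold sampleSize; positivity
  have hE0 : ∀ n, n ≠ 0 → ∀ ω,
      momentMap m (Q n ω) 0 / φ₁ = fdEst m X B n ω 0 / fdScale φ₁ φ₂ n := by
    intro n hn ω
    have h1 : sampleSize n ^ φ₂ ≠ 0 := (Real.rpow_pos_of_pos (hN n hn) _).ne'
    rw [hQe n hn, momentMap_smul_zero m h1, fdScale, Real.rpow_neg (hN n hn).le, fdEst]
    field_simp
  have hE1 : ∀ n, n ≠ 0 → ∀ ω, momentMap m (Q n ω) 1 = fdEst m X B n ω 1 := by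
    intro n hn ω
    rw [hQe n hn, momentMap_smul_one m (Real.rpow_pos_of_pos (hN n hn) _).ne', fdEst]
  -- Stage `n = 0` has `√N = 0`, so all normalized vectors agree there, whatever the conventions for
  -- division and powers of zero.
  have hzero : ∀ y y' : Plane, Real.sqrt (sampleSize 0) • y = Real.sqrt (sampleSize 0) • y' := by
    intro y y'
    simp [sampleSize]
  have hR : ∀ n, Measurable fun ω => momentMap m (Q n ω) 0 / φ₁ := fun n =>
    ((by fun_prop : Measurable fun y : Plane => y 0).comp
      ((measurable_momentMap m).comp (hQm' n))).div_const φ₁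
  have hT : ∀ n, Measurable fun ω => momentMap m (Q n ω) 1 := fun n =>
    (by fun_prop : Measurable fun y : Plane => y 1).comp ((measurable_momentMap m).comp (hQm' n))
  have hratio := tendstoGaussian_momentMap_ratio hφ₁ hφ₂ hm' hQm' hfd
  -- Since `1/τ₁ = N^φ₂/φ₁`, the factor `N^(τ̂₂ - φ₂)` turns `τ̂₁/τ₁` into the plug-in scale divided
  -- by `φ₁`.
  have hexp : ∀ n, n ≠ 0 → ∀ ω, Real.exp (Real.log (sampleSize n) * (fdEst m X B n ω 1 - φ₂)) *
      (fdEst m X B n ω 0 / fdScale φ₁ φ₂ n)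
      = sampleSize n ^ (fdEst m X B n ω 1) * fdEst m X B n ω 0 / φ₁ := by
    intro n hn ω
    have h1 : sampleSize n ^ φ₂ ≠ 0 := (Real.rpow_pos_of_pos (hN n hn) _).ne'
    rw [← Real.rpow_def_of_pos (hN n hn), Real.rpow_sub (hN n hn), fdScale,
      Real.rpow_neg (hN n hn).le]
    field_simp
  refine ⟨fun n hn i => hX.integral_quadVar hφ₁ hφ₂ hm hn i, hid,
    tendstoGaussian_momentMap hφ₁ hφ₂ hm' hQm hid,
    tendstoGaussian_momentMap_ratio hφ₁ hφ₂ hm' hQm hid, ?_, ?_, ?_, ?_⟩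
  · convert hfd using 3 with n ω
    rcases eq_or_ne n 0 with rfl | hn
    · exact hzero _ _
    · rw [hQe n hn]
  · convert hratio using 3 with n ω
    rcases eq_or_ne n 0 with rfl | hn
    · exact hzero _ _
    · rw [hE0 n hn, hE1 n hn]
  · convert TendstoGaussian.plugIn hR hT hratio using 3 with n ω
    rcases eq_or_ne n 0 with rfl | hn
    · exact hzero _ _
    · rw [hE0 n hn, hE1 n hn, hexp n hn]
  · convert TendstoGaussian.log_plugIn hR hT hratio using 3 with n ω
    rcases eq_or_ne n 0 with rfl | hn
    · exact hzero _ _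
    · rw [hE0 n hn, hE1 n hn, hexp n hn]
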